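/- **Processes.** Let $N$ be an infinite set of names, with co-names $\bar a$ ($a\in N$) and $\bar{\bar a}=a$; $\lambda,\nu$ range over names and co-names, $\alpha$ over names, co-names and $\tau$. CCS processes are $P,Q ::= 0 \mid \lambda.P \mid P\,|\,Q \mid \lambda.P+\nu.Q \mid P\backslash a$. Memories are $m ::= \emptyset \mid \curlyvee.m \mid \langle i,\lambda,Q\rangle.m$ with $i\in\mathbb N$, and RCCS processes are $R,S ::= m\rhd P \mid R\,|\,S \mid R\backslash a$. Let $\mathrm{ids}(\cdot)$ be the set of identifiers $i$ that occur, and $\mathrm{fn}(m)$ the set of free names of $m$ (those of the $\lambda$'s and of the residuals $Q$). Structural congruence $\equiv$ is the least congruence with $m\rhd(P\,|\,Q)\equiv(\curlyvee.m\rhd P)\,|\,(\curlyvee.m\rhd Q)$, with $m\rhd P\backslash a\equiv(m\rhd P)\backslash a$ if $a\notin\mathrm{fn}(m)$, and with $m\rhd P\equiv m\rhd Q$ whenever $P,Q$ are equal up to $\alpha$-conversion of restricted names and commutativity of $+$. Forward transitions $R\xrightarrow{i:\alpha}S$ and backward transitions $R\rightsquigarrow^{i:\alpha}S$ are generated by the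 following rules, where $\lambda.P$ is read as $\lambda.P+0$: if $i\notin\mathrm{ids}(m)$, then $m\rhd\lambda.P+Q\xrightarrow{i:\lambda}\langle i,\lambda,Q\rangle.m\rhd P$ and $\langle i,\lambda,Q\rangle.m\rhd P\rightsquigarrow^{i:\lambda}m\rhd\lambda.P+Q$; and, in each direction, a transition $i:\lambda$ of $R$ to $R'$ and a transition $i:\bar\lambda$ of $S$ to $S'$ give a transition $i:\tau$ of $R\,|\,S$ to $R'\,|\,S'$; a transition $i:\alpha$ of $R$ to $R'$ gives one of $R\,|\,S$ to $R'\,|\,S$ and of $S\,|\,R$ to $S\,|\,R'$ if $i\notin\mathrm{ids}(S)$, and one of $R\backslash a$ to $R'\backslash a$ if $\alpha\notin\{a,\bar a\}$; transitions are closed under $\equiv$ on both sides. $R$ is reachable from $S$ if it is obtained from $S$ by finitely many forward and backward transitions. **Structures.** A configuration structure $\mathcal C=(E,C,\ell)$ consists of events $E$, configurations $C\subseteq\mathcal P(E)$ and labels $\ell$ on $E$, subject to the usual axioms (finiteness, coincidence freeness, finite completeness, stability). For $x,y\in C$ write $x\to y$ if $y=x\cup\{e\}$ for some $e\notin x$.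 For $x\in C$ and $d,e\in x$, $d\le_x e$ means that every $y\in C$ with $y\subseteq x$ and $e\in y$ contains $d$. An isomorphism is a label-preserving bijection on events which induces a bijection on configurations. The encoding $[\![P]\!]$ is given by $[\![0]\!]=(\emptyset,\{\emptyset\},\emptyset)$; $[\![\lambda.P]\!]$, which adds to $[\![P]\!]$ a new event $e$ labelled $\lambda$, with configurations $\emptyset$ and $x\cup\{e\}$; $[\![\lambda.P+\nu.Q]\!]$, the disjoint sum of $[\![\lambda.P]\!]$ and $[\![\nu.Q]\!]$, with the configurations of either side; $[\![P\backslash a]\!]$, which removes from $[\![P]\!]$ the events labelled $a$ or $\bar a$ and the configurations that contain one; and $[\![P\,|\,Q]\!]$, which is obtained from the product $[\![P]\!]\times[\![Q]\!]$ by giving $(e,\star),(\star,e)$ the label of $e$, giving $(e_1,e_2)$ the label $\tau$ if $e_1,e_2$ have complementary labels, and removing all other pairs (and all configurations that contain one). Here the product of $(E_1,C_1,\ell_1)$ and $(E_2,C_2,\ell_2)$ has the events $(e_1,\star),(\star,e_2),(e_1,e_2)$ with $e_k\in E_k$, and its configurations are the sets $x$ of events such that $\pi_k(x)\in C_k$ for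 $k=1,2$ (where $\star$ is left out); two distinct events of $x$ do not have a common component other than $\star$; every $e\in x$ lies in a finite $z\subseteq x$ with $\pi_k(z)\in C_k$ for $k=1,2$; and any two distinct events of $x$ are separated by (exactly one of them lies in) some $z\subseteq x$ with $\pi_k(z)\in C_k$ for $k=1,2$. The memory encoding $\lfloor R\rfloor$ is such a triple together with an identifier in $\mathbb N$ for each event: $\lfloor m\rhd P\rfloor=\lfloor m\rfloor$, $\lfloor R\backslash a\rfloor=\lfloor R\rfloor$, $\lfloor\curlyvee.m\rfloor=\lfloor m\rfloor$, $\lfloor\emptyset\rfloor=(\emptyset,\{\emptyset\},\emptyset)$; $\lfloor\langle i,\lambda,Q\rangle.m\rfloor$ adds to $\lfloor m\rfloor$ a new event $e$ with label $\lambda$ and identifier $i$, and the configurations $x\cup\{e\}$ for $x$ maximal in $\lfloor m\rfloor$; and $\lfloor R\,|\,S\rfloor$ is obtained from the product of $\lfloor R\rfloor$ and $\lfloor S\rfloor$ by keeping only the events $(e,\star)$ and $(\star,e)$ such that the identifier of $e$ does not occur on the other side, with the label of $e$, and the pairs $(e_1,e_2)$ with equal identifiers and with either complementary labels (new label $\tau$)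 or equal labels (same label), each with the identifier of its component(s), and the configurations that consist of such events. $F\lfloor R\rfloor$ is $\lfloor R\rfloor$ without its identifiers. Events of the memory encodings of two processes are regarded as the same event if they have the same identifier; the restriction of a function between memory encodings is understood in this sense. **Bisimulations on structures.** A *history-preserving bisimulation* (HPB) between $\mathcal C_1$ and $\mathcal C_2$ is a set $\mathcal R$ of triples $(x_1,x_2,f)$, with $x_k\in C_k$ and $f$ a label-preserving bijection from $x_1$ to $x_2$ that is an isomorphism of the orders $\le_{x_1}$ and $\le_{x_2}$, such that $(\emptyset,\emptyset,\emptyset)\in\mathcal R$ and for all $(x_1,x_2,f)\in\mathcal R$: (1) if $x_1\to y_1$, there are $y_2,g$ with $x_2\to y_2$, $g{\restriction}x_1=f$ and $(y_1,y_2,g)\in\mathcal R$; (2) if $x_2\to y_2$, there are $y_1,g$ with $x_1\to y_1$, $g{\restriction}x_1=f$ and $(y_1,y_2,g)\in\mathcal R$. It is *hereditary* (HHPB) if moreover (3) if $y_1\to x_1$, there are $y_2,g$ with $y_2\to x_2$, $g=f{\restriction}y_1$ and $(y_1,y_2,g)\in\mathcal R$; (4) if $y_2\to x_2$, there are $y_1,g$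 with $y_1\to x_1$, $g=f{\restriction}y_1$ and $(y_1,y_2,g)\in\mathcal R$. The weak-function variants wf-HPB and wf-HHPB drop the conditions $g{\restriction}x_1=f$ and $g=f{\restriction}y_1$. $\mathcal C_1$ and $\mathcal C_2$ are HPB (HHPB, wf-HPB, wf-HHPB) if such an $\mathcal R$ exists. **Bisimulations on CCS.** An HPB between CCS processes $P_1$ and $P_2$ is a set $\mathcal R$ of triples $(R_1,R_2,f)$, with $R_k$ reachable from $\emptyset\rhd P_k$ and $f$ an isomorphism from $F\lfloor R_1\rfloor$ to $F\lfloor R_2\rfloor$, such that $(\emptyset\rhd P_1,\emptyset\rhd P_2,\emptyset)\in\mathcal R$ and for all $(R_1,R_2,f)\in\mathcal R$: (1) if $R_1\xrightarrow{i:\alpha}S_1$, there are $j,S_2,g$ with $R_2\xrightarrow{j:\alpha}S_2$, $g{\restriction}F\lfloor R_1\rfloor=f$ and $(S_1,S_2,g)\in\mathcal R$; (2) if $R_2\xrightarrow{i:\alpha}S_2$, there are $j,S_1,g$ with $R_1\xrightarrow{j:\alpha}S_1$, $g{\restriction}F\lfloor R_1\rfloor=f$ and $(S_1,S_2,g)\in\mathcal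 R$. It is an HHPB if moreover (3) if $R_1\rightsquigarrow^{i:\alpha}S_1$, there are $j,S_2,g$ with $R_2\rightsquigarrow^{j:\alpha}S_2$, $g=f{\restriction}F\lfloor S_1\rfloor$ and $(S_1,S_2,g)\in\mathcal R$; (4) if $R_2\rightsquigarrow^{i:\alpha}S_2$, there are $j,S_1,g$ with $R_1\rightsquigarrow^{j:\alpha}S_1$, $g=f{\restriction}F\lfloor S_1\rfloor$ and $(S_1,S_2,g)\in\mathcal R$. The variants wf-HPB and wf-HHPB drop the conditions that relate $g$ to $f$. $P_1$ and $P_2$ are HPB (HHPB, wf-HPB, wf-HHPB) if such an $\mathcal R$ exists. **Theorem.** Let $P_1$ and $P_2$ be CCS processes (possibly with auto-concurrency). Then $P_1$ and $P_2$ are HHPB (resp. wf-HHPB, HPB, wf-HPB) if and only if $[\![P_1]\!]$ and $[\![P_2]\!]$ are HHPB (resp. wf-HHPB, HPB, wf-HPB). -/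

import Mathlib

universe u v

namespace RevCCS

/-! ## Names, labels and CCS processes -/

/-- Visible labels `λ`: names `a` and co-names `a̅`. -/
inductive Vis (N : Type u) : Type u
  | name (a : N) : Vis N
  | coname (a : N) : Vis N

/-- The complement of a visible label. -/
def Vis.compl {N : Type u} : Vis N → Vis N
  | .name a => .coname a
  | .coname a => .name a

/-- The name `a` underlying `a` or `a̅`. -/
def Vis.base {N : Type u} : Vis N → N
  | .name a => a
  | .coname a => a

def Vis.rename {N : Type u} (s : N → N) : Vis N → Vis N
  | .name a => .name (s a)
  | .coname a => .coname (s a)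

/-- Labels `α`: the visible ones and `τ`. -/
inductive Label (N : Type u) : Type u
  | vis (l : Vis N) : Label N
  | tau : Label N

/-- `α ∈ {a, a̅}`. -/
def Label.Mentions {N : Type u} (a : N) : Label N → Prop
  | .vis l => l.base = a
  | .tau => False

/-- CCS processes: `0`, `λ.P`, `P | Q`, `λ.P + ν.Q` and `P \ a`. -/
inductive CCS (N : Type u) : Type u
  | nil : CCS N
  | pre (l : Vis N) (P : CCS N) : CCS N
  | par (P Q : CCS N) : CCS N
  | sum (l : Vis N) (P : CCS N) (k : Vis N) (Q : CCS N) : CCS N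
  | res (P : CCS N) (a : N) : CCS N

namespace CCS

/-- Free names. -/
def fn {N : Type u} : CCS N → Set N
  | nil => ∅
  | pre l P => {l.base} ∪ fn P
  | par P Q => fn P ∪ fn Q
  | sum l P k Q => ({l.base} ∪ fn P) ∪ ({k.base} ∪ fn Q)
  | res P a => fn P \ {a}

/-- Apply `s` to all names of a process, bound ones included. -/
def rename {N : Type u} (s : N → N) : CCS N → CCS N
  | nil => nil
  | pre l P => pre (l.rename s) (rename s P)
  | par P Q => par (rename s P) (rename s Q)
  | sum l P k Q => sum (l.rename s) (rename s P) (k.rename s) (rename s Q)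
  | res P a => res (rename s P) (s a)

open Classical in
/-- The congruence generated by `α`-conversion of restricted names and commutativity of the sum.
In `alpha`, exchanging `a` and the non-free name `b` everywhere in `P` is the (capture-avoiding)
replacement of `a` by `b`, up to `α`-conversion inside `P`. -/
inductive Cong {N : Type u} : CCS N → CCS N → Prop
  | refl (P : CCS N) : Cong P P
  | symm {P Q : CCS N} : Cong P Q → Cong Q P
  | trans {P Q R : CCS N} : Cong P Q → Cong Q R → Cong P R
  | pre (l : Vis N) {P P' : CCS N} : Cong P P' → Cong (pre l P) (pre l P')
  | par {P P' Q Q' : CCS N} : Cong P P' → Cong Q Q' → Cong (par P Q) (par P' Q')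
  | sum (l k : Vis N) {P P' Q Q' : CCS N} : Cong P P' → Cong Q Q' →
      Cong (sum l P k Q) (sum l P' k Q')
  | res (a : N) {P P' : CCS N} : Cong P P' → Cong (res P a) (res P' a)
  | sum_comm (l k : Vis N) (P Q : CCS N) : Cong (sum l P k Q) (sum k Q l P)
  | alpha (P : CCS N) (a b : N) : b ∉ fn P →
      Cong (res P a) (res (rename (Equiv.swap a b) P) b)

end CCS

/-! ## Configuration structures -/

/-- The set `A ×⋆ B = {(a,⋆)} ∪ {(⋆,b)} ∪ {(a,b)}`. -/
inductive StarProd (A : Type u) (B : Type v) : Type (max u v)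
  | left (a : A) : StarProd A B
  | right (b : B) : StarProd A B
  | both (a : A) (b : B) : StarProd A B

namespace StarProd

/-- First projection, `none` being `⋆`. -/
def fst {A : Type u} {B : Type v} : StarProd A B → Option A
  | left a => some a
  | right _ => none
  | both a _ => some a

/-- Second projection, `none` being `⋆`. -/
def snd {A : Type u} {B : Type v} : StarProd A B → Option B
  | left _ => none
  | right b => some b
  | both _ b => some b

def map {A A' : Type*} {B B' : Type*} (f : A → A') (g : B → B') :
    StarProd A B → StarProd A' B'
  | left a => left (f a)
  | right b => right (g b)
  | both a b => both (f a) (g b)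

/-- The identifier `i` carried by `(i,⋆)`, `(⋆,i)` or `(i,i)`. -/
def merge {A : Type u} : StarProd A A → A
  | left a => a
  | right a => a
  | both a _ => a

/-- `π₁(x)`, for a set `x`. -/
def fstImage {A : Type u} {B : Type v} (x : Set (StarProd A B)) : Set A :=
  {a | ∃ e ∈ x, e.fst = some a}

/-- `π₂(x)`, for a set `x`. -/
def sndImage {A : Type u} {B : Type v} (x : Set (StarProd A B)) : Set B :=
  {b | ∃ e ∈ x, e.snd = some b}

end StarProd

/-- The data of a configuration structure labelled in `L`: events, configurations and labelling.
The axioms are in `ConfStruct.IsConfStruct`; they hold for the encoding of every process,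
see `CCS.enc_isConfStruct`. -/
structure ConfStruct (L : Type u) where
  E : Type
  C : Set (Set E)
  lab : E → L

namespace ConfStruct

/-- The axioms of configuration structures. -/
structure IsConfStruct {L : Type u} (S : ConfStruct L) : Prop where
  finiteness : ∀ x ∈ S.C, ∀ e ∈ x, ∃ z ∈ S.C, z.Finite ∧ e ∈ z ∧ z ⊆ x
  coincidence_free : ∀ x ∈ S.C, ∀ e ∈ x, ∀ e' ∈ x, e ≠ e' →
    ∃ z ∈ S.C, z ⊆ x ∧ (e ∈ z ↔ e' ∉ z)
  finite_complete : ∀ X : Set (Set S.E), X ⊆ S.C →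
    (∃ y ∈ S.C, y.Finite ∧ ∀ x ∈ X, x ⊆ y) → ⋃₀ X ∈ S.C
  stable : ∀ x ∈ S.C, ∀ y ∈ S.C, x ∪ y ∈ S.C → x ∩ y ∈ S.C

/-- The transition `x → y` performing the event `e`; read from `y` to `x`, it is the backward
transition undoing `e`. -/
def Step {L : Type u} (S : ConfStruct L) (x : Set S.E) (e : S.E) (y : Set S.E) : Prop :=
  x ∈ S.C ∧ y ∈ S.C ∧ e ∉ x ∧ y = insert e x

/-- Causality `d ≤ₓ e` in the configuration `x` (used for `d, e ∈ x`). -/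
def Le {L : Type u} (S : ConfStruct L) (x : Set S.E) (d e : S.E) : Prop :=
  ∀ y ∈ S.C, y ⊆ x → e ∈ y → d ∈ y

/-- `x` is a maximal configuration. -/
def IsMaximal {L : Type u} (S : ConfStruct L) (x : Set S.E) : Prop :=
  x ∈ S.C ∧ ∀ y ∈ S.C, x = y ∨ ¬ x ⊆ y

/-- The structure `0`. -/
def zero (L : Type u) : ConfStruct L where
  E := Empty
  C := {∅}
  lab := Empty.elim

/-- The product. -/
def prod {L : Type u} {L' : Type v} (S : ConfStruct L) (T : ConfStruct L') :
    ConfStruct (StarProd L L') where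
  E := StarProd S.E T.E
  C := {x | (StarProd.fstImage x ∈ S.C ∧ StarProd.sndImage x ∈ T.C) ∧
    (∀ e ∈ x, ∀ e' ∈ x, (e.fst = e'.fst ∧ e.fst ≠ none) ∨ (e.snd = e'.snd ∧ e.snd ≠ none) →
      e = e') ∧
    (∀ e ∈ x, ∃ z ⊆ x, z.Finite ∧ StarProd.fstImage z ∈ S.C ∧ StarProd.sndImage z ∈ T.C ∧
      e ∈ z) ∧
    (∀ e ∈ x, ∀ e' ∈ x, e ≠ e' → ∃ z ⊆ x, StarProd.fstImage z ∈ S.C ∧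
      StarProd.sndImage z ∈ T.C ∧ (e ∈ z ↔ e' ∉ z))}
  lab := StarProd.map S.lab T.lab

/-- The restriction to a set `F` of events. -/
def restrict {L : Type u} (S : ConfStruct L) (F : Set S.E) : ConfStruct L where
  E := {e : S.E // e ∈ F}
  C := {x | Subtype.val '' x ∈ S.C}
  lab := fun e => S.lab e.1

/-- Relabelling along `r`, where `none` plays the role of `⊥`, followed by the restriction to the
events not labelled `⊥`. -/
def relabelRestrict {L : Type u} {L' : Type v} (S : ConfStruct L) (r : S.E → Option L') :
    ConfStruct L' where
  E := {e : S.E // (r e).isSome}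
  C := {x | Subtype.val '' x ∈ S.C}
  lab := fun e => (r e.1).get e.2

open Classical in
/-- Labels of the parallel composition: a single event keeps its label, two events with
complementary labels give `τ`, all other pairs are `⊥`. -/
noncomputable def parLabel {N : Type u} : StarProd (Label N) (Label N) → Option (Label N)
  | .left α => some α
  | .right α => some α
  | .both (.vis l) (.vis k) => if k = l.compl then some .tau else none
  | .both _ _ => none

/-- The parallel composition. -/
noncomputable def par {N : Type u} (S T : ConfStruct (Label N)) : ConfStruct (Label N) :=
  (S.prod T).relabelRestrict (fun e => parLabel ((S.prod T).lab e))

/-- The restriction to a name `a`: events labelled `a` or `a̅` are removed. -/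
def resName {N : Type u} (S : ConfStruct (Label N)) (a : N) : ConfStruct (Label N) :=
  S.restrict {e | ¬ (S.lab e).Mentions a}

/-- The coproduct. -/
def coprod {L : Type u} (S T : ConfStruct L) : ConfStruct L where
  E := S.E ⊕ T.E
  C := {x | (∃ y ∈ S.C, x = Sum.inl '' y) ∨ (∃ y ∈ T.C, x = Sum.inr '' y)}
  lab := Sum.elim S.lab T.lab

/-- Prefixing by a label; the new event is `none`. -/
def pre {L : Type u} (l : L) (S : ConfStruct L) : ConfStruct L where
  E := Option S.E
  C := {x | x = ∅ ∨ ∃ y ∈ S.C, x = insert none (some '' y)}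
  lab := fun e => e.elim l S.lab

/-- Isomorphisms of configuration structures over the same labels: label-preserving bijections on
events that induce a bijection on configurations. -/
structure Iso {L : Type u} (S T : ConfStruct L) where
  toEquiv : S.E ≃ T.E
  lab_eq : ∀ e, T.lab (toEquiv e) = S.lab e
  conf_iff : ∀ x : Set S.E, x ∈ S.C ↔ toEquiv '' x ∈ T.C

/-- The identity isomorphism. -/
def Iso.refl {L : Type u} (S : ConfStruct L) : Iso S S where
  toEquiv := Equiv.refl S.E
  lab_eq := fun _ => rfl
  conf_iff := fun x => by simp

/-! ### (Hereditary) history-preserving bisimulations on configuration structures -/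

open Classical in
/-- The restriction of a partial function to a set. -/
noncomputable def restr {A B : Type} (f : A → Option B) (x : Set A) : A → Option B :=
  fun e => if e ∈ x then f e else none

/-- The partial function `f` is a label- and order-preserving bijection from `x₁` to `x₂`, i.e.
an isomorphism of labelled partially ordered sets. -/
structure IsLabelOrderBij {L : Type u} (S T : ConfStruct L) (x₁ : Set S.E) (x₂ : Set T.E)
    (f : S.E → Option T.E) : Prop where
  dom : ∀ e, (∃ d, f e = some d) ↔ e ∈ x₁
  range : ∀ d, (∃ e, f e = some d) ↔ d ∈ x₂
  inj : ∀ e e' d, f e = some d → f e' = some d → e = e'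
  label : ∀ e d, f e = some d → S.lab e = T.lab d
  order : ∀ e e' d d', f e = some d → f e' = some d' → (S.Le x₁ e e' ↔ T.Le x₂ d d')

/-- `R` is a bisimulation between `S` and `T`: a history-preserving one, or, if `her` holds, a
hereditary one. If `keep` holds the bijections have to be preserved from one step to the next; if
not, this is the weak-function variant. -/
structure IsBisim {L : Type u} (keep her : Prop) (S T : ConfStruct L)
    (R : Set S.E → Set T.E → (S.E → Option T.E) → Prop) : Prop where
  conf : ∀ x₁ x₂ f, R x₁ x₂ f → x₁ ∈ S.C ∧ x₂ ∈ T.C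
  init : R ∅ ∅ (fun _ => none)
  bij : ∀ x₁ x₂ f, R x₁ x₂ f → IsLabelOrderBij S T x₁ x₂ f
  fwd₁ : ∀ x₁ x₂ f, R x₁ x₂ f → ∀ e₁ y₁, S.Step x₁ e₁ y₁ →
    ∃ e₂ y₂ g, T.Step x₂ e₂ y₂ ∧ (keep → restr g x₁ = f) ∧ R y₁ y₂ g
  fwd₂ : ∀ x₁ x₂ f, R x₁ x₂ f → ∀ e₂ y₂, T.Step x₂ e₂ y₂ →
    ∃ e₁ y₁ g, S.Step x₁ e₁ y₁ ∧ (keep → restr g x₁ = f) ∧ R y₁ y₂ g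
  bwd₁ : her → ∀ x₁ x₂ f, R x₁ x₂ f → ∀ e₁ y₁, S.Step y₁ e₁ x₁ →
    ∃ e₂ y₂ g, T.Step y₂ e₂ x₂ ∧ (keep → g = restr f y₁) ∧ R y₁ y₂ g
  bwd₂ : her → ∀ x₁ x₂ f, R x₁ x₂ f → ∀ e₂ y₂, T.Step y₂ e₂ x₂ →
    ∃ e₁ y₁ g, S.Step y₁ e₁ x₁ ∧ (keep → g = restr f y₁) ∧ R y₁ y₂ g

/-- History-preserving bisimilarity. -/
def HPB {L : Type u} (S T : ConfStruct L) : Prop := ∃ R, IsBisim True False S T R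

/-- Hereditary history-preserving bisimilarity. -/
def HHPB {L : Type u} (S T : ConfStruct L) : Prop := ∃ R, IsBisim True True S T R

/-- Weak-function history-preserving bisimilarity. -/
def WfHPB {L : Type u} (S T : ConfStruct L) : Prop := ∃ R, IsBisim False False S T R

/-- Weak-function hereditary history-preserving bisimilarity. -/
def WfHHPB {L : Type u} (S T : ConfStruct L) : Prop := ∃ R, IsBisim False True S T R

end ConfStruct

/-- The encoding `⟦P⟧` of a CCS process as a configuration structure. -/
noncomputable def CCS.enc {N : Type u} : CCS N → ConfStruct (Label N)
  | .nil => ConfStruct.zero (Label N)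
  | .pre l P => ConfStruct.pre (.vis l) P.enc
  | .par P Q => P.enc.par Q.enc
  | .sum l P k Q => (ConfStruct.pre (.vis l) P.enc).coprod (ConfStruct.pre (.vis k) Q.enc)
  | .res P a => P.enc.resName a

/-! ## The encoding of a process is a configuration structure -/

namespace ConfStruct

theorem IsConfStruct.empty_mem {L : Type u} {S : ConfStruct L} (hS : S.IsConfStruct)
    [Finite S.E] {y : Set S.E} (hy : y ∈ S.C) : ∅ ∈ S.C := by
  have := hS.finite_complete ∅ (Set.empty_subset _) ⟨y, hy, Set.toFinite y, by simp⟩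
  simpa using this

theorem IsConfStruct.inter_mem {L : Type u} {S : ConfStruct L} (hS : S.IsConfStruct)
    [Finite S.E] {x y z : Set S.E} (hx : x ∈ S.C) (hy : y ∈ S.C) (hz : z ∈ S.C)
    (hxz : x ⊆ z) (hyz : y ⊆ z) : x ∩ y ∈ S.C := by
  refine hS.stable x hx y hy ?_
  have := hS.finite_complete {x, y} (by rintro w (rfl | rfl) <;> assumption)
    ⟨z, hz, Set.toFinite z, by rintro w (rfl | rfl) <;> assumption⟩
  simpa using this

theorem isConfStruct_of_injective {L : Type u} {L' : Type v} {S : ConfStruct L}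
    (hS : S.IsConfStruct) {T : ConfStruct L'} [Finite T.E] (j : T.E → S.E)
    (hj : Function.Injective j) (hC : ∀ x, x ∈ T.C ↔ j '' x ∈ S.C) : T.IsConfStruct where
  finiteness x hx e he := ⟨x, hx, Set.toFinite x, he, subset_rfl⟩
  coincidence_free x hx e he e' he' hne := by
    obtain ⟨z, hz, hzx, h⟩ := hS.coincidence_free _ ((hC x).1 hx) _ (Set.mem_image_of_mem j he) _
      (Set.mem_image_of_mem j he') (hj.ne hne)
    refine ⟨j ⁻¹' z, (hC _).2 ?_, fun a ha => ?_, h⟩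
    · rwa [Set.image_preimage_eq_of_subset (hzx.trans (Set.image_subset_range _ _))]
    · obtain ⟨b, hb, hba⟩ := hzx ha
      exact hj hba ▸ hb
  finite_complete X hX := by
    rintro ⟨y, hy, _, h⟩
    rw [hC, Set.sUnion_eq_biUnion, Set.image_iUnion₂]
    have := hS.finite_complete ((fun x => j '' x) '' X)
      (by rintro _ ⟨x, hx, rfl⟩; exact (hC x).1 (hX hx))
      ⟨j '' y, (hC y).1 hy, Set.toFinite _, by
        rintro _ ⟨x, hx, rfl⟩; exact Set.image_mono (h x hx)⟩
    rwa [Set.sUnion_image] at this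
  stable x hx y hy hxy := by
    rw [hC, Set.image_inter hj]
    refine hS.stable _ ((hC x).1 hx) _ ((hC y).1 hy) ?_
    rw [← Set.image_union]
    exact (hC _).1 hxy

theorem zero_isConfStruct (L : Type u) : (zero L).IsConfStruct where
  finiteness x _ e _ := e.elim
  coincidence_free x _ e _ := e.elim
  finite_complete X _ _ := by
    show _ = _
    ext e; exact e.elim
  stable x _ y _ _ := by
    show _ = _
    ext e; exact e.elim

theorem coprod_isConfStruct {L : Type u} {S T : ConfStruct L} [Finite S.E] [Finite T.E]
    (hS : S.IsConfStruct) (hT : T.IsConfStruct) : (S.coprod T).IsConfStruct := by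
  have hfin : Finite (S.coprod T).E := inferInstanceAs (Finite (S.E ⊕ T.E))
  have key : ∀ y ∈ (S.coprod T).C, ∃ (W : ConfStruct L) (_ : W.IsConfStruct) (_ : Finite W.E)
      (j : W.E → (S.coprod T).E), Function.Injective j ∧ (∀ x, j '' x ⊆ y → 
        (x ∈ W.C ↔ j '' x ∈ (S.coprod T).C)) ∧ y ⊆ Set.range j := by
    rintro _ (⟨y, hy, rfl⟩ | ⟨y, hy, rfl⟩)
    · refine ⟨S, hS, inferInstance, Sum.inl, Sum.inl_injective, fun x hx => ?_,
        Set.image_subset_range _ _⟩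
      constructor
      · exact fun h => Or.inl ⟨x, h, rfl⟩
      · rintro (⟨z, hz, h⟩ | ⟨z, hz, h⟩)
        · rwa [Sum.inl_injective.image_injective h]
        · have : x = ∅ := by
            ext a
            simp only [Set.mem_empty_iff_false, iff_false]
            intro ha
            have : Sum.inl a ∈ Sum.inr '' z := h ▸ Set.mem_image_of_mem _ ha
            simp at this
          rw [this]; exact hS.empty_mem hy
    · refine ⟨T, hT, inferInstance, Sum.inr, Sum.inr_injective, fun x hx => ?_,
        Set.image_subset_range _ _⟩
      constructor
      · exact fun h => Or.inr ⟨x, h, rfl⟩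
      · rintro (⟨z, hz, h⟩ | ⟨z, hz, h⟩)
        · have : x = ∅ := by
            ext a
            simp only [Set.mem_empty_iff_false, iff_false]
            intro ha
            have : Sum.inr a ∈ Sum.inl '' z := h ▸ Set.mem_image_of_mem _ ha
            simp at this
          rw [this]; exact hT.empty_mem hy
        · rwa [Sum.inr_injective.image_injective h]
  refine ⟨fun x hx e he => ⟨x, hx, Set.toFinite x, he, subset_rfl⟩, ?_, ?_, ?_⟩
  · intro x hx e he e' he' hne
    obtain ⟨W, hW, _, j, hj, hC, hr⟩ := key x hx
    obtain ⟨x, rfl⟩ := Set.subset_range_iff_exists_image_eq.1 hr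
    obtain ⟨a, ha, rfl⟩ := he
    obtain ⟨a', ha', rfl⟩ := he'
    obtain ⟨z, hz, hzx, h⟩ := hW.coincidence_free x ((hC x subset_rfl).2 hx) a ha a' ha'
      (fun h => hne (h ▸ rfl))
    exact ⟨j '' z, (hC z (Set.image_mono hzx)).1 hz, Set.image_mono hzx, by
      simpa [hj.eq_iff] using h⟩
  · rintro X hX ⟨y, hy, -, h⟩
    obtain ⟨W, hW, _, j, hj, hC, hr⟩ := key y hy
    obtain ⟨y, rfl⟩ := Set.subset_range_iff_exists_image_eq.1 hr
    have hX' : ∀ x ∈ X, j '' (j ⁻¹' x) = x := fun x hx =>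
      Set.image_preimage_eq_of_subset ((h x hx).trans hr)
    have hU := hW.finite_complete ((fun x => j ⁻¹' x) '' X)
      (by
        rintro _ ⟨x, hx, rfl⟩
        have e := hX' x hx
        refine (hC _ ?_).2 ?_
        · dsimp only; rw [e]; exact h x hx
        · dsimp only; rw [e]; exact hX hx)
      ⟨y, (hC y subset_rfl).2 hy, Set.toFinite _, by
        rintro _ ⟨x, hx, rfl⟩
        intro a ha
        obtain ⟨b, hb, hba⟩ := h x hx ha
        exact hj hba ▸ hb⟩
    have e : j '' ⋃₀ ((fun x => j ⁻¹' x) '' X) = ⋃₀ X := by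
      rw [Set.sUnion_image, Set.image_iUnion₂, Set.sUnion_eq_biUnion]
      exact Set.iUnion₂_congr hX'
    rw [← e]
    refine (hC _ ?_).1 hU
    rw [e]; exact Set.sUnion_subset h
  · intro x hx y hy hxy
    obtain ⟨W, hW, _, j, hj, hC, hr⟩ := key _ hxy
    obtain ⟨x, rfl⟩ := Set.subset_range_iff_exists_image_eq.1 (Set.subset_union_left.trans hr)
    obtain ⟨y, rfl⟩ := Set.subset_range_iff_exists_image_eq.1 (Set.subset_union_right.trans hr)
    rw [← Set.image_inter hj]
    refine (hC _ ?_).1 (hW.stable _ ((hC _ Set.subset_union_left).2 hx) _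
      ((hC _ Set.subset_union_right).2 hy) ((hC _ ?_).2 ?_))
    · exact (Set.image_mono Set.inter_subset_left).trans Set.subset_union_left
    · rw [Set.image_union]
    · rwa [Set.image_union]

theorem pre_isConfStruct {L : Type u} (l : L) {S : ConfStruct L} [Finite S.E]
    (hS : S.IsConfStruct) : (S.pre l).IsConfStruct := by
  have hfin : Finite (S.pre l).E := inferInstanceAs (Finite (Option S.E))
  have hmem : ∀ x : Set (Option S.E), x ∈ (S.pre l).C ↔
      x = ∅ ∨ (none ∈ x ∧ some ⁻¹' x ∈ S.C) := by
    intro x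
    refine or_congr Iff.rfl ⟨?_, fun h => ⟨_, h.2, ?_⟩⟩
    · rintro ⟨y, hy, rfl⟩
      refine ⟨Set.mem_insert _ _, ?_⟩
      have : (some ⁻¹' (insert none (some '' y)) : Set S.E) = y := by ext; simp
      rwa [this]
    · ext (_ | a) <;> simp [h.1]
  refine ⟨fun x hx e he => ⟨x, hx, Set.toFinite x, he, subset_rfl⟩, ?_, ?_, ?_⟩
  · intro x hx e he e' he' hne
    rcases (hmem x).1 hx with rfl | ⟨hn, hx'⟩
    · exact absurd he (Set.notMem_empty e)
    have hsing : ∀ z : Set (Option S.E), z = {none} → z ∈ (S.pre l).C := by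
      rintro _ rfl
      refine (hmem _).2 (Or.inr ⟨rfl, ?_⟩)
      have : (some ⁻¹' {none} : Set S.E) = ∅ := by ext; simp
      rw [this]; exact hS.empty_mem hx'
    rcases e with _ | a <;> rcases e' with _ | a'
    · exact absurd rfl hne
    · exact ⟨{none}, hsing _ rfl, Set.singleton_subset_iff.2 hn,
        iff_of_true rfl (fun h => Option.some_ne_none a' h)⟩
    · exact ⟨{none}, hsing _ rfl, Set.singleton_subset_iff.2 hn,
        iff_of_false (fun h => Option.some_ne_none a h) (not_not_intro rfl)⟩
    · obtain ⟨z, hz, hzx, h⟩ := hS.coincidence_free _ hx' a he a' he' (fun h => hne (h ▸ rfl))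
      have hm : ∀ b, (some b : Option S.E) ∈ insert none (some '' z) ↔ b ∈ z := by simp
      exact ⟨insert none (some '' z), Or.inr ⟨z, hz, rfl⟩,
        Set.insert_subset hn (Set.image_subset_iff.2 hzx), (hm a).trans (h.trans (hm a').symm.not)⟩
  · rintro X hX ⟨y, hy, -, h⟩
    by_cases hne : ∃ x ∈ X, x ≠ ∅
    · obtain ⟨x₀, hx₀, hx₀ne⟩ := hne
      have hn : none ∈ x₀ := (((hmem x₀).1 (hX hx₀)).resolve_left hx₀ne).1
      rcases (hmem y).1 hy with rfl | ⟨_, hy'⟩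
      · exact absurd (Set.subset_empty_iff.1 (h x₀ hx₀)) hx₀ne
      refine (hmem _).2 (Or.inr ⟨⟨x₀, hx₀, hn⟩, ?_⟩)
      have := hS.finite_complete ((fun x => some ⁻¹' x) '' X)
        (by
          rintro _ ⟨x, hx, rfl⟩
          rcases (hmem x).1 (hX hx) with rfl | ⟨_, h'⟩
          · simpa using hS.empty_mem hy'
          · exact h')
        ⟨_, hy', Set.toFinite _, by
          rintro _ ⟨x, hx, rfl⟩; exact Set.preimage_mono (h x hx)⟩
      have e : (some ⁻¹' ⋃₀ X : Set S.E) = ⋃₀ ((fun x => some ⁻¹' x) '' X) := by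
        ext a
        exact ⟨fun ⟨x, hx, ha⟩ => ⟨_, ⟨x, hx, rfl⟩, ha⟩,
          fun ⟨_, ⟨x, hx, e⟩, ha⟩ => ⟨x, hx, by subst e; exact ha⟩⟩
      exact e ▸ this
    · push Not at hne
      refine (hmem _).2 (Or.inl (Set.sUnion_eq_empty.2 hne))
  · intro x hx y hy hxy
    rcases (hmem x).1 hx with rfl | ⟨hn, hx'⟩
    · exact (hmem _).2 (Or.inl (Set.empty_inter _))
    rcases (hmem y).1 hy with rfl | ⟨hn', hy'⟩
    · exact (hmem _).2 (Or.inl (Set.inter_empty _))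
    refine (hmem _).2 (Or.inr ⟨⟨hn, hn'⟩, ?_⟩)
    rcases (hmem _).1 hxy with h | ⟨_, h⟩
    · exact absurd (h ▸ Or.inl hn : none ∈ (∅ : Set (Option S.E))) (Set.notMem_empty _)
    · exact hS.stable _ hx' _ hy' h

theorem prod_finite {L : Type u} {L' : Type v} (S : ConfStruct L) (T : ConfStruct L')
    [Finite S.E] [Finite T.E] : Finite (S.prod T).E := by
  refine Finite.of_injective
    (fun e : StarProd S.E T.E => (e.fst, e.snd)) ?_
  rintro (a | b | ⟨a, b⟩) (a' | b' | ⟨a', b'⟩) h <;>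
    simp only [StarProd.fst, StarProd.snd, Prod.mk.injEq, Option.some.injEq, reduceCtorEq,
      false_and, and_false, and_true, true_and] at h
  · rw [h]
  · rw [h]
  · rw [h.1, h.2]

theorem prod_isConfStruct {L : Type u} {L' : Type v} {S : ConfStruct L} {T : ConfStruct L'}
    [Finite S.E] [Finite T.E] (hS : S.IsConfStruct) (hT : T.IsConfStruct) :
    (S.prod T).IsConfStruct := by
  have hfin : Finite (S.prod T).E := prod_finite S T
  have hfst : ∀ {w v : Set (StarProd S.E T.E)}, w ⊆ v →
      StarProd.fstImage w ⊆ StarProd.fstImage v :=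
    fun h a ⟨e, he, h'⟩ => ⟨e, h he, h'⟩
  have hsnd : ∀ {w v : Set (StarProd S.E T.E)}, w ⊆ v →
      StarProd.sndImage w ⊆ StarProd.sndImage v :=
    fun h a ⟨e, he, h'⟩ => ⟨e, h he, h'⟩
  -- sets with good projections, and local injectivity
  let P : Set (StarProd S.E T.E) → Prop := fun w =>
    StarProd.fstImage w ∈ S.C ∧ StarProd.sndImage w ∈ T.C
  have inter : ∀ x ∈ (S.prod T).C, ∀ v w, v ⊆ x → w ⊆ x → P v → P w → P (v ∩ w) := by
    rintro x ⟨hP, hi, -, -⟩ v w hv hw hPv hPw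
    have h1 : StarProd.fstImage (v ∩ w) = StarProd.fstImage v ∩ StarProd.fstImage w := by
      refine Set.Subset.antisymm (Set.subset_inter (hfst Set.inter_subset_left)
        (hfst Set.inter_subset_right)) ?_
      rintro a ⟨⟨e, he, h⟩, ⟨e', he', h'⟩⟩
      have : e = e' := hi e (hv he) e' (hw he') (Or.inl ⟨h.trans h'.symm, by simp [h]⟩)
      exact ⟨e, ⟨he, this ▸ he'⟩, h⟩
    have h2 : StarProd.sndImage (v ∩ w) = StarProd.sndImage v ∩ StarProd.sndImage w := by
      refine Set.Subset.antisymm (Set.subset_inter (hsnd Set.inter_subset_left)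
        (hsnd Set.inter_subset_right)) ?_
      rintro a ⟨⟨e, he, h⟩, ⟨e', he', h'⟩⟩
      have : e = e' := hi e (hv he) e' (hw he') (Or.inr ⟨h.trans h'.symm, by simp [h]⟩)
      exact ⟨e, ⟨he, this ▸ he'⟩, h⟩
    refine ⟨?_, ?_⟩
    · rw [h1]; exact hS.inter_mem hPv.1 hPw.1 hP.1 (hfst hv) (hfst hw)
    · rw [h2]; exact hT.inter_mem hPv.2 hPw.2 hP.2 (hsnd hv) (hsnd hw)
  -- subsets with good projections are configurations
  have sub : ∀ x ∈ (S.prod T).C, ∀ w, w ⊆ x → P w → w ∈ (S.prod T).C := by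
    intro x hx w hw hPw
    refine ⟨hPw, fun e he e' he' => hx.2.1 e (hw he) e' (hw he'),
      fun e he => ⟨w, subset_rfl, Set.toFinite (α := (S.prod T).E) w, hPw.1, hPw.2, he⟩,
      fun e he e' he' hne => ?_⟩
    obtain ⟨z, hz, h1, h2, h⟩ := hx.2.2.2 e (hw he) e' (hw he') hne
    have := inter x hx z w hz hw ⟨h1, h2⟩ hPw
    exact ⟨z ∩ w, Set.inter_subset_right, this.1, this.2,
      (and_iff_left he).trans (h.trans (and_iff_left he').symm.not)⟩
  refine ⟨fun x hx e he => ⟨x, hx, Set.toFinite x, he, subset_rfl⟩, ?_, ?_, ?_⟩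
  · intro x hx e he e' he' hne
    obtain ⟨z, hz, h1, h2, h⟩ := hx.2.2.2 e he e' he' hne
    exact ⟨z, sub x hx z hz ⟨h1, h2⟩, hz, h⟩
  · rintro X hX ⟨y, hy, -, h⟩
    refine sub y hy _ (Set.sUnion_subset h) ⟨?_, ?_⟩
    · have := hS.finite_complete (StarProd.fstImage '' X)
        (by rintro _ ⟨x, hx, rfl⟩; exact (hX hx).1.1)
        ⟨_, hy.1.1, Set.toFinite _, by rintro _ ⟨x, hx, rfl⟩; exact hfst (h x hx)⟩
      convert this using 1
      ext a
      exact ⟨fun ⟨e, ⟨x, hx, he⟩, h⟩ => ⟨_, ⟨x, hx, rfl⟩, e, he, h⟩,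
        fun ⟨_, ⟨x, hx, hxe⟩, ha⟩ => by
          subst hxe
          obtain ⟨e, he, h⟩ := ha
          exact ⟨e, ⟨x, hx, he⟩, h⟩⟩
    · have := hT.finite_complete (StarProd.sndImage '' X)
        (by rintro _ ⟨x, hx, rfl⟩; exact (hX hx).1.2)
        ⟨_, hy.1.2, Set.toFinite _, by rintro _ ⟨x, hx, rfl⟩; exact hsnd (h x hx)⟩
      convert this using 1
      ext a
      exact ⟨fun ⟨e, ⟨x, hx, he⟩, h⟩ => ⟨_, ⟨x, hx, rfl⟩, e, he, h⟩,
        fun ⟨_, ⟨x, hx, hxe⟩, ha⟩ => by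
          subst hxe
          obtain ⟨e, he, h⟩ := ha
          exact ⟨e, ⟨x, hx, he⟩, h⟩⟩
  · intro x hx y hy hxy
    exact sub _ hxy _ (Set.inter_subset_left.trans Set.subset_union_left)
      (inter _ hxy x y Set.subset_union_left Set.subset_union_right hx.1 hy.1)

end ConfStruct

/-- The encoding of every process is a configuration structure, with finitely many events. -/
theorem CCS.enc_isConfStruct {N : Type u} (P : CCS N) :
    Finite P.enc.E ∧ P.enc.IsConfStruct := by
  have pre : ∀ (l : Vis N) (P : CCS N), Finite P.enc.E ∧ P.enc.IsConfStruct →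
      Finite (ConfStruct.pre (.vis l) P.enc).E ∧
        (ConfStruct.pre (Label.vis l) P.enc).IsConfStruct := by
    rintro l P ⟨_, h⟩
    exact ⟨inferInstanceAs (Finite (Option P.enc.E)), ConfStruct.pre_isConfStruct _ h⟩
  induction P with
  | nil => exact ⟨inferInstanceAs (Finite Empty), ConfStruct.zero_isConfStruct _⟩
  | pre l P ih => exact pre l P ih
  | par P Q ihP ihQ =>
    obtain ⟨_, hP⟩ := ihP
    obtain ⟨_, hQ⟩ := ihQ
    have := ConfStruct.prod_finite P.enc Q.enc
    have hf : Finite (CCS.par P Q).enc.E := by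
      refine Finite.of_injective (β := (P.enc.prod Q.enc).E) Subtype.val Subtype.val_injective
    exact ⟨hf, ConfStruct.isConfStruct_of_injective (ConfStruct.prod_isConfStruct hP hQ)
      Subtype.val Subtype.val_injective fun _ => Iff.rfl⟩
  | sum l P k Q ihP ihQ =>
    obtain ⟨_, hP⟩ := pre l P ihP
    obtain ⟨_, hQ⟩ := pre k Q ihQ
    exact ⟨inferInstanceAs (Finite ((ConfStruct.pre (.vis l) P.enc).E ⊕
      (ConfStruct.pre (.vis k) Q.enc).E)), ConfStruct.coprod_isConfStruct hP hQ⟩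
  | res P a ih =>
    obtain ⟨_, hP⟩ := ih
    have hf : Finite (CCS.res P a).enc.E := by
      refine Finite.of_injective (β := P.enc.E) Subtype.val Subtype.val_injective
    exact ⟨hf, ConfStruct.isConfStruct_of_injective hP Subtype.val Subtype.val_injective
      fun _ => Iff.rfl⟩

/-! ## Identified configuration structures -/

/-- A configuration structure with an identifier, in `I`, for every event; `toConfStruct` is the
underlying configuration structure. Collision freeness (distinct events of a configuration have
distinct identifiers) holds for the encodings of all coherent, hence of all reachable, processes. -/
structure IdConfStruct (L : Type u) (I : Type) extends ConfStruct L where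
  ident : E → I

namespace IdConfStruct

/-- The structure `0`. -/
def zero (L : Type u) (I : Type) : IdConfStruct L I where
  toConfStruct := ConfStruct.zero L
  ident := Empty.elim

/-- The product; the identifiers of a pair are the pair of identifiers. -/
def prod {L : Type u} {L' : Type v} {I I' : Type} (D : IdConfStruct L I)
    (D' : IdConfStruct L' I') : IdConfStruct (StarProd L L') (StarProd I I') where
  toConfStruct := D.toConfStruct.prod D'.toConfStruct
  ident := StarProd.map D.ident D'.ident

open Classical in
/-- The label of a pair of events with the same identifier: `τ` for a synchronisation, the common
label for a fork. Other combinations do not occur in reachable processes and are discarded. -/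
noncomputable def jointLabel {N : Type u} : Label N → Label N → Option (Label N)
  | .vis l, .vis k => if k = l.compl then some .tau else if k = l then some (.vis l) else none
  | .tau, .tau => some .tau
  | _, _ => none

open Classical in
/-- Labels of the parallel composition of identified structures: a pair is kept only if the two
identifiers agree, a single event only if its identifier does not occur on the other side. -/
noncomputable def parLabel {N : Type u} {I : Type} (D D' : IdConfStruct (Label N) I) :
    StarProd D.E D'.E → Option (Label N)
  | .left e => if ∃ e', D.ident e = D'.ident e' then none else some (D.lab e)
  | .right e' => if ∃ e, D.ident e = D'.ident e' then none else some (D'.lab e')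
  | .both e e' => if D.ident e = D'.ident e' then jointLabel (D.lab e) (D'.lab e') else none

/-- The parallel composition. The identifiers of the remaining events have the form `(i,⋆)`,
`(⋆,i)` or `(i,i)`, and are identified with `i`. -/
noncomputable def par {N : Type u} {I : Type} (D D' : IdConfStruct (Label N) I) :
    IdConfStruct (Label N) I where
  toConfStruct := (D.prod D').toConfStruct.relabelRestrict (parLabel D D')
  ident := fun e => ((D.prod D').ident e.1).merge

/-- Add, on top of the maximal configurations, a new event (`none`) with label `l` and
identifier `i`. -/
def push {L : Type u} {I : Type} (i : I) (l : L) (D : IdConfStruct L I) : IdConfStruct L I where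
  E := Option D.E
  C := {x | (∃ y ∈ D.C, x = some '' y) ∨
    ∃ y, D.toConfStruct.IsMaximal y ∧ x = insert none (some '' y)}
  lab := fun e => e.elim l D.lab
  ident := fun e => e.elim i D.ident

end IdConfStruct

/-! ## Reversible CCS -/

/-- Memory stacks: `∅`, `⋎.m` and `⟨i, λ, Q⟩.m`. -/
inductive Mem (N : Type u) : Type u
  | empty : Mem N
  | fork (m : Mem N) : Mem N
  | ev (i : ℕ) (l : Vis N) (Q : CCS N) (m : Mem N) : Mem N

namespace Mem

/-- The identifiers occurring in a memory. -/
def ids {N : Type u} : Mem N → Set ℕ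
  | empty => ∅
  | fork m => ids m
  | ev i _ _ m => {i} ∪ ids m

/-- The free names of a memory. -/
def fn {N : Type u} : Mem N → Set N
  | empty => ∅
  | fork m => fn m
  | ev _ l Q m => ({l.base} ∪ Q.fn) ∪ fn m

/-- The encoding `⌊m⌋` of a memory. -/
def enc {N : Type u} : Mem N → IdConfStruct (Label N) ℕ
  | empty => IdConfStruct.zero (Label N) ℕ
  | fork m => enc m
  | ev i l _ m => (enc m).push i (.vis l)

end Mem

/-- RCCS processes: reversible threads `m ▷ P`, parallel compositions and restrictions. -/
inductive RProc (N : Type u) : Type u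
  | thread (m : Mem N) (P : CCS N) : RProc N
  | par (R S : RProc N) : RProc N
  | res (R : RProc N) (a : N) : RProc N

/-- Directions of transitions. -/
inductive Dir : Type
  | fwd : Dir
  | bwd : Dir

namespace RProc

/-- The identifiers occurring in a process. -/
def ids {N : Type u} : RProc N → Set ℕ
  | thread m _ => m.ids
  | par R S => ids R ∪ ids S
  | res R _ => ids R

/-- The encoding `⌊R⌋` of the memory of a process. -/
noncomputable def enc {N : Type u} : RProc N → IdConfStruct (Label N) ℕ
  | thread m _ => m.enc
  | par R S => (enc R).par (enc S)
  | res R _ => enc R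

/-- Structural congruence: distribution of memory, scope of restriction, and the congruence of
CCS (`α`-conversion and commutativity of sums) in threads. -/
inductive Cong {N : Type u} : RProc N → RProc N → Prop
  | refl (R : RProc N) : Cong R R
  | symm {R S : RProc N} : Cong R S → Cong S R
  | trans {R S T : RProc N} : Cong R S → Cong S T → Cong R T
  | par {R R' S S' : RProc N} : Cong R R' → Cong S S' → Cong (par R S) (par R' S')
  | res (a : N) {R R' : RProc N} : Cong R R' → Cong (res R a) (res R' a)
  | thread (m : Mem N) {P Q : CCS N} : CCS.Cong P Q → Cong (thread m P) (thread m Q)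
  | distrib (m : Mem N) (P Q : CCS N) :
      Cong (thread m (.par P Q)) (par (thread m.fork P) (thread m.fork Q))
  | scope (m : Mem N) (P : CCS N) (a : N) : a ∉ m.fn →
      Cong (thread m (.res P a)) (res (thread m P) a)

/-- The labelled transition system. A prefix `λ.P` is treated as `λ.P + 0`. -/
inductive Step {N : Type u} : Dir → RProc N → ℕ → Label N → RProc N → Prop
  | act_pre (m : Mem N) (i : ℕ) (l : Vis N) (P : CCS N) : i ∉ m.ids →
      Step .fwd (thread m (.pre l P)) i (.vis l) (thread (.ev i l .nil m) P)
  | act_sum (m : Mem N) (i : ℕ) (l k : Vis N) (P Q : CCS N) : i ∉ m.ids →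
      Step .fwd (thread m (.sum l P k Q)) i (.vis l) (thread (.ev i l (.pre k Q) m) P)
  | undo_pre (m : Mem N) (i : ℕ) (l : Vis N) (P : CCS N) : i ∉ m.ids →
      Step .bwd (thread (.ev i l .nil m) P) i (.vis l) (thread m (.pre l P))
  | undo_sum (m : Mem N) (i : ℕ) (l k : Vis N) (P Q : CCS N) : i ∉ m.ids →
      Step .bwd (thread (.ev i l (.pre k Q) m) P) i (.vis l) (thread m (.sum l P k Q))
  | syn (d : Dir) {R R' S S' : RProc N} {i : ℕ} {l : Vis N} :
      Step d R i (.vis l) R' → Step d S i (.vis l.compl) S' →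
      Step d (par R S) i .tau (par R' S')
  | par_left (d : Dir) {R R' : RProc N} (S : RProc N) {i : ℕ} {α : Label N} :
      Step d R i α R' → i ∉ S.ids → Step d (par R S) i α (par R' S)
  | par_right (d : Dir) (R : RProc N) {S S' : RProc N} {i : ℕ} {α : Label N} :
      Step d S i α S' → i ∉ R.ids → Step d (par R S) i α (par R S')
  | res (d : Dir) {R R' : RProc N} (a : N) {i : ℕ} {α : Label N} :
      Step d R i α R' → ¬ α.Mentions a → Step d (res R a) i α (res R' a)
  | cong (d : Dir) {R₁ R R' R₁' : RProc N} {i : ℕ} {α : Label N} :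
      Cong R₁ R → Step d R i α R' → Cong R' R₁' → Step d R₁ i α R₁'

/-- The process `∅ ▷ P`. -/
def start {N : Type u} (P : CCS N) : RProc N := thread .empty P

/-- `R` is reachable from `∅ ▷ P` by forward and backward transitions. -/
def Reachable {N : Type u} (P : CCS N) (R : RProc N) : Prop :=
  Relation.ReflTransGen (fun S T : RProc N => ∃ d i α, Step d S i α T) (start P) R

/-- Isomorphisms between the configuration structures underlying `⌊R₁⌋` and `⌊R₂⌋`. -/
abbrev MemIso {N : Type u} (R₁ R₂ : RProc N) : Type :=
  ConfStruct.Iso R₁.enc.toConfStruct R₂.enc.toConfStruct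

/-- The empty isomorphism between the memories of `∅ ▷ P₁` and `∅ ▷ P₂`. -/
def emptyIso {N : Type u} (P₁ P₂ : CCS N) : MemIso (start P₁) (start P₂) :=
  ConfStruct.Iso.refl (ConfStruct.zero (Label N))

/-- `f` is the restriction of `g` to the events of `⌊R₁⌋`. An event of `⌊Rᵢ⌋` and an event of
`⌊Sᵢ⌋` are the same event when they have the same identifier. -/
def IsRestriction {N : Type u} {R₁ R₂ S₁ S₂ : RProc N} (f : MemIso R₁ R₂) (g : MemIso S₁ S₂) :
    Prop :=
  ∀ e : R₁.enc.E, ∃ e' : S₁.enc.E, S₁.enc.ident e' = R₁.enc.ident e ∧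
    S₂.enc.ident (g.toEquiv e') = R₂.enc.ident (f.toEquiv e)

end RProc

namespace CCS

open RProc in
/-- `B` is a bisimulation between the CCS processes `P₁` and `P₂`, defined on the reversible
processes reachable from them: a history-preserving one, or, if `her` holds, a hereditary one. If
`keep` holds the isomorphisms have to be preserved from one step to the next; if not, this is the
weak-function variant. -/
structure IsBisim {N : Type u} (keep her : Prop) (P₁ P₂ : CCS N)
    (B : (R₁ R₂ : RProc N) → MemIso R₁ R₂ → Prop) : Prop where
  reach : ∀ R₁ R₂ f, B R₁ R₂ f → Reachable P₁ R₁ ∧ Reachable P₂ R₂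
  init : B (start P₁) (start P₂) (emptyIso P₁ P₂)
  fwd₁ : ∀ R₁ R₂ f, B R₁ R₂ f → ∀ i α S₁, Step .fwd R₁ i α S₁ →
    ∃ j S₂, ∃ g : MemIso S₁ S₂, Step .fwd R₂ j α S₂ ∧ (keep → IsRestriction f g) ∧ B S₁ S₂ g
  fwd₂ : ∀ R₁ R₂ f, B R₁ R₂ f → ∀ i α S₂, Step .fwd R₂ i α S₂ →
    ∃ j S₁, ∃ g : MemIso S₁ S₂, Step .fwd R₁ j α S₁ ∧ (keep → IsRestriction f g) ∧ B S₁ S₂ g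
  bwd₁ : her → ∀ R₁ R₂ f, B R₁ R₂ f → ∀ i α S₁, Step .bwd R₁ i α S₁ →
    ∃ j S₂, ∃ g : MemIso S₁ S₂, Step .bwd R₂ j α S₂ ∧ (keep → IsRestriction g f) ∧ B S₁ S₂ g
  bwd₂ : her → ∀ R₁ R₂ f, B R₁ R₂ f → ∀ i α S₂, Step .bwd R₂ i α S₂ →
    ∃ j S₁, ∃ g : MemIso S₁ S₂, Step .bwd R₁ j α S₁ ∧ (keep → IsRestriction g f) ∧ B S₁ S₂ g

/-- History-preserving bisimilarity on CCS. -/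
def HPB {N : Type u} (P₁ P₂ : CCS N) : Prop := ∃ B, IsBisim True False P₁ P₂ B

/-- Hereditary history-preserving bisimilarity on CCS. -/
def HHPB {N : Type u} (P₁ P₂ : CCS N) : Prop := ∃ B, IsBisim True True P₁ P₂ B

/-- Weak-function history-preserving bisimilarity on CCS. -/
def WfHPB {N : Type u} (P₁ P₂ : CCS N) : Prop := ∃ B, IsBisim False False P₁ P₂ B

/-- Weak-function hereditary history-preserving bisimilarity on CCS. -/
def WfHHPB {N : Type u} (P₁ P₂ : CCS N) : Prop := ∃ B, IsBisim False True P₁ P₂ B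

end CCS

end RevCCS

/-! Fix a CCS process `P`. A process `R` derived from ∅ ▷ P remembers which events of ⟦P⟧ it has
performed: they form a configuration `x`, and the identifiers in its memories define an injective
map from `x` to ℕ. The pair is recorded by `Track`. Two facts make reversible processes and
configurations interchangeable. (a) The forward and backward transitions of `R` are exactly the
additions and removals of one event in `x` (`Track.step`, `Track.exists_step`). (b) Through the
identifiers, ⌊R⌋ is the family of configurations of ⟦P⟧ contained in `x` (`Track.exists_event`). The
configurations inside `x` are the subsets of `x` closed under causality
(`ConfStruct.IsConfStruct.mem_iff_of_subset`), so isomorphisms of memories are the same thing as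
label- and order-preserving bijections between configurations (`Compat.isLabelOrderBij`,
`exists_memIso`), and restriction means the same on both sides (`isRestriction_iff`). A bisimulation
on one side therefore induces one on the other, by relating whatever tracks related objects.
Auto-concurrency does no harm, because events are told apart by identifiers and not by labels.
Bisimulations of structures do not ask matching steps to have equal labels; this is recovered by
counting labels in the two configurations (`ConfStruct.IsLabelOrderBij.lab_eq`), which also works
when the bijections are not preserved.

For (a), transitions are derived in subterms and up to ≡, so the invariant has to make sense for
processes that are not themselves derived from some ∅ ▷ P. `RProc.Rep R m X` says that the part of
`R` performed since the common memory `m` is described by the marked structure `X`, a structure some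
of whose events carry identifiers. It is defined by recursion on `R`, and each constructor of
processes corresponds to an operation on marked structures; a past prefix stays in the structure as
a marked event, together with the alternative it discarded. Structural congruence does not change
the represented structure (`RProc.Cong.rep_iff`): distribution of memory holds because ⟦P | Q⟧ is
built from ⟦P⟧ and ⟦Q⟧, extrusion of a restriction because it commutes with prefixes that avoid the
name, and α-conversion because the removed names are the only ones affected. Then `RProc.Step.rep`
turns transitions into moves of the structure, by induction on the derivation, and
`RProc.Rep.exists_step` turns moves into transitions, by induction on a weight that decreases when
memory is distributed or a restriction is extruded. The latter is where infinitely many names are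
needed.

For (b), `Marked.Below` states that an identified structure consists of the memory `m` followed by
the marked events of `X`, and `RProc.Rep.below` proves it for ⌊R⌋. The main case is
`Marked.Below.par`: the shared memory occurs on both sides with equal labels and is glued to one
copy, while a common identifier above it is a synchronisation. -/

namespace RevCCS

/-! ## Renaming of labels -/

/-- Renaming of labels. -/
def Label.rename {N : Type u} (s : N → N) : Label N → Label N
  | .vis l => .vis (l.rename s)
  | .tau => .tau

@[simp] theorem Vis.rename_id {N : Type u} (l : Vis N) : l.rename id = l := by cases l <;> rfl

@[simp] theorem Label.rename_id {N : Type u} (α : Label N) : α.rename id = α := by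
  cases α <;> simp [Label.rename]

@[simp] theorem Vis.base_rename {N : Type u} (s : N → N) (l : Vis N) :
    (l.rename s).base = s l.base := by cases l <;> rfl

theorem Vis.compl_ne {N : Type u} (l : Vis N) : l ≠ l.compl := by
  cases l <;> simp [Vis.compl]

theorem Vis.rename_compl {N : Type u} (s : N → N) (l : Vis N) :
    l.compl.rename s = (l.rename s).compl := by cases l <;> rfl

theorem Vis.rename_injective {N : Type u} {s : N → N} (hs : Function.Injective s) :
    Function.Injective (Vis.rename s) := by
  rintro (a | a) (b | b) h <;> simp_all [Vis.rename, hs.eq_iff]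

theorem Label.mentions_rename {N : Type u} {s : N → N} (hs : Function.Injective s) (a : N)
    (α : Label N) : (α.rename s).Mentions (s a) ↔ α.Mentions a := by
  cases α <;> simp [Label.rename, Label.Mentions, hs.eq_iff]

theorem Label.rename_eq_self {N : Type u} {s : N → N} {α : Label N}
    (h : ∀ a, α.Mentions a → s a = a) : α.rename s = α := by
  rcases α with (a | a) | _
  · simp [Label.rename, Vis.rename, h a rfl]
  · simp [Label.rename, Vis.rename, h a rfl]
  · rfl

/-- Injectivity is what prevents a renaming from creating new complementary pairs. -/
theorem ConfStruct.parLabel_rename {N : Type u} {s : N → N} (hs : Function.Injective s)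
    (e : StarProd (Label N) (Label N)) :
    ConfStruct.parLabel (e.map (Label.rename s) (Label.rename s)) =
      (ConfStruct.parLabel e).map (Label.rename s) := by
  rcases e with α | α | ⟨(l | _), (k | _)⟩ <;>
    simp only [StarProd.map, ConfStruct.parLabel, Option.map, Label.rename]
  rw [← Vis.rename_compl, (Vis.rename_injective hs).eq_iff]
  split_ifs <;> rfl

theorem ConfStruct.parLabel_both_isSome {N : Type u} {α β : Label N} :
    (ConfStruct.parLabel (.both α β)).isSome ↔ ∃ l : Vis N, α = .vis l ∧ β = .vis l.compl := by
  rcases α with l | _ <;> rcases β with k | _ <;> simp [ConfStruct.parLabel]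

theorem ConfStruct.parLabel_both {N : Type u} (l : Vis N) :
    ConfStruct.parLabel (.both (.vis l) (.vis l.compl)) = some .tau := by
  simp [ConfStruct.parLabel]

/-! ## Membership in the configurations of the constructions -/

namespace ConfStruct

theorem mem_pre_C {L : Type u} {l : L} {S : ConfStruct L} {x : Set (Option S.E)} :
    x ∈ (S.pre l).C ↔ x = ∅ ∨ (none ∈ x ∧ some ⁻¹' x ∈ S.C) := by
  refine or_congr Iff.rfl ⟨?_, fun h => ⟨_, h.2, ?_⟩⟩
  · rintro ⟨y, hy, rfl⟩
    refine ⟨Set.mem_insert _ _, ?_⟩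
    have : (some ⁻¹' (insert none (some '' y)) : Set S.E) = y := by ext; simp
    rwa [this]
  · ext (_ | a) <;> simp [h.1]

theorem mem_coprod_C {L : Type u} {S T : ConfStruct L} {x : Set (S.E ⊕ T.E)} :
    x ∈ (S.coprod T).C ↔ (Sum.inl ⁻¹' x ∈ S.C ∧ Sum.inr ⁻¹' x = ∅) ∨
      (Sum.inr ⁻¹' x ∈ T.C ∧ Sum.inl ⁻¹' x = ∅) := by
  refine or_congr ⟨?_, fun h => ⟨_, h.1, ?_⟩⟩ ⟨?_, fun h => ⟨_, h.1, ?_⟩⟩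
  · rintro ⟨y, hy, rfl⟩
    exact ⟨by rwa [Set.preimage_image_eq _ Sum.inl_injective], by ext; simp⟩
  · ext (a | a)
    · simp
    · simpa using fun ha => (Set.ext_iff.1 h.2 a).1 ha
  · rintro ⟨y, hy, rfl⟩
    exact ⟨by rwa [Set.preimage_image_eq _ Sum.inr_injective], by ext; simp⟩
  · ext (a | a)
    · simpa using fun ha => (Set.ext_iff.1 h.2 a).1 ha
    · simp

end ConfStruct

theorem CCS.empty_mem_enc {N : Type u} (P : CCS N) : ∅ ∈ P.enc.C := by
  induction P with
  | nil => exact rfl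
  | pre l P ih => exact Or.inl rfl
  | par P Q ihP ihQ =>
    have h1 : (StarProd.fstImage (B := Q.enc.E) ∅ : Set P.enc.E) = ∅ := by
      ext; simp [StarProd.fstImage]
    have h2 : (StarProd.sndImage (A := P.enc.E) ∅ : Set Q.enc.E) = ∅ := by
      ext; simp [StarProd.sndImage]
    change Subtype.val '' ∅ ∈ (P.enc.prod Q.enc).C
    rw [Set.image_empty]
    refine ⟨⟨?_, ?_⟩, ?_, ?_, ?_⟩
    · exact h1 ▸ ihP
    · exact h2 ▸ ihQ
    · exact fun e he => absurd he (Set.notMem_empty _)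
    · exact fun e he => absurd he (Set.notMem_empty _)
    · exact fun e he => absurd he (Set.notMem_empty _)
  | sum l P k Q ihP ihQ => exact Or.inl ⟨∅, Or.inl rfl, (Set.image_empty _).symm⟩
  | res P a ih => change Subtype.val '' ∅ ∈ P.enc.C; rwa [Set.image_empty]

/-- The names of the labels of an encoding are free in the process. -/
theorem CCS.mem_fn_of_mentions {N : Type u} (P : CCS N) :
    ∀ (e : P.enc.E) (a : N), (P.enc.lab e).Mentions a → a ∈ P.fn := by
  induction P with
  | nil => exact fun e => e.elim
  | pre l P ih =>
    rintro (_ | e) a h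
    · exact Or.inl h.symm
    · exact Or.inr (ih e a h)
  | par P Q ihP ihQ =>
    rintro ⟨(e | e | ⟨e, f⟩), he⟩ a h
    · exact Or.inl (ihP e a h)
    · exact Or.inr (ihQ e a h)
    · obtain ⟨l, h1, h2⟩ := ConfStruct.parLabel_both_isSome.1 he
      have : ∀ o ∈ ConfStruct.parLabel (.both (P.enc.lab e) (Q.enc.lab f)), ¬ o.Mentions a := by
        rw [h1, h2, ConfStruct.parLabel_both]
        rintro o ho
        rw [← Option.some.inj ho]
        exact id
      exact absurd h (this _ (Option.get_mem he))
  | sum l P k Q ihP ihQ =>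
    rintro ((_ | e) | (_ | e)) a h
    · exact Or.inl (Or.inl h.symm)
    · exact Or.inl (Or.inr (ihP e a h))
    · exact Or.inr (Or.inl h.symm)
    · exact Or.inr (Or.inr (ihQ e a h))
  | res P b ih =>
    rintro ⟨e, he⟩ a h
    refine ⟨ih e a h, ?_⟩
    rintro rfl
    exact he h

/-! ## Marked structures -/

/-- A configuration structure in which some events carry identifiers. -/
structure Marked (N : Type u) where
  S : ConfStruct (Label N)
  key : S.E → Option ℕ

namespace Marked

variable {N : Type u}

/-- The set of events that carry an identifier. -/
def dom (X : Marked N) : Set X.S.E := {e | X.key e ≠ none}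

/-- The identifiers in use. -/
def ran (X : Marked N) : Set ℕ := {i | ∃ e, X.key e = some i}

open Classical in
/-- Change of the identifier of one event. -/
noncomputable def upd (X : Marked N) (e : X.S.E) (o : Option ℕ) : Marked N where
  S := X.S
  key := Function.update X.key e o

open Classical in
theorem upd_key (X : Marked N) (e : X.S.E) (o : Option ℕ) (d : X.S.E) :
    (X.upd e o).key d = if d = e then o else X.key d := by
  change Function.update X.key e o d = _
  exact Function.update_apply _ _ _ _

theorem upd_key_self (X : Marked N) (e : X.S.E) (o : Option ℕ) : (X.upd e o).key e = o := by
  classical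
  rw [upd_key, if_pos rfl]

theorem upd_key_of_ne (X : Marked N) {e d : X.S.E} (o : Option ℕ) (h : d ≠ e) :
    (X.upd e o).key d = X.key d := by
  classical
  rw [upd_key, if_neg h]

/-- A process none of whose events carries an identifier. -/
noncomputable def lift (P : CCS N) : Marked N where
  S := P.enc
  key := fun _ => none

/-- Prefixing, where the new event may carry an identifier. -/
def pre (o : Option ℕ) (l : Vis N) (X : Marked N) : Marked N where
  S := X.S.pre (.vis l)
  key := fun e : Option X.S.E => e.elim o X.key

def sum (X Y : Marked N) : Marked N where
  S := X.S.coprod Y.S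
  key := Sum.elim X.key Y.key

def res (a : N) (X : Marked N) : Marked N where
  S := X.S.resName a
  key := fun e => X.key e.1

open Classical in
/-- Identifiers of the events of a parallel composition. -/
noncomputable def parKey {A B : Type} (k : A → Option ℕ) (k' : B → Option ℕ) :
    StarProd A B → Option ℕ
  -- An unmarked event stays unmarked: if `k e` is `none`, both branches give `none`.
  | .left e => if ∃ f, k' f = k e then none else k e
  | .right f => if ∃ e, k e = k' f then none else k' f
  | .both e f => if k e = k' f then k e else none

theorem parKey_left {A B : Type} {k : A → Option ℕ} {k' : B → Option ℕ} {e : A} {i : ℕ} :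
    parKey k k' (.left e) = some i ↔ k e = some i ∧ ∀ f, k' f ≠ some i := by
  simp only [parKey]
  split_ifs with h
  · obtain ⟨f, hf⟩ := h
    simp only [false_iff, not_and, not_forall, not_not]
    exact fun h => ⟨f, hf.trans h⟩
  · simp only [iff_self_and]
    exact fun h' f hf => h ⟨f, hf.trans h'.symm⟩

theorem parKey_right {A B : Type} {k : A → Option ℕ} {k' : B → Option ℕ} {f : B} {i : ℕ} :
    parKey k k' (.right f) = some i ↔ k' f = some i ∧ ∀ e, k e ≠ some i := by
  simp only [parKey]
  split_ifs with h
  · obtain ⟨f, hf⟩ := h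
    simp only [false_iff, not_and, not_forall, not_not]
    exact fun h => ⟨f, hf.trans h⟩
  · simp only [iff_self_and]
    exact fun h' f hf => h ⟨f, hf.trans h'.symm⟩

theorem parKey_both {A B : Type} {k : A → Option ℕ} {k' : B → Option ℕ} {e : A} {f : B} {i : ℕ} :
    parKey k k' (.both e f) = some i ↔ k e = some i ∧ k' f = some i := by
  simp only [parKey]
  split_ifs with h
  · exact ⟨fun h' => ⟨h', h ▸ h'⟩, fun h' => h'.1⟩
  · simp only [false_iff]
    exact fun h' => h (h'.1.trans h'.2.symm)

noncomputable def par (X Y : Marked N) : Marked N where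
  S := X.S.par Y.S
  key := fun e => parKey X.key Y.key e.1

/-- The structure of a process after the prefix `l`, identified by `i`, of `l.P + Q`. -/
noncomputable def past (i : ℕ) (l : Vis N) (Q : CCS N) (X : Marked N) : Marked N :=
  (X.pre (some i) l).sum (lift Q)

/-- Isomorphisms that preserve identifiers and rename labels along `s`. -/
structure Iso (s : N → N) (X Y : Marked N) where
  toEquiv : X.S.E ≃ Y.S.E
  lab_eq : ∀ e, Y.S.lab (toEquiv e) = (X.S.lab e).rename s
  -- Preimages rather than images: configurations of prefixes and sums are characterised by their
  -- preimages under `some`, `Sum.inl` and `Sum.inr`, and these compose definitionally.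
  conf_iff : ∀ y, y ∈ Y.S.C ↔ toEquiv ⁻¹' y ∈ X.S.C
  key_eq : ∀ e, Y.key (toEquiv e) = X.key e

namespace Iso

def refl (X : Marked N) : Iso id X X where
  toEquiv := Equiv.refl _
  lab_eq := by simp
  conf_iff := by simp
  key_eq := by simp

def symm {X Y : Marked N} (f : Iso id X Y) : Iso id Y X where
  toEquiv := f.toEquiv.symm
  lab_eq e := by
    have := f.lab_eq (f.toEquiv.symm e)
    simp at this
    simp [this]
  conf_iff y := by
    rw [f.conf_iff, ← Set.preimage_comp]
    simp
  key_eq e := by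
    have := f.key_eq (f.toEquiv.symm e)
    simp at this
    simp [this]

def trans {X Y Z : Marked N} (f : Iso id X Y) (g : Iso id Y Z) : Iso id X Z where
  toEquiv := f.toEquiv.trans g.toEquiv
  lab_eq e := by simp [f.lab_eq, g.lab_eq]
  conf_iff y := by
    rw [g.conf_iff, f.conf_iff]; rfl
  key_eq e := by simp [f.key_eq, g.key_eq]

theorem lab_eq' {X Y : Marked N} (f : Iso id X Y) (e : X.S.E) :
    Y.S.lab (f.toEquiv e) = X.S.lab e := by simp [f.lab_eq]

theorem preimage_dom {s : N → N} {X Y : Marked N} (f : Iso s X Y) :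
    f.toEquiv ⁻¹' Y.dom = X.dom := by
  ext e; simp [dom, f.key_eq]

theorem dom_mem_iff {s : N → N} {X Y : Marked N} (f : Iso s X Y) :
    Y.dom ∈ Y.S.C ↔ X.dom ∈ X.S.C := by
  rw [f.conf_iff, f.preimage_dom]

def upd {s : N → N} {X Y : Marked N} (f : Iso s X Y) (e : X.S.E) (o : Option ℕ) :
    Iso s (X.upd e o) (Y.upd (f.toEquiv e) o) where
  toEquiv := f.toEquiv
  lab_eq := f.lab_eq
  conf_iff := f.conf_iff
  key_eq d := by
    by_cases h : d = e
    · rw [h]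
      exact (upd_key_self _ _ _).trans (upd_key_self _ _ _).symm
    · exact (upd_key_of_ne _ _ (f.toEquiv.injective.ne h)).trans
        ((f.key_eq d).trans (upd_key_of_ne X _ h).symm)

def nil (s : N → N) : Iso s (lift CCS.nil) (lift CCS.nil) where
  toEquiv := Equiv.refl _
  lab_eq := fun e : Empty => e.elim
  conf_iff _ := Iff.rfl
  key_eq _ := rfl

theorem preimage_eq_empty_iff {A B : Type*} (f : A ≃ B) (y : Set B) : f ⁻¹' y = ∅ ↔ y = ∅ := by
  rw [Set.preimage_eq_empty_iff, f.range_eq_univ, Set.disjoint_univ]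

def pre {s : N → N} {X Y : Marked N} (f : Iso s X Y) (o : Option ℕ) (l : Vis N) :
    Iso s (X.pre o l) (Y.pre o (l.rename s)) where
  toEquiv := Equiv.optionCongr f.toEquiv
  lab_eq := by
    rintro (_ | e)
    · rfl
    · exact f.lab_eq e
  conf_iff y := by
    refine ConfStruct.mem_pre_C.trans (Iff.trans ?_ ConfStruct.mem_pre_C.symm)
    refine or_congr ?_ (and_congr Iff.rfl (f.conf_iff _))
    exact (preimage_eq_empty_iff (Equiv.optionCongr f.toEquiv) y).symm
  key_eq := by
    rintro (_ | e)
    · rfl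
    · exact f.key_eq e


def sum {s : N → N} {X Y X' Y' : Marked N} (f : Iso s X Y) (g : Iso s X' Y') :
    Iso s (X.sum X') (Y.sum Y') where
  toEquiv := Equiv.sumCongr f.toEquiv g.toEquiv
  lab_eq := by
    rintro (e | e)
    · exact f.lab_eq e
    · exact g.lab_eq e
  conf_iff y := by
    refine ConfStruct.mem_coprod_C.trans (Iff.trans ?_ ConfStruct.mem_coprod_C.symm)
    refine or_congr (and_congr (f.conf_iff _) ?_) (and_congr (g.conf_iff _) ?_)
    · exact (preimage_eq_empty_iff g.toEquiv _).symm
    · exact (preimage_eq_empty_iff f.toEquiv _).symm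
  key_eq := by
    rintro (e | e)
    · exact f.key_eq e
    · exact g.key_eq e

def sumComm (X Y : Marked N) : Iso id (X.sum Y) (Y.sum X) where
  toEquiv := Equiv.sumComm _ _
  lab_eq := by rintro (e | e) <;> exact (Label.rename_id _).symm
  conf_iff y := by
    refine ConfStruct.mem_coprod_C.trans (Iff.trans ?_ ConfStruct.mem_coprod_C.symm)
    exact or_comm
  key_eq := by rintro (e | e) <;> rfl

/-- Restriction and parallel composition both pass to a subtype of events and test configurations on
the image in the ambient type; this compatibility serves both. -/
theorem preimage_image_val {A B : Type*} {p : A → Prop} {q : B → Prop} (f : A ≃ B)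
    (h : ∀ a, p a ↔ q (f a)) (y : Set {b // q b}) :
    f ⁻¹' (Subtype.val '' y) = Subtype.val '' (f.subtypeEquiv h ⁻¹' y) := by
  ext e
  constructor
  · rintro ⟨d, hd, h'⟩
    exact ⟨⟨e, (h e).2 (h' ▸ d.2)⟩, by
      rwa [Set.mem_preimage, show f.subtypeEquiv h ⟨e, _⟩ = d from Subtype.ext h'.symm], rfl⟩
  · rintro ⟨d, hd, rfl⟩
    exact ⟨_, hd, rfl⟩

def res {s : N → N} (hs : Function.Injective s) {X Y : Marked N} (f : Iso s X Y) (a : N) :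
    Iso s (X.res a) (Y.res (s a)) where
  toEquiv := f.toEquiv.subtypeEquiv fun e => by
    simp [f.lab_eq, Label.mentions_rename hs]
  lab_eq e := f.lab_eq e.1
  conf_iff y := (f.conf_iff _).trans
    (iff_of_eq (congrArg (· ∈ X.S.C) (preimage_image_val _ _ y)))
  key_eq e := f.key_eq e.1

end Iso

end Marked

/-! ### Transport of products along bijections of events -/

namespace StarProd

def congr {A A' B B' : Type*} (f : A ≃ A') (g : B ≃ B') : StarProd A B ≃ StarProd A' B' where
  toFun := map f g
  invFun := map f.symm g.symm
  left_inv := by rintro (a | b | ⟨a, b⟩) <;> simp [map]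
  right_inv := by rintro (a | b | ⟨a, b⟩) <;> simp [map]

theorem fst_map {A A' B B' : Type*} (f : A → A') (g : B → B') (e : StarProd A B) :
    (e.map f g).fst = e.fst.map f := by cases e <;> rfl

theorem snd_map {A A' B B' : Type*} (f : A → A') (g : B → B') (e : StarProd A B) :
    (e.map f g).snd = e.snd.map g := by cases e <;> rfl

theorem fstImage_preimage {A A' B B' : Type*} (f : A ≃ A') (g : B ≃ B')
    (y : Set (StarProd A' B')) : fstImage (congr f g ⁻¹' y) = f ⁻¹' fstImage y := by
  ext a
  constructor
  · rintro ⟨e, he, h⟩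
    exact ⟨_, he, (fst_map f g e).trans (by simp [h])⟩
  · rintro ⟨e, he, h⟩
    obtain ⟨e, rfl⟩ := (congr f g).surjective e
    refine ⟨e, he, ?_⟩
    have := (fst_map f g e).symm.trans h
    simpa using this

theorem sndImage_preimage {A A' B B' : Type*} (f : A ≃ A') (g : B ≃ B')
    (y : Set (StarProd A' B')) : sndImage (congr f g ⁻¹' y) = g ⁻¹' sndImage y := by
  ext a
  constructor
  · rintro ⟨e, he, h⟩
    exact ⟨_, he, (snd_map f g e).trans (by simp [h])⟩
  · rintro ⟨e, he, h⟩
    obtain ⟨e, rfl⟩ := (congr f g).surjective e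
    refine ⟨e, he, ?_⟩
    have := (snd_map f g e).symm.trans h
    simpa using this

end StarProd

namespace ConfStruct

/-- Every clause in the definition of the product speaks of projections and inclusions only.
Projections commute with preimages under `StarProd.congr`, so each witness `z` can be pulled back.
-/
theorem prod_preimage_mem {L L' : Type*} {S S' : ConfStruct L} {T T' : ConfStruct L'}
    (f : S.E ≃ S'.E) (g : T.E ≃ T'.E) (hf : ∀ y ∈ S'.C, f ⁻¹' y ∈ S.C)
    (hg : ∀ y ∈ T'.C, g ⁻¹' y ∈ T.C) {y : Set (StarProd S'.E T'.E)} (hy : y ∈ (S'.prod T').C) :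
    StarProd.congr f g ⁻¹' y ∈ (S.prod T).C := by
  obtain ⟨⟨h1, h2⟩, h3, h4, h5⟩ := hy
  refine ⟨⟨?_, ?_⟩, ?_, ?_, ?_⟩
  · rw [StarProd.fstImage_preimage]; exact hf _ h1
  · rw [StarProd.sndImage_preimage]; exact hg _ h2
  · intro e he e' he' h
    refine (StarProd.congr f g).injective (h3 _ he _ he' ?_)
    have e1 := StarProd.fst_map f g e
    have e2 := StarProd.fst_map f g e'
    have e3 := StarProd.snd_map f g e
    have e4 := StarProd.snd_map f g e'
    change ((e.map f g).fst = (e'.map f g).fst ∧ (e.map f g).fst ≠ none) ∨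
      ((e.map f g).snd = (e'.map f g).snd ∧ (e.map f g).snd ≠ none)
    rw [e1, e2, e3, e4]
    rcases h with ⟨h, h'⟩ | ⟨h, h'⟩
    · exact Or.inl ⟨by rw [h], by simpa using h'⟩
    · exact Or.inr ⟨by rw [h], by simpa using h'⟩
  · intro e he
    obtain ⟨z, hz, hf', hz1, hz2, hez⟩ := h4 _ he
    refine ⟨StarProd.congr f g ⁻¹' z, Set.preimage_mono hz,
      hf'.preimage (StarProd.congr f g).injective.injOn, ?_, ?_, hez⟩
    · rw [StarProd.fstImage_preimage]; exact hf _ hz1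
    · rw [StarProd.sndImage_preimage]; exact hg _ hz2
  · intro e he e' he' hne
    obtain ⟨z, hz, hz1, hz2, hez⟩ := h5 _ he _ he' ((StarProd.congr f g).injective.ne hne)
    refine ⟨StarProd.congr f g ⁻¹' z, Set.preimage_mono hz, ?_, ?_, hez⟩
    · rw [StarProd.fstImage_preimage]; exact hf _ hz1
    · rw [StarProd.sndImage_preimage]; exact hg _ hz2

theorem prod_preimage_mem_iff {L L' : Type*} {S S' : ConfStruct L} {T T' : ConfStruct L'}
    (f : S.E ≃ S'.E) (g : T.E ≃ T'.E) (hf : ∀ y, y ∈ S'.C ↔ f ⁻¹' y ∈ S.C)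
    (hg : ∀ y, y ∈ T'.C ↔ g ⁻¹' y ∈ T.C) (y : Set (StarProd S'.E T'.E)) :
    y ∈ (S'.prod T').C ↔ StarProd.congr f g ⁻¹' y ∈ (S.prod T).C := by
  refine ⟨prod_preimage_mem f g (fun y => (hf y).1) (fun y => (hg y).1), fun h => ?_⟩
  have := prod_preimage_mem f.symm g.symm (S := S') (T := T')
    (fun y hy => (hf _).2 (by rwa [← Set.preimage_comp, Equiv.symm_comp_self]))
    (fun y hy => (hg _).2 (by rwa [← Set.preimage_comp, Equiv.symm_comp_self])) h
  have e : StarProd.congr f.symm g.symm = (StarProd.congr f g).symm := rfl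
  rwa [e, ← Set.preimage_comp, Equiv.self_comp_symm] at this

end ConfStruct

/-! ### Invariance of encodings under renaming and congruence of processes -/

namespace Marked

variable {N : Type u}

namespace Iso

theorem parLabel_congr {s : N → N} (hs : Function.Injective s) {X Y X' Y' : Marked N}
    (f : Iso s X Y) (g : Iso s X' Y') (e : StarProd X.S.E X'.S.E) :
    ConfStruct.parLabel ((Y.S.prod Y'.S).lab (StarProd.congr f.toEquiv g.toEquiv e)) =
      (ConfStruct.parLabel ((X.S.prod X'.S).lab e)).map (Label.rename s) := by
  rw [← ConfStruct.parLabel_rename hs]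
  congr 1
  rcases e with a | b | ⟨a, b⟩ <;>
    simp [ConfStruct.prod, StarProd.congr, StarProd.map, f.lab_eq, g.lab_eq]

theorem parKey_congr {s : N → N} {X Y X' Y' : Marked N}
    (f : Iso s X Y) (g : Iso s X' Y') (e : StarProd X.S.E X'.S.E) :
    parKey Y.key Y'.key (StarProd.congr f.toEquiv g.toEquiv e) = parKey X.key X'.key e := by
  have h1 : ∀ o, (∃ d, Y.key d = o) ↔ ∃ d, X.key d = o := fun o =>
    (f.toEquiv.exists_congr fun d => by rw [f.key_eq]).symm
  have h2 : ∀ o, (∃ d, Y'.key d = o) ↔ ∃ d, X'.key d = o := fun o =>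
    (g.toEquiv.exists_congr fun d => by rw [g.key_eq]).symm
  rcases e with a | b | ⟨a, b⟩ <;>
    simp only [StarProd.congr, Equiv.coe_fn_mk, StarProd.map, parKey, f.key_eq, g.key_eq] <;>
    congr 1 <;> simp only [h1, h2, f.key_eq, g.key_eq]

def par {s : N → N} (hs : Function.Injective s) {X Y X' Y' : Marked N} (f : Iso s X Y)
    (g : Iso s X' Y') : Iso s (X.par X') (Y.par Y') where
  toEquiv := (StarProd.congr f.toEquiv g.toEquiv).subtypeEquiv fun e => by
    have := congrArg Option.isSome (parLabel_congr hs f g e)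
    rw [Option.isSome_map] at this
    exact iff_of_eq (congrArg (· = true) this.symm)
  lab_eq e := by
    have := parLabel_congr hs f g e.1
    change Option.get (ConfStruct.parLabel ((Y.S.prod Y'.S).lab
      (StarProd.congr f.toEquiv g.toEquiv e.1))) _ =
      (Option.get (ConfStruct.parLabel ((X.S.prod X'.S).lab e.1)) _).rename s
    simp only [this, Option.get_map]
  conf_iff y :=
    (ConfStruct.prod_preimage_mem_iff f.toEquiv g.toEquiv f.conf_iff g.conf_iff _).trans
      (iff_of_eq (congrArg (· ∈ (X.S.prod X'.S).C) (preimage_image_val _ _ y)))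
  key_eq e := parKey_congr f g e.1

noncomputable def past {X Y : Marked N} (f : Iso id X Y) (i : ℕ) (l : Vis N) (Q : CCS N) :
    Iso id (X.past i l Q) (Y.past i l Q) := by
  have := (f.pre (some i) l).sum (refl (lift Q))
  rwa [Vis.rename_id] at this

end Iso

/-- This and the next two lemmas let the constructions on isomorphisms of marked structures be
applied to encodings of bare processes. -/
theorem lift_pre (l : Vis N) (P : CCS N) : lift (.pre l P) = (lift P).pre none l := by
  simp only [lift, pre]
  congr
  ext1 (_ | e) <;> rfl

theorem lift_sum (l k : Vis N) (P Q : CCS N) :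
    lift (.sum l P k Q) = ((lift P).pre none l).sum ((lift Q).pre none k) := by
  simp only [lift, pre, sum]
  congr
  ext1 ((_ | e) | (_ | e)) <;> rfl

theorem lift_par (P Q : CCS N) : lift (.par P Q) = (lift P).par (lift Q) := by
  simp only [lift, par]
  congr
  ext1 ⟨(e | e | e), h⟩ <;> simp [parKey]

/-- Since `CCS.rename` acts on bound names as well, the restriction case is uniform: the events
removed for `a` correspond to those removed for `s a`. -/
theorem nonempty_iso_rename {s : N → N} (hs : Function.Injective s) (P : CCS N) :
    Nonempty (Iso s (lift P) (lift (P.rename s))) := by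
  induction P with
  | nil => exact ⟨Iso.nil s⟩
  | pre l P ih =>
    obtain ⟨f⟩ := ih
    rw [CCS.rename, lift_pre, lift_pre]
    exact ⟨f.pre none l⟩
  | par P Q ihP ihQ =>
    obtain ⟨f⟩ := ihP
    obtain ⟨g⟩ := ihQ
    rw [CCS.rename, lift_par, lift_par]
    exact ⟨f.par hs g⟩
  | sum l P k Q ihP ihQ =>
    obtain ⟨f⟩ := ihP
    obtain ⟨g⟩ := ihQ
    rw [CCS.rename, lift_sum, lift_sum]
    exact ⟨(f.pre none l).sum (g.pre none k)⟩
  | res P a ih =>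
    obtain ⟨f⟩ := ih
    exact ⟨f.res hs a⟩

/-- Congruent processes have isomorphic encodings. -/
theorem nonempty_iso_of_cong {P Q : CCS N} (h : CCS.Cong P Q) :
    Nonempty (Iso id (lift P) (lift Q)) := by
  have hpre : ∀ (l : Vis N) {P Q : CCS N}, Iso id (lift P) (lift Q) →
      Iso id ((lift P).pre none l) ((lift Q).pre none l) := fun l P Q f => by
    have := f.pre none l
    rwa [Vis.rename_id] at this
  induction h with
  | refl P => exact ⟨Iso.refl _⟩
  | symm _ ih => exact ih.map Iso.symm
  | trans _ _ ih ih' => exact ⟨ih.some.trans ih'.some⟩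
  | pre l _ ih =>
    rw [lift_pre, lift_pre]
    exact ih.map (hpre l)
  | par _ _ ih ih' =>
    rw [lift_par, lift_par]
    exact ⟨ih.some.par Function.injective_id ih'.some⟩
  | sum l k _ _ ih ih' =>
    rw [lift_sum, lift_sum]
    exact ⟨(hpre l ih.some).sum (hpre k ih'.some)⟩
  | res a _ ih => exact ih.map fun f => f.res Function.injective_id a
  | sum_comm l k P Q =>
    rw [lift_sum, lift_sum]
    exact ⟨Iso.sumComm _ _⟩
  | alpha P a b hb =>
    classical
    obtain ⟨f⟩ := nonempty_iso_rename (Equiv.swap a b).injective P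
    have f := f.res (Equiv.swap a b).injective a
    rw [Equiv.swap_apply_left] at f
    -- The swap does nothing to the surviving labels: events mentioning `a` have been removed, and
    -- no label mentions `b`, since labels of an encoding use free names only.
    refine ⟨⟨f.toEquiv, fun d => ?_, f.conf_iff, f.key_eq⟩⟩
    refine (f.lab_eq d).trans ?_
    refine (Label.rename_eq_self ?_).trans (Label.rename_id _).symm
    intro c hc
    refine Equiv.swap_apply_of_ne_of_ne ?_ ?_
    · rintro rfl
      exact d.2 hc
    · rintro rfl
      exact hb (CCS.mem_fn_of_mentions P d.1 _ hc)

end Marked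
-- Configurations of a product with finitely many events
namespace StarProd

theorem fstImage_mono {A : Type u} {B : Type v} {w x : Set (StarProd A B)} (h : w ⊆ x) :
    fstImage w ⊆ fstImage x := fun _ ⟨e, he, h'⟩ => ⟨e, h he, h'⟩

theorem sndImage_mono {A : Type u} {B : Type v} {w x : Set (StarProd A B)} (h : w ⊆ x) :
    sndImage w ⊆ sndImage x := fun _ ⟨e, he, h'⟩ => ⟨e, h he, h'⟩

/-- No two elements of `x` share a component. -/
def LocInj {A : Type u} {B : Type v} (x : Set (StarProd A B)) : Prop :=
  ∀ e ∈ x, ∀ e' ∈ x, (e.fst = e'.fst ∧ e.fst ≠ none) ∨ (e.snd = e'.snd ∧ e.snd ≠ none) → e = e'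

end StarProd

namespace ConfStruct

section prod

variable {L : Type u} {L' : Type v} {S : ConfStruct L} {T : ConfStruct L'}

theorem mem_prod_C [Finite S.E] [Finite T.E] {x : Set (StarProd S.E T.E)} :
    x ∈ (S.prod T).C ↔ StarProd.fstImage x ∈ S.C ∧ StarProd.sndImage x ∈ T.C ∧
      StarProd.LocInj x ∧ ∀ e ∈ x, ∀ e' ∈ x, e ≠ e' → ∃ z ⊆ x, StarProd.fstImage z ∈ S.C ∧
      StarProd.sndImage z ∈ T.C ∧ (e ∈ z ↔ e' ∉ z) := by
  constructor
  · rintro ⟨⟨h1, h2⟩, h3, -, h5⟩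
    exact ⟨h1, h2, h3, h5⟩
  · rintro ⟨h1, h2, h3, h5⟩
    have := prod_finite S T
    exact ⟨⟨h1, h2⟩, h3, fun e he =>
      ⟨x, subset_rfl, Set.toFinite (α := (S.prod T).E) x, h1, h2, he⟩, h5⟩

/-- The separating sets of `x` are cut down to `w`. The cut is harmless because no two elements of
`x` share a component: projections then commute with intersections, and intersections of
configurations below a common one are configurations. -/
theorem prod_mem_of_subset [Finite S.E] [Finite T.E] (hS : S.IsConfStruct) (hT : T.IsConfStruct)
    {x w : Set (StarProd S.E T.E)} (hx : x ∈ (S.prod T).C) (hw : w ⊆ x)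
    (h1 : StarProd.fstImage w ∈ S.C) (h2 : StarProd.sndImage w ∈ T.C) : w ∈ (S.prod T).C := by
  obtain ⟨hx1, hx2, hi, hx4⟩ := mem_prod_C.1 hx
  refine mem_prod_C.2 ⟨h1, h2, fun e he e' he' => hi e (hw he) e' (hw he'),
    fun e he e' he' hne => ?_⟩
  obtain ⟨z, hz, hz1, hz2, h⟩ := hx4 e (hw he) e' (hw he') hne
  refine ⟨z ∩ w, Set.inter_subset_right, ?_, ?_, ?_⟩
  · have : StarProd.fstImage (z ∩ w) = StarProd.fstImage z ∩ StarProd.fstImage w := by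
      refine Set.Subset.antisymm (Set.subset_inter (StarProd.fstImage_mono Set.inter_subset_left)
        (StarProd.fstImage_mono Set.inter_subset_right)) ?_
      rintro a ⟨⟨e, he, h⟩, ⟨e', he', h'⟩⟩
      have : e = e' := hi e (hz he) e' (hw he') (Or.inl ⟨h.trans h'.symm, by simp [h]⟩)
      exact ⟨e, ⟨he, this ▸ he'⟩, h⟩
    rw [this]
    exact hS.inter_mem hz1 h1 hx1 (StarProd.fstImage_mono hz) (StarProd.fstImage_mono hw)
  · have : StarProd.sndImage (z ∩ w) = StarProd.sndImage z ∩ StarProd.sndImage w := by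
      refine Set.Subset.antisymm (Set.subset_inter (StarProd.sndImage_mono Set.inter_subset_left)
        (StarProd.sndImage_mono Set.inter_subset_right)) ?_
      rintro a ⟨⟨e, he, h⟩, ⟨e', he', h'⟩⟩
      have : e = e' := hi e (hz he) e' (hw he') (Or.inr ⟨h.trans h'.symm, by simp [h]⟩)
      exact ⟨e, ⟨he, this ▸ he'⟩, h⟩
    rw [this]
    exact hT.inter_mem hz2 h2 hx2 (StarProd.sndImage_mono hz) (StarProd.sndImage_mono hw)
  · exact (and_iff_left he).trans (h.trans (and_iff_left he').symm.not)

/-- The old configuration `x` separates the new event from all others, so coincidence freeness costs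
nothing; only the projections and local injectivity have to be supplied. -/
theorem prod_insert_mem [Finite S.E] [Finite T.E] {x : Set (StarProd S.E T.E)}
    (hx : x ∈ (S.prod T).C) {e : StarProd S.E T.E}
    (h1 : StarProd.fstImage (insert e x) ∈ S.C) (h2 : StarProd.sndImage (insert e x) ∈ T.C)
    (hi : StarProd.LocInj (insert e x)) : insert e x ∈ (S.prod T).C := by
  obtain ⟨hx1, hx2, -, hx4⟩ := mem_prod_C.1 hx
  by_cases hex : e ∈ x
  · rwa [Set.insert_eq_of_mem hex]
  refine mem_prod_C.2 ⟨h1, h2, hi, ?_⟩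
  rintro d (rfl | hd) d' (rfl | hd') hne
  · exact absurd rfl hne
  · exact ⟨x, Set.subset_insert _ _, hx1, hx2, iff_of_false hex (not_not_intro hd')⟩
  · exact ⟨x, Set.subset_insert _ _, hx1, hx2, iff_of_true hd hex⟩
  · obtain ⟨z, hz, h⟩ := hx4 d hd d' hd' hne
    exact ⟨z, hz.trans (Set.subset_insert _ _), h⟩

end prod

end ConfStruct

/-! ### Valid marked structures and moves -/

/-- The identifier of an event after a transition that is identified by `i`. -/
def Dir.newKey : Dir → ℕ → Option ℕ
  | .fwd, i => some i
  | .bwd, _ => none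

/-- The identifier of an event before a transition that is identified by `i`. -/
def Dir.oldKey : Dir → ℕ → Option ℕ
  | .fwd, _ => none
  | .bwd, i => some i

namespace Marked

variable {N : Type u}

theorem mem_dom {X : Marked N} {e : X.S.E} : e ∈ X.dom ↔ ∃ i, X.key e = some i :=
  Option.ne_none_iff_exists'

/-- The events that carry identifiers form a configuration and have distinct identifiers. -/
structure Valid (X : Marked N) : Prop where
  finite : Finite X.S.E
  conf : X.S.IsConfStruct
  dom_mem : X.dom ∈ X.S.C
  inj : ∀ e e' i, X.key e = some i → X.key e' = some i → e = e'

/-- The effect of a transition on an event. -/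
noncomputable def move (d : Dir) (X : Marked N) (e : X.S.E) (i : ℕ) : Marked N :=
  X.upd e (d.newKey i)

/-- The event `e` can be performed or undone with the identifier `i`. -/
structure Can (d : Dir) (X : Marked N) (e : X.S.E) (i : ℕ) : Prop where
  key : X.key e = d.oldKey i
  -- For a forward move `e` is unmarked, so this says that `i` is unused; for a backward move it
  -- says that `e` is the only bearer of `i`.
  fresh : ∀ e', X.key e' = some i → e' = e
  mem : (X.move d e i).dom ∈ X.S.C

theorem dom_upd_some (X : Marked N) (e : X.S.E) (i : ℕ) :
    (X.upd e (some i)).dom = insert e X.dom := by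
  refine Set.ext fun (d : X.S.E) => ?_
  by_cases h : d = e
  · refine iff_of_true ?_ (Or.inl h)
    rw [h]
    exact fun h => Option.some_ne_none i ((upd_key_self _ _ _).symm.trans h)
  · refine Iff.trans ?_ (or_iff_right h).symm
    exact not_congr (iff_of_eq (congrArg (· = none) (upd_key_of_ne X _ h)))

theorem dom_upd_none (X : Marked N) (e : X.S.E) : (X.upd e none).dom = X.dom \ {e} := by
  refine Set.ext fun (d : X.S.E) => ?_
  by_cases h : d = e
  · refine iff_of_false ?_ (fun h' => h'.2 h)
    rw [h]
    exact fun h => h (upd_key_self _ _ _)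
  · refine Iff.trans ?_ (and_iff_left h).symm
    exact not_congr (iff_of_eq (congrArg (· = none) (upd_key_of_ne X _ h)))

theorem Iso.valid {X Y : Marked N} (f : Iso id X Y) (h : X.Valid) : Y.Valid where
  finite := by
    have := h.finite
    exact Finite.of_equiv _ f.toEquiv
  conf := by
    have := h.finite
    have : Finite Y.S.E := Finite.of_equiv _ f.toEquiv
    refine ConfStruct.isConfStruct_of_injective h.conf f.toEquiv.symm f.toEquiv.symm.injective
      fun x => ?_
    rw [f.conf_iff, Equiv.image_symm_eq_preimage]
  dom_mem := f.dom_mem_iff.2 h.dom_mem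
  inj e e' i h1 h2 := f.toEquiv.symm.injective <| h.inj _ _ i
    (by rw [← f.key_eq, Equiv.apply_symm_apply, h1])
    (by rw [← f.key_eq, Equiv.apply_symm_apply, h2])

theorem Iso.ran_eq {X Y : Marked N} (f : Iso id X Y) : X.ran = Y.ran := by
  ext i
  exact f.toEquiv.exists_congr fun e => by rw [f.key_eq]

theorem Iso.can {X Y : Marked N} (f : Iso id X Y) {d : Dir} {e : X.S.E} {i : ℕ}
    (h : X.Can d e i) : Y.Can d (f.toEquiv e) i where
  key := (f.key_eq e).trans h.key
  fresh e' h' := by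
    rw [← f.toEquiv.symm_apply_eq]
    refine h.fresh _ ?_
    rw [← f.key_eq, Equiv.apply_symm_apply, h']
  mem := (f.upd e (d.newKey i)).dom_mem_iff.2 h.mem

noncomputable def Iso.move {X Y : Marked N} (f : Iso id X Y) (d : Dir) (e : X.S.E) (i : ℕ) :
    Iso id (X.move d e i) (Y.move d (f.toEquiv e) i) := f.upd e _

theorem key_move_eq_some {X : Marked N} {d : Dir} {e e' : X.S.E} {i j : ℕ} :
    (X.move d e i).key e' = some j ↔
      (e' = e ∧ d = .fwd ∧ i = j) ∨ (e' ≠ e ∧ X.key e' = some j) := by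
  by_cases h : e' = e
  · subst h
    cases d <;> simp [move, upd_key_self, Dir.newKey]
  · simp [move, upd_key_of_ne _ _ h, h]

theorem Valid.move {X : Marked N} (hX : X.Valid) {d : Dir} {e : X.S.E} {i : ℕ}
    (h : X.Can d e i) : (X.move d e i).Valid where
  finite := hX.finite
  conf := hX.conf
  dom_mem := h.mem
  inj e₁ e₂ j h₁ h₂ := by
    rcases key_move_eq_some.1 h₁ with ⟨h₃, -, h₃'⟩ | ⟨h₃, h₃'⟩ <;>
      rcases key_move_eq_some.1 h₂ with ⟨h₄, -, h₄'⟩ | ⟨h₄, h₄'⟩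
    · exact h₃.trans h₄.symm
    · exact absurd (h.fresh _ (h₃' ▸ h₄')) h₄
    · exact absurd (h.fresh _ (h₄' ▸ h₃')) h₃
    · exact hX.inj _ _ _ h₃' h₄'

theorem lift_dom (P : CCS N) : (lift P).dom = ∅ := by
  ext e
  exact iff_of_false (fun h => h rfl) (Set.notMem_empty _)

theorem lift_ran (P : CCS N) : (lift P).ran = ∅ := by
  ext e
  exact iff_of_false (fun ⟨_, h⟩ => Option.some_ne_none _ h.symm) (Set.notMem_empty _)

theorem lift_valid (P : CCS N) : (lift P).Valid where
  finite := P.enc_isConfStruct.1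
  conf := P.enc_isConfStruct.2
  dom_mem := (lift_dom P) ▸ P.empty_mem_enc
  inj _ _ _ h := absurd h.symm (Option.some_ne_none _)

/-! ### Prefixes in the past -/

section past

variable {i : ℕ} {l : Vis N} {Q : CCS N} {X : Marked N}

/-- The event of the prefix. -/
def pastNew (i : ℕ) (l : Vis N) (Q : CCS N) (X : Marked N) : (X.past i l Q).S.E :=
  Sum.inl (none : Option X.S.E)

def pastOld (i : ℕ) (l : Vis N) (Q : CCS N) {X : Marked N} (e : X.S.E) : (X.past i l Q).S.E :=
  Sum.inl (some e : Option X.S.E)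

theorem pastOld_injective : Function.Injective (pastOld i l Q (X := X)) := fun _ _ h =>
  Option.some.inj (Sum.inl.inj h)

theorem pastOld_ne_pastNew (e : X.S.E) : pastOld i l Q e ≠ pastNew i l Q X := fun h =>
  Option.some_ne_none _ (Sum.inl.inj h)

theorem past_key_eq_some {e : (X.past i l Q).S.E} {j : ℕ} : (X.past i l Q).key e = some j ↔
    (e = pastNew i l Q X ∧ i = j) ∨ ∃ d, e = pastOld i l Q d ∧ X.key d = some j := by
  rcases e with (_ | e) | e
  · refine Iff.trans ?_ (or_iff_left ?_).symm
    · exact Option.some_inj.trans (and_iff_right rfl).symm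
    · rintro ⟨d, h, -⟩
      exact pastOld_ne_pastNew d h.symm
  · refine Iff.trans ?_ (or_iff_right ?_).symm
    · exact ⟨fun h => ⟨e, rfl, h⟩, fun ⟨d, h, h'⟩ => pastOld_injective h ▸ h'⟩
    · exact fun h => pastOld_ne_pastNew e h.1
  · refine iff_of_false (fun h => Option.some_ne_none _ h.symm) ?_
    rintro (⟨h, -⟩ | ⟨d, h, -⟩) <;> cases h

theorem past_ran : (X.past i l Q).ran = insert i X.ran := by
  ext j
  constructor
  · rintro ⟨e, h⟩
    rcases past_key_eq_some.1 h with ⟨-, h⟩ | ⟨d, -, h⟩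
    · exact Or.inl h.symm
    · exact Or.inr ⟨d, h⟩
  · rintro (rfl | ⟨d, h⟩)
    · exact ⟨pastNew _ l Q X, rfl⟩
    · exact ⟨pastOld i l Q d, h⟩

theorem past_dom : (X.past i l Q).dom = insert (pastNew i l Q X) (pastOld i l Q '' X.dom) := by
  ext e
  rw [mem_dom]
  constructor
  · rintro ⟨j, h⟩
    rcases past_key_eq_some.1 h with ⟨h, -⟩ | ⟨d, h, h'⟩
    · exact Or.inl h
    · exact Or.inr ⟨d, mem_dom.2 ⟨j, h'⟩, h.symm⟩
  · rintro (rfl | ⟨d, h, rfl⟩)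
    · exact ⟨i, rfl⟩
    · exact mem_dom.1 h

/-- Once the prefix event is present, the discarded alternative `Q` is in conflict, and being a
configuration is decided by `X` alone. -/
theorem past_mem_iff {x : Set (X.past i l Q).S.E} (hx : pastNew i l Q X ∈ x) :
    x ∈ (X.past i l Q).S.C ↔ Sum.inr ⁻¹' x = (∅ : Set Q.enc.E) ∧ pastOld i l Q ⁻¹' x ∈ X.S.C := by
  refine ConfStruct.mem_coprod_C.trans ((or_iff_left ?_).trans ?_)
  · rintro ⟨-, h⟩
    exact (Set.ext_iff.1 h (none : Option X.S.E)).1 hx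
  · refine and_comm.trans (and_congr Iff.rfl (ConfStruct.mem_pre_C.trans ?_))
    refine (or_iff_right fun h => ?_).trans (and_iff_right hx)
    exact ((Set.ext_iff.1 h (none : Option X.S.E)).1 hx).elim

theorem past_dom_mem_iff : (X.past i l Q).dom ∈ (X.past i l Q).S.C ↔ X.dom ∈ X.S.C := by
  rw [past_mem_iff (by rw [past_dom]; exact Or.inl rfl)]
  exact and_iff_right (Set.ext fun e => iff_of_false (fun h => h rfl) (Set.notMem_empty _))

theorem past_valid (h : X.Valid) (hi : i ∉ X.ran) : (X.past i l Q).Valid := by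
  obtain ⟨h1, h2⟩ := Q.enc_isConfStruct
  have := h.finite
  have f1 : Finite (X.S.pre (.vis l)).E := inferInstanceAs (Finite (Option X.S.E))
  refine ⟨?_, ?_, past_dom_mem_iff.2 h.dom_mem, ?_⟩
  · exact inferInstanceAs (Finite ((X.S.pre (.vis l)).E ⊕ Q.enc.E))
  · exact ConfStruct.coprod_isConfStruct (S := X.S.pre (.vis l)) (T := Q.enc) (ConfStruct.pre_isConfStruct _ h.conf) h2
  · intro e e' j h₁ h₂
    rcases past_key_eq_some.1 h₁ with ⟨rfl, rfl⟩ | ⟨d, rfl, h₁⟩ <;>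
      rcases past_key_eq_some.1 h₂ with ⟨rfl, h₂⟩ | ⟨d', rfl, h₂⟩
    · rfl
    · exact absurd ⟨_, h₂⟩ hi
    · exact absurd ⟨_, h₂ ▸ h₁⟩ hi
    · rw [h.inj _ _ _ h₁ h₂]

theorem past_upd (e : X.S.E) (o : Option ℕ) :
    (X.past i l Q).upd (pastOld i l Q e) o = (X.upd e o).past i l Q := by
  have : ∀ d, ((X.past i l Q).upd (pastOld i l Q e) o).key d =
      ((X.upd e o).past i l Q).key d := by
    intro (d : (X.past i l Q).S.E)
    by_cases hd : d = pastOld i l Q e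
    · rw [hd, upd_key_self]
      exact (upd_key_self X e o).symm
    · refine (upd_key_of_ne (X.past i l Q) _ hd).trans ?_
      rcases d with (_ | d) | d
      · rfl
      · exact (upd_key_of_ne X o (fun h => hd (congrArg (pastOld i l Q) h))).symm
      · rfl
  exact congrArg (Marked.mk (X.past i l Q).S) (funext this)

theorem past_move (d : Dir) (e : X.S.E) (j : ℕ) :
    (X.past i l Q).move d (pastOld i l Q e) j = (X.move d e j).past i l Q := past_upd e _

theorem past_can {d : Dir} {e : X.S.E} {j : ℕ} (h : X.Can d e j) (hj : j ≠ i) :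
    (X.past i l Q).Can d (pastOld i l Q e) j where
  key := h.key
  fresh e' h' := by
    rcases past_key_eq_some.1 h' with ⟨-, h'⟩ | ⟨d', rfl, h'⟩
    · exact absurd h'.symm hj
    · rw [h.fresh _ h']
  mem := by
    have : ((X.past i l Q).move d (pastOld i l Q e) j).dom ∈
        ((X.past i l Q).move d (pastOld i l Q e) j).S.C := by
      rw [past_move, past_dom_mem_iff]
      exact h.mem
    exact this

/-- Events of `Q` conflict with the marked prefix event and are never marked themselves. The prefix
event is already marked, and it cannot be undone while a marked event of `X` depends on it. This is
what the last hypothesis is for: undoing the prefix event is possible only when `X` has no past. -/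
theorem exists_of_past_can {d : Dir} {e : (X.past i l Q).S.E} {j : ℕ}
    (h : (X.past i l Q).Can d e j) (hd : d = .fwd ∨ X.dom.Nonempty) :
    ∃ e', e = pastOld i l Q e' ∧ X.Can d e' j ∧ j ≠ i := by
  have key : ∃ e', e = pastOld i l Q e' := by
    obtain ⟨hk, hf, hm⟩ := h
    rcases e with (_ | e) | e
    · cases d with
      | fwd => exact absurd hk (Option.some_ne_none i)
      | bwd =>
        obtain ⟨x, hx⟩ := hd.resolve_left (by simp)
        -- Undoing the prefix event would leave `x` without its cause.
        have hx' : pastOld i l Q x ∈ ((X.past i l Q).move .bwd (pastNew i l Q X) j).dom := by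
          refine (dom_upd_none _ _).symm ▸ ⟨?_, pastOld_ne_pastNew x⟩
          rw [past_dom]
          exact Or.inr ⟨x, hx, rfl⟩
        rcases ConfStruct.mem_coprod_C.1 hm with ⟨h1, -⟩ | ⟨-, h2⟩
        · rcases ConfStruct.mem_pre_C.1 h1 with h1 | ⟨h1, -⟩
          · exact ((Set.ext_iff.1 h1 (some x : Option X.S.E)).1 hx').elim
          · have : pastNew i l Q X ∈ ((X.past i l Q).upd (pastNew i l Q X) none).dom := h1
            rw [dom_upd_none] at this
            exact absurd rfl this.2
        · exact ((Set.ext_iff.1 h2 (some x : Option X.S.E)).1 hx').elim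
    · exact ⟨e, rfl⟩
    · cases d with
      | bwd => exact absurd hk.symm (Option.some_ne_none j)
      | fwd =>
        have h1 : pastNew i l Q X ∈ ((X.past i l Q).move .fwd (Sum.inr e) j).dom := by
          refine (dom_upd_some _ _ _).symm ▸ Or.inr ?_
          rw [past_dom]
          exact Or.inl rfl
        have h2 : (Sum.inr e : (X.past i l Q).S.E) ∈
            ((X.past i l Q).move .fwd (Sum.inr e) j).dom :=
          (dom_upd_some _ _ _).symm ▸ Or.inl rfl
        exact ((Set.ext_iff.1 ((past_mem_iff h1).1 hm).1 e).1 h2).elim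
  obtain ⟨e, rfl⟩ := key
  refine ⟨e, rfl, ⟨h.key, fun e' h' => pastOld_injective (h.fresh (pastOld i l Q e') h'), ?_⟩, ?_⟩
  · have : ((X.past i l Q).move d (pastOld i l Q e) j).dom ∈
        ((X.past i l Q).move d (pastOld i l Q e) j).S.C := h.mem
    rwa [past_move, past_dom_mem_iff] at this
  · rintro rfl
    exact pastOld_ne_pastNew e (h.fresh (pastNew _ l Q X) rfl).symm

/-- The hypothesis `hl` keeps the prefix event among the survivors of the restriction, and `hQ`
keeps every event of the discarded alternative. -/
def pastResEquiv {a : N} (i : ℕ) {l : Vis N} {Q : CCS N} (X : Marked N) (hl : l.base ≠ a)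
    (hQ : a ∉ Q.fn) : ((X.past i l Q).res a).S.E ≃ ((X.res a).past i l Q).S.E where
  toFun := fun e => match e with
    | ⟨.inl none, _⟩ => Sum.inl none
    | ⟨.inl (some e), h⟩ => Sum.inl (some ⟨e, h⟩)
    | ⟨.inr e, _⟩ => Sum.inr e
  invFun := fun e => match e with
    | .inl none => ⟨Sum.inl none, hl⟩
    | .inl (some e) => ⟨Sum.inl (some e.1), e.2⟩
    | .inr e => ⟨Sum.inr e, fun h => hQ (CCS.mem_fn_of_mentions Q e a h)⟩
  left_inv := by rintro ⟨(_ | e) | e, h⟩ <;> rfl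
  right_inv := by rintro ((_ | e) | e) <;> rfl

/-- A restriction to a name that is not free in the prefix can be moved inside. -/
def pastRes {a : N} (i : ℕ) {l : Vis N} {Q : CCS N} (X : Marked N) (hl : l.base ≠ a)
    (hQ : a ∉ Q.fn) : Iso id ((X.past i l Q).res a) ((X.res a).past i l Q) where
  toEquiv := pastResEquiv i X hl hQ
  lab_eq := by rintro ⟨(_ | e) | e, h⟩ <;> exact (Label.rename_id _).symm
  conf_iff y := by
    refine ConfStruct.mem_coprod_C.trans (Iff.trans ?_ ConfStruct.mem_coprod_C.symm)
    have h1 : ∀ w : Set (Option X.S.E ⊕ Q.enc.E), ∀ y : Set (Option (X.res a).S.E ⊕ Q.enc.E),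
        (Sum.inl none ∈ w ↔ Sum.inl none ∈ y) →
        (∀ e, Sum.inl (some e) ∈ w ↔ ∃ h, Sum.inl (some ⟨e, h⟩) ∈ y) →
        (∀ e, Sum.inr e ∈ w ↔ Sum.inr e ∈ y) →
        (Sum.inl ⁻¹' y = ∅ ↔ Sum.inl ⁻¹' w = ∅) ∧ Sum.inr ⁻¹' y = Sum.inr ⁻¹' w ∧
        Subtype.val '' (some ⁻¹' (Sum.inl ⁻¹' y)) = some ⁻¹' (Sum.inl ⁻¹' w) := by
      intro w y hn hl hr
      refine ⟨?_, Set.ext fun e => (hr e).symm, Set.ext fun e => ?_⟩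
      · simp only [Set.eq_empty_iff_forall_notMem, Set.mem_preimage, Option.forall, hn, hl,
          not_exists]
        exact and_congr Iff.rfl ⟨fun h x hx => h ⟨x, hx⟩, fun h x => h x.1 x.2⟩
      · exact ⟨fun ⟨d, h, h'⟩ => (hl e).2 ⟨h' ▸ d.2, by subst h'; exact h⟩,
          fun h => ⟨_, ((hl e).1 h).2, rfl⟩⟩
    obtain ⟨h2, h3, h4⟩ := h1 (Subtype.val '' (pastResEquiv i X hl hQ ⁻¹' y)) y
      ⟨fun ⟨⟨_, _⟩, h, h'⟩ => by subst h'; exact h, fun h => ⟨⟨Sum.inl none, hl⟩, h, rfl⟩⟩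
      (fun e => ⟨fun ⟨⟨_, _⟩, h, h'⟩ => by subst h'; exact ⟨_, h⟩,
        fun ⟨h, h'⟩ => ⟨⟨Sum.inl (some e), h⟩, h', rfl⟩⟩)
      (fun e => ⟨fun ⟨⟨_, _⟩, h, h'⟩ => by subst h'; exact h,
        fun h => ⟨⟨Sum.inr e, fun h => hQ (CCS.mem_fn_of_mentions Q e a h)⟩, h, rfl⟩⟩)
    refine or_congr (and_congr ?_ (iff_of_eq (congrArg (· = ∅) h3)))
      (and_congr (iff_of_eq (congrArg (· ∈ Q.enc.C) h3)) h2)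
    refine ConfStruct.mem_pre_C.trans (Iff.trans ?_ ConfStruct.mem_pre_C.symm)
    refine or_congr h2 (and_congr ?_ (iff_of_eq (congrArg (· ∈ X.S.C) h4)))
    exact ⟨fun h => ⟨⟨Sum.inl none, hl⟩, h, rfl⟩, fun ⟨⟨_, _⟩, h, h'⟩ => by subst h'; exact h⟩
  key_eq := by rintro ⟨(_ | e) | e, h⟩ <;> rfl

end past

/-! ### Restriction -/

section res

variable {a : N} {X : Marked N}

/-- No event that carries an identifier mentions the name `a`. -/
def Avoids (X : Marked N) (a : N) : Prop := ∀ e ∈ X.dom, ¬ (X.S.lab e).Mentions a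

theorem res_dom_mem_iff (ha : X.Avoids a) : (X.res a).dom ∈ (X.res a).S.C ↔ X.dom ∈ X.S.C := by
  have : Subtype.val '' (X.res a).dom = X.dom := by
    ext e
    exact ⟨fun ⟨d, h, h'⟩ => h' ▸ h, fun h => ⟨⟨e, ha e h⟩, h, rfl⟩⟩
  exact iff_of_eq (congrArg (· ∈ X.S.C) this)

theorem res_ran (ha : X.Avoids a) : (X.res a).ran = X.ran := by
  ext i
  exact ⟨fun ⟨e, h⟩ => ⟨e.1, h⟩, fun ⟨e, h⟩ => ⟨⟨e, ha e (mem_dom.2 ⟨i, h⟩)⟩, h⟩⟩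

theorem res_valid (h : X.Valid) (ha : X.Avoids a) : (X.res a).Valid := by
  have := h.finite
  have hf : Finite (X.res a).S.E := by
    refine Finite.of_injective (β := X.S.E) Subtype.val Subtype.val_injective
  exact ⟨hf, ConfStruct.isConfStruct_of_injective h.conf Subtype.val Subtype.val_injective
    fun _ => Iff.rfl, (res_dom_mem_iff ha).2 h.dom_mem,
    fun e e' i h₁ h₂ => Subtype.ext (h.inj _ _ i h₁ h₂)⟩

theorem res_move (d : Dir) (e : (X.res a).S.E) (i : ℕ) :
    (X.res a).move d e i = (X.move d e.1 i).res a := by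
  have : ∀ e', ((X.res a).move d e i).key e' = ((X.move d e.1 i).res a).key e' := by
    intro (e' : (X.res a).S.E)
    by_cases h : e' = e
    · rw [h]
      exact (upd_key_self _ _ _).trans (upd_key_self X _ _).symm
    · exact (upd_key_of_ne (X.res a) _ h).trans
        (upd_key_of_ne X _ (fun h' => h (Subtype.ext h'))).symm
  exact congrArg (Marked.mk (X.res a).S) (funext this)

theorem Avoids.move (ha : X.Avoids a) (d : Dir) {e : X.S.E} (he : ¬ (X.S.lab e).Mentions a)
    (i : ℕ) : (X.move d e i).Avoids a := by
  intro e' h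
  obtain ⟨j, h⟩ := mem_dom.1 h
  rcases key_move_eq_some.1 h with ⟨h, -⟩ | ⟨-, h⟩
  · exact h ▸ he
  · exact ha _ (mem_dom.2 ⟨j, h⟩)

/-- No marked event is lost in the restriction, so uniqueness of an identifier and membership of the
marked set among the configurations can be tested on either side. -/
theorem res_can_iff (ha : X.Avoids a) {d : Dir} {e : (X.res a).S.E} {i : ℕ} :
    (X.res a).Can d e i ↔ X.Can d e.1 i := by
  have key : ((X.res a).move d e i).dom ∈ (X.res a).S.C ↔ (X.move d e.1 i).dom ∈ X.S.C := by
    have : ((X.res a).move d e i).dom ∈ ((X.res a).move d e i).S.C ↔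
        (X.move d e.1 i).dom ∈ X.S.C := by
      rw [res_move, res_dom_mem_iff (ha.move d e.2 i)]
      rfl
    exact this
  constructor
  · rintro ⟨h1, h2, h3⟩
    refine ⟨h1, fun e' h => ?_, key.1 h3⟩
    exact congrArg Subtype.val (h2 ⟨e', ha e' (mem_dom.2 ⟨i, h⟩)⟩ h)
  · rintro ⟨h1, h2, h3⟩
    exact ⟨h1, fun e' h => Subtype.ext (h2 _ h), key.2 h3⟩

end res

end Marked
namespace Marked

variable {N : Type u}

/-! ### Parallel composition -/

section parKey

variable {A B : Type} {k : A → Option ℕ} {k' : B → Option ℕ}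

/-- The events of a parallel composition that carry identifiers. -/
def parDom (k : A → Option ℕ) (k' : B → Option ℕ) : Set (StarProd A B) :=
  {e | parKey k k' e ≠ none}

theorem mem_parDom {e : StarProd A B} : e ∈ parDom k k' ↔ ∃ i, parKey k k' e = some i :=
  Option.ne_none_iff_exists'

theorem key_fst_of_parKey {e : StarProd A B} {i : ℕ} (h : parKey k k' e = some i) {a : A}
    (ha : e.fst = some a) : k a = some i := by
  rcases e with e | f | ⟨e, f⟩
  · cases ha
    exact (parKey_left.1 h).1
  · cases ha
  · cases ha
    exact (parKey_both.1 h).1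

theorem key_snd_of_parKey {e : StarProd A B} {i : ℕ} (h : parKey k k' e = some i) {b : B}
    (hb : e.snd = some b) : k' b = some i := by
  rcases e with e | f | ⟨e, f⟩
  · cases hb
  · cases hb
    exact (parKey_right.1 h).1
  · cases hb
    exact (parKey_both.1 h).2

/-- A marked event of one side has a marked counterpart in the composition: a pair if the other side
uses the same identifier, a single event otherwise. -/
theorem exists_parKey_of_left {a : A} {i : ℕ} (h : k a = some i) :
    ∃ e : StarProd A B, e.fst = some a ∧ parKey k k' e = some i := by
  by_cases h' : ∃ f, k' f = some i
  · obtain ⟨f, hf⟩ := h'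
    exact ⟨.both a f, rfl, parKey_both.2 ⟨h, hf⟩⟩
  · exact ⟨.left a, rfl, parKey_left.2 ⟨h, not_exists.1 h'⟩⟩

theorem exists_parKey_of_right {b : B} {i : ℕ} (h : k' b = some i) :
    ∃ e : StarProd A B, e.snd = some b ∧ parKey k k' e = some i := by
  by_cases h' : ∃ e, k e = some i
  · obtain ⟨e, he⟩ := h'
    exact ⟨.both e b, rfl, parKey_both.2 ⟨he, h⟩⟩
  · exact ⟨.right b, rfl, parKey_right.2 ⟨h, not_exists.1 h'⟩⟩

theorem fstImage_parDom : StarProd.fstImage (parDom k k') = {a | k a ≠ none} := by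
  ext a
  constructor
  · rintro ⟨e, he, h⟩
    obtain ⟨i, hi⟩ := mem_parDom.1 he
    exact Option.ne_none_iff_exists'.2 ⟨i, key_fst_of_parKey hi h⟩
  · intro ha
    obtain ⟨i, hi⟩ := Option.ne_none_iff_exists'.1 ha
    obtain ⟨e, he, h⟩ := exists_parKey_of_left (k' := k') hi
    exact ⟨e, mem_parDom.2 ⟨i, h⟩, he⟩

theorem sndImage_parDom : StarProd.sndImage (parDom k k') = {b | k' b ≠ none} := by
  ext a
  constructor
  · rintro ⟨e, he, h⟩
    obtain ⟨i, hi⟩ := mem_parDom.1 he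
    exact Option.ne_none_iff_exists'.2 ⟨i, key_snd_of_parKey hi h⟩
  · intro ha
    obtain ⟨i, hi⟩ := Option.ne_none_iff_exists'.1 ha
    obtain ⟨e, he, h⟩ := exists_parKey_of_right (k := k) hi
    exact ⟨e, mem_parDom.2 ⟨i, h⟩, he⟩

theorem parKey_inj (hk : ∀ e e' i, k e = some i → k e' = some i → e = e')
    (hk' : ∀ e e' i, k' e = some i → k' e' = some i → e = e') {e e' : StarProd A B} {i : ℕ}
    (h : parKey k k' e = some i) (h' : parKey k k' e' = some i) : e = e' := by
  rcases e with a | b | ⟨a, b⟩ <;> rcases e' with a' | b' | ⟨a', b'⟩ <;>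
    simp only [parKey_left, parKey_right, parKey_both] at h h'
  · rw [hk _ _ _ h.1 h'.1]
  · exact absurd h'.1 (h.2 _)
  · exact absurd h'.2 (h.2 _)
  · exact absurd h'.1 (h.2 _)
  · rw [hk' _ _ _ h.1 h'.1]
  · exact absurd h'.1 (h.2 _)
  · exact absurd h.2 (h'.2 _)
  · exact absurd h.1 (h'.2 _)
  · rw [hk _ _ _ h.1 h'.1, hk' _ _ _ h.2 h'.2]

/-- Marked events that share a component share its identifier, and identifiers are distinct. -/
theorem parDom_locInj (hk : ∀ e e' i, k e = some i → k e' = some i → e = e')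
    (hk' : ∀ e e' i, k' e = some i → k' e' = some i → e = e') :
    StarProd.LocInj (parDom k k') := by
  intro e he e' he' h
  obtain ⟨i, hi⟩ := mem_parDom.1 he
  obtain ⟨j, hj⟩ := mem_parDom.1 he'
  have : i = j := by
    rcases h with ⟨h1, h2⟩ | ⟨h1, h2⟩
    · obtain ⟨a, ha⟩ := Option.ne_none_iff_exists'.1 h2
      exact Option.some.inj ((key_fst_of_parKey hi ha).symm.trans
        (key_fst_of_parKey hj (h1 ▸ ha)))
    · obtain ⟨a, ha⟩ := Option.ne_none_iff_exists'.1 h2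
      exact Option.some.inj ((key_snd_of_parKey hi ha).symm.trans
        (key_snd_of_parKey hj (h1 ▸ ha)))
  exact parKey_inj hk hk' hi (this ▸ hj)

/-- A move changes the set of marked pairs by a single element. A larger set is handled by
`ConfStruct.prod_insert_mem`, a smaller one by `ConfStruct.prod_mem_of_subset`; in both cases the
projections are the marked sets of the two sides. -/
theorem parDom_mem {L L' : Type*} {S : ConfStruct L} {T : ConfStruct L'} [Finite S.E] [Finite T.E]
    (hS : S.IsConfStruct) (hT : T.IsConfStruct) {k k₂ : S.E → Option ℕ} {k' k₂' : T.E → Option ℕ}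
    (h : parDom k k' ∈ (S.prod T).C)
    (hk : ∀ e e' i, k₂ e = some i → k₂ e' = some i → e = e')
    (hk' : ∀ e e' i, k₂' e = some i → k₂' e' = some i → e = e')
    (h1 : {a | k₂ a ≠ none} ∈ S.C) (h2 : {a | k₂' a ≠ none} ∈ T.C)
    (h3 : ∃ p, parDom k₂ k₂' = insert p (parDom k k') ∨ parDom k₂ k₂' = parDom k k' \ {p}) :
    parDom k₂ k₂' ∈ (S.prod T).C := by
  rw [← fstImage_parDom (k' := k₂')] at h1
  rw [← sndImage_parDom (k := k₂)] at h2
  obtain ⟨p, h3 | h3⟩ := h3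
  · have := parDom_locInj hk hk'
    rw [h3] at this h1 h2 ⊢
    exact ConfStruct.prod_insert_mem h h1 h2 this
  · exact ConfStruct.prod_mem_of_subset hS hT h (h3 ▸ Set.sdiff_subset) h1 h2

variable {d : Dir} {e : A} {f : B} {i : ℕ} {k₂ : A → Option ℕ} {k₂' : B → Option ℕ}

theorem oldKey_eq_some {d : Dir} {i j : ℕ} : d.oldKey i = some j ↔ d = .bwd ∧ i = j := by
  cases d <;> simp [Dir.oldKey]

/-- As the other side does not use `i`, changing the identifier of `e` between `none` and `i`
creates or destroys no pair: only the single event `.left e` is affected. -/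
theorem parKey_move_left
    (hk : ∀ e' j, k₂ e' = some j ↔ (e' = e ∧ d = .fwd ∧ i = j) ∨ (e' ≠ e ∧ k e' = some j))
    (he : k e = d.oldKey i) (hi : ∀ f, k' f ≠ some i) {p : StarProd A B} {j : ℕ} : parKey k₂ k' p = some j ↔
      (p = .left e ∧ d = .fwd ∧ i = j) ∨ (p ≠ .left e ∧ parKey k k' p = some j) := by
  rcases p with e' | f' | ⟨e', f'⟩
  · rw [parKey_left, parKey_left, hk]
    by_cases h : e' = e
    · subst h
      simp only [true_and, ne_eq, not_true_eq_false, false_and, or_false, and_iff_left_iff_imp]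
      rintro ⟨-, rfl⟩
      exact hi
    · simp [h]
  · rw [parKey_right, parKey_right]
    simp only [reduceCtorEq, false_and, ne_eq, not_false_eq_true, true_and, false_or]
    refine and_congr_right fun hf => forall_congr' fun e' => not_congr ?_
    have hij : i ≠ j := fun h => hi f' (h ▸ hf)
    rw [hk]
    by_cases h : e' = e
    · subst h
      simp [hij, he, oldKey_eq_some]
    · simp [h]
  · rw [parKey_both, parKey_both]
    simp only [reduceCtorEq, false_and, ne_eq, not_false_eq_true, true_and, false_or]
    refine and_congr_left fun hf => ?_
    have hij : i ≠ j := fun h => hi f' (h ▸ hf)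
    rw [hk]
    by_cases h : e' = e
    · subst h
      simp [hij, he, oldKey_eq_some]
    · simp [h]

theorem parKey_move_right
    (hk' : ∀ f' j, k₂' f' = some j ↔ (f' = f ∧ d = .fwd ∧ i = j) ∨ (f' ≠ f ∧ k' f' = some j))
    (hf : k' f = d.oldKey i) (hi : ∀ e, k e ≠ some i) {p : StarProd A B} {j : ℕ} : parKey k k₂' p = some j ↔
      (p = .right f ∧ d = .fwd ∧ i = j) ∨ (p ≠ .right f ∧ parKey k k' p = some j) := by
  rcases p with e' | f' | ⟨e', f'⟩
  · rw [parKey_left, parKey_left]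
    simp only [reduceCtorEq, false_and, ne_eq, not_false_eq_true, true_and, false_or]
    refine and_congr_right fun he => forall_congr' fun f' => not_congr ?_
    have hij : i ≠ j := fun h => hi e' (h ▸ he)
    rw [hk']
    by_cases h : f' = f
    · subst h
      simp [hij, hf, oldKey_eq_some]
    · simp [h]
  · rw [parKey_right, parKey_right, hk']
    by_cases h : f' = f
    · subst h
      simp only [true_and, ne_eq, not_true_eq_false, false_and, or_false, and_iff_left_iff_imp]
      rintro ⟨-, rfl⟩
      exact hi
    · simp [h]
  · rw [parKey_both, parKey_both]
    simp only [reduceCtorEq, false_and, ne_eq, not_false_eq_true, true_and, false_or]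
    refine and_congr_right fun he => ?_
    have hij : i ≠ j := fun h => hi e' (h ▸ he)
    rw [hk']
    by_cases h : f' = f
    · subst h
      simp [hij, hf, oldKey_eq_some]
    · simp [h]

/-- Both sides change the same identifier at the same moment, so the pair is marked or unmarked as a
whole and no single event ever carries `i`. -/
theorem parKey_move_both
    (hk : ∀ e' j, k₂ e' = some j ↔ (e' = e ∧ d = .fwd ∧ i = j) ∨ (e' ≠ e ∧ k e' = some j))
    (hk' : ∀ f' j, k₂' f' = some j ↔ (f' = f ∧ d = .fwd ∧ i = j) ∨ (f' ≠ f ∧ k' f' = some j))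
    (he : k e = d.oldKey i) (hf : k' f = d.oldKey i)
    (hX : ∀ e', k e' = some i → e' = e) (hY : ∀ f', k' f' = some i → f' = f)
    {p : StarProd A B} {j : ℕ} :
    parKey k₂ k₂' p = some j ↔
      (p = .both e f ∧ d = .fwd ∧ i = j) ∨ (p ≠ .both e f ∧ parKey k k' p = some j) := by
  rcases p with e' | f' | ⟨e', f'⟩
  · rw [parKey_left, parKey_left]
    simp only [reduceCtorEq, false_and, ne_eq, not_false_eq_true, true_and, false_or]
    -- For `i` itself both sides of the equivalence fail: a bearer of `i` on the left is `e`, and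
    -- then `f` carries `i` too, before as well as after the move. Other identifiers are unchanged.
    by_cases hij : i = j
    · subst hij
      refine iff_of_false ?_ ?_
      · rintro ⟨h₁, h₂⟩
        rcases (hk _ _).1 h₁ with ⟨-, hd, -⟩ | ⟨h, h'⟩
        · exact h₂ f ((hk' _ _).2 (Or.inl ⟨rfl, hd, rfl⟩))
        · exact h (hX _ h')
      · rintro ⟨h₁, h₂⟩
        rw [hX _ h₁] at h₁
        exact h₂ f (hf.trans (he.symm.trans h₁))
    · have h1 : ∀ e', k₂ e' = some j ↔ k e' = some j := fun e' => by
        rw [hk]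
        by_cases h : e' = e
        · subst h
          simp [hij, he, oldKey_eq_some]
        · simp [h]
      have h2 : ∀ f', k₂' f' = some j ↔ k' f' = some j := fun f' => by
        rw [hk']
        by_cases h : f' = f
        · subst h
          simp [hij, hf, oldKey_eq_some]
        · simp [h]
      exact and_congr (h1 _) (forall_congr' fun f' => not_congr (h2 f'))
  · rw [parKey_right, parKey_right]
    simp only [reduceCtorEq, false_and, ne_eq, not_false_eq_true, true_and, false_or]
    by_cases hij : i = j
    · subst hij
      refine iff_of_false ?_ ?_
      · rintro ⟨h₁, h₂⟩
        rcases (hk' _ _).1 h₁ with ⟨-, hd, -⟩ | ⟨h, h'⟩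
        · exact h₂ e ((hk _ _).2 (Or.inl ⟨rfl, hd, rfl⟩))
        · exact h (hY _ h')
      · rintro ⟨h₁, h₂⟩
        rw [hY _ h₁] at h₁
        exact h₂ e (he.trans (hf.symm.trans h₁))
    · have h1 : ∀ e', k₂ e' = some j ↔ k e' = some j := fun e' => by
        rw [hk]
        by_cases h : e' = e
        · subst h
          simp [hij, he, oldKey_eq_some]
        · simp [h]
      have h2 : ∀ f', k₂' f' = some j ↔ k' f' = some j := fun f' => by
        rw [hk']
        by_cases h : f' = f
        · subst h
          simp [hij, hf, oldKey_eq_some]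
        · simp [h]
      exact and_congr (h2 _) (forall_congr' fun f' => not_congr (h1 f'))
  · rw [parKey_both, parKey_both, hk, hk']
    by_cases h : e' = e <;> by_cases h' : f' = f
    · subst h h'
      simp
    · subst h
      simp only [true_and, ne_eq, not_true_eq_false, false_and, or_false, h', not_false_eq_true,
        false_or, StarProd.both.injEq, and_false]
      refine and_congr_left fun hf' => ?_
      have hij : i ≠ j := fun hij => h' (hY _ (hij ▸ hf'))
      simp [hij, he, oldKey_eq_some]
    · subst h'
      simp only [true_and, ne_eq, not_true_eq_false, false_and, or_false, h, not_false_eq_true,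
        false_or, StarProd.both.injEq]
      refine and_congr_right fun he' => ?_
      have hij : i ≠ j := fun hij => h (hX _ (hij ▸ he'))
      simp [hij, hf, oldKey_eq_some]
    · simp [h, h']

end parKey

section par

variable {X Y : Marked N}

/-- Events with the same identifier have complementary labels. -/
def Match (X Y : Marked N) : Prop := ∀ e f i, X.key e = some i → Y.key f = some i →
  ∃ l : Vis N, X.S.lab e = .vis l ∧ Y.S.lab f = .vis l.compl

/-- Marked pairs survive the removal of events labelled ⊥. Without this the composition could forget
part of its past. -/
theorem Match.isSome (h : Match X Y) {e : StarProd X.S.E Y.S.E} {i : ℕ}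
    (he : parKey X.key Y.key e = some i) :
    (ConfStruct.parLabel ((X.S.prod Y.S).lab e)).isSome := by
  rcases e with e | f | ⟨e, f⟩
  · rfl
  · rfl
  · obtain ⟨h1, h2⟩ := parKey_both.1 he
    exact ConfStruct.parLabel_both_isSome.2 (h e f i h1 h2)

def parLeft (Y : Marked N) (e : X.S.E) : (X.par Y).S.E := ⟨.left e, rfl⟩

def parRight (X : Marked N) (f : Y.S.E) : (X.par Y).S.E := ⟨.right f, rfl⟩

def parBoth (e : X.S.E) (f : Y.S.E) {l : Vis N} (he : X.S.lab e = .vis l)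
    (hf : Y.S.lab f = .vis l.compl) : (X.par Y).S.E :=
  ⟨.both e f, ConfStruct.parLabel_both_isSome.2 ⟨l, he, hf⟩⟩

theorem lab_parBoth (e : X.S.E) (f : Y.S.E) {l : Vis N} (he : X.S.lab e = .vis l)
    (hf : Y.S.lab f = .vis l.compl) : (X.par Y).S.lab (parBoth e f he hf) = .tau := by
  have h : ConfStruct.parLabel (.both (X.S.lab e) (Y.S.lab f)) = some .tau := by
    rw [he, hf, ConfStruct.parLabel_both]
  exact Option.get_of_eq_some _ h

theorem par_ran (h : Match X Y) : (X.par Y).ran = X.ran ∪ Y.ran := by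
  ext i
  constructor
  · rintro ⟨⟨e | e | ⟨e, f⟩, _⟩, h⟩
    · exact Or.inl ⟨e, (parKey_left.1 h).1⟩
    · exact Or.inr ⟨e, (parKey_right.1 h).1⟩
    · exact Or.inl ⟨e, (parKey_both.1 h).1⟩
  · rintro (⟨e, he⟩ | ⟨e, he⟩)
    · obtain ⟨p, -, hp⟩ := exists_parKey_of_left (k' := Y.key) he
      exact ⟨⟨p, h.isSome hp⟩, hp⟩
    · obtain ⟨p, -, hp⟩ := exists_parKey_of_right (k := X.key) he
      exact ⟨⟨p, h.isSome hp⟩, hp⟩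

theorem image_par_dom (h : Match X Y) : Subtype.val '' (X.par Y).dom = parDom X.key Y.key := by
  ext e
  constructor
  · rintro ⟨d, hd, rfl⟩
    exact hd
  · intro he
    obtain ⟨i, hi⟩ := mem_parDom.1 he
    exact ⟨⟨e, h.isSome hi⟩, he, rfl⟩

theorem par_dom_mem_iff (h : Match X Y) :
    (X.par Y).dom ∈ (X.par Y).S.C ↔ parDom X.key Y.key ∈ (X.S.prod Y.S).C :=
  iff_of_eq (congrArg (· ∈ (X.S.prod Y.S).C) (image_par_dom h))

theorem dom_left_mem (h : Match X Y) (hd : (X.par Y).dom ∈ (X.par Y).S.C) : X.dom ∈ X.S.C := by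
  have := ((par_dom_mem_iff h).1 hd).1.1
  rwa [fstImage_parDom] at this

theorem dom_right_mem (h : Match X Y) (hd : (X.par Y).dom ∈ (X.par Y).S.C) : Y.dom ∈ Y.S.C := by
  have := ((par_dom_mem_iff h).1 hd).1.2
  rwa [sndImage_parDom] at this

theorem par_valid (hX : X.Valid) (hY : Y.Valid) (hd : (X.par Y).dom ∈ (X.par Y).S.C) :
    (X.par Y).Valid := by
  have := hX.finite
  have := hY.finite
  have := ConfStruct.prod_finite X.S Y.S
  have hf : Finite (X.par Y).S.E := by
    refine Finite.of_injective (β := (X.S.prod Y.S).E) Subtype.val Subtype.val_injective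
  exact ⟨hf, ConfStruct.isConfStruct_of_injective (ConfStruct.prod_isConfStruct hX.conf hY.conf)
    Subtype.val Subtype.val_injective fun _ => Iff.rfl, hd,
    fun e e' i h h' => Subtype.ext (parKey_inj hX.inj hY.inj h h')⟩

variable {d : Dir} {e : X.S.E} {f : Y.S.E} {i : ℕ}

theorem Match.move_left (h : Match X Y) (hi : i ∉ Y.ran) : Match (X.move d e i) Y := by
  intro e' f' j h₁ h₂
  rcases key_move_eq_some.1 h₁ with ⟨-, -, rfl⟩ | ⟨-, h₁⟩
  · exact absurd ⟨_, h₂⟩ hi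
  · exact h _ _ _ h₁ h₂

theorem Match.move_right (h : Match X Y) (hi : i ∉ X.ran) : Match X (Y.move d f i) := by
  intro e' f' j h₁ h₂
  rcases key_move_eq_some.1 h₂ with ⟨-, -, rfl⟩ | ⟨-, h₂⟩
  · exact absurd ⟨_, h₁⟩ hi
  · exact h _ _ _ h₁ h₂

theorem Match.move_both (h : Match X Y) {l : Vis N} (he : X.S.lab e = .vis l)
    (hf : Y.S.lab f = .vis l.compl) (hX : ∀ e', X.key e' = some i → e' = e)
    (hY : ∀ f', Y.key f' = some i → f' = f) : Match (X.move d e i) (Y.move d f i) := by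
  intro e' f' j h₁ h₂
  rcases key_move_eq_some.1 h₁ with ⟨h₃, -, hij⟩ | ⟨h₃, h₃'⟩ <;>
    rcases key_move_eq_some.1 h₂ with ⟨h₄, -, hij'⟩ | ⟨h₄, h₄'⟩
  · exact ⟨l, by rw [h₃]; exact he, by rw [h₄]; exact hf⟩
  · exact absurd (hY _ (hij ▸ h₄')) h₄
  · exact absurd (hX _ (hij' ▸ h₃')) h₃
  · exact h _ _ _ h₃' h₄'

theorem parLeft_move (he : X.key e = d.oldKey i) (hi : i ∉ Y.ran) :
    (X.par Y).move d (parLeft Y e) i = (X.move d e i).par Y := by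
  have h := fun p j => parKey_move_left (p := p) (j := j) (fun _ _ => key_move_eq_some) he
    (fun f h => hi ⟨f, h⟩)
  -- The two marked structures have the same underlying structure by definition, so only identifiers
  -- are compared.
  refine congrArg (Marked.mk (X.par Y).S) (funext fun p => Option.ext fun j => ?_)
  refine Iff.trans ?_ (h p.1 j).symm
  exact key_move_eq_some.trans (or_congr (and_congr Subtype.ext_iff Iff.rfl)
    (and_congr (not_congr Subtype.ext_iff) Iff.rfl))

theorem parRight_move (hf : Y.key f = d.oldKey i) (hi : i ∉ X.ran) :
    (X.par Y).move d (parRight X f) i = X.par (Y.move d f i) := by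
  have h := fun p j => parKey_move_right (p := p) (j := j) (fun _ _ => key_move_eq_some) hf
    (fun f h => hi ⟨f, h⟩)
  refine congrArg (Marked.mk (X.par Y).S) (funext fun p => Option.ext fun j => ?_)
  refine Iff.trans ?_ (h p.1 j).symm
  exact key_move_eq_some.trans (or_congr (and_congr Subtype.ext_iff Iff.rfl)
    (and_congr (not_congr Subtype.ext_iff) Iff.rfl))

theorem parBoth_move {l : Vis N} (hl : X.S.lab e = .vis l) (hl' : Y.S.lab f = .vis l.compl)
    (he : X.key e = d.oldKey i) (hf : Y.key f = d.oldKey i)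
    (hX : ∀ e', X.key e' = some i → e' = e) (hY : ∀ f', Y.key f' = some i → f' = f) :
    (X.par Y).move d (parBoth e f hl hl') i = (X.move d e i).par (Y.move d f i) := by
  have h := fun p j => parKey_move_both (p := p) (j := j) (fun _ _ => key_move_eq_some)
    (fun _ _ => key_move_eq_some) he hf hX hY
  refine congrArg (Marked.mk (X.par Y).S) (funext fun p => Option.ext fun j => ?_)
  refine Iff.trans ?_ (h p.1 j).symm
  exact key_move_eq_some.trans (or_congr (and_congr Subtype.ext_iff Iff.rfl)
    (and_congr (not_congr Subtype.ext_iff) Iff.rfl))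

theorem parDom_move {A B : Type} {k k₂ : A → Option ℕ} {k' k₂' : B → Option ℕ} {d : Dir} {i : ℕ}
    {p : StarProd A B} (h : ∀ q j, parKey k₂ k₂' q = some j ↔
      (q = p ∧ d = .fwd ∧ i = j) ∨ (q ≠ p ∧ parKey k k' q = some j)) :
    ∃ p, parDom k₂ k₂' = insert p (parDom k k') ∨ parDom k₂ k₂' = parDom k k' \ {p} := by
  refine ⟨p, ?_⟩
  cases d with
  | fwd =>
    refine Or.inl (Set.ext fun q => mem_parDom.trans ⟨?_, ?_⟩)
    · rintro ⟨j, hj⟩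
      rcases (h q j).1 hj with ⟨hq, -⟩ | ⟨-, hq⟩
      · exact Or.inl hq
      · exact Or.inr (mem_parDom.2 ⟨j, hq⟩)
    · intro hq
      by_cases hqp : q = p
      · exact ⟨i, (h q i).2 (Or.inl ⟨hqp, rfl, rfl⟩)⟩
      · obtain ⟨j, hj⟩ := mem_parDom.1 (hq.resolve_left hqp)
        exact ⟨j, (h q j).2 (Or.inr ⟨hqp, hj⟩)⟩
  | bwd =>
    refine Or.inr (Set.ext fun q => mem_parDom.trans ⟨?_, ?_⟩)
    · rintro ⟨j, hj⟩
      rcases (h q j).1 hj with ⟨-, hq, -⟩ | ⟨hqp, hq⟩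
      · exact absurd hq (by simp)
      · exact ⟨mem_parDom.2 ⟨j, hq⟩, hqp⟩
    · rintro ⟨hq, hqp⟩
      obtain ⟨j, hj⟩ := mem_parDom.1 hq
      exact ⟨j, (h q j).2 (Or.inr ⟨hqp, hj⟩)⟩

theorem par_can_left (hX : X.Valid) (hY : Y.Valid) (hm : Match X Y)
    (hd : (X.par Y).dom ∈ (X.par Y).S.C) (h : X.Can d e i) (hi : i ∉ Y.ran) :
    (X.par Y).Can d (parLeft Y e) i where
  key := by
    have hY : ∀ f, Y.key f ≠ some i := fun f h => hi ⟨f, h⟩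
    change parKey X.key Y.key (.left e) = _
    refine Option.ext fun j => parKey_left.trans ?_
    rw [h.key, oldKey_eq_some]
    constructor
    · exact fun h => h.1
    · rintro ⟨h₁, rfl⟩
      exact ⟨⟨h₁, rfl⟩, hY⟩
  fresh := by
    rintro ⟨e' | f' | ⟨e', f'⟩, hp⟩ h'
    · exact Subtype.ext (congrArg StarProd.left (h.fresh e' (parKey_left.1 h').1))
    · exact absurd ⟨f', (parKey_right.1 h').1⟩ hi
    · exact absurd ⟨f', (parKey_both.1 h').2⟩ hi
  mem := by
    have := hX.finite
    have := hY.finite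
    have : ((X.par Y).move d (parLeft Y e) i).dom ∈ ((X.par Y).move d (parLeft Y e) i).S.C := by
      rw [parLeft_move h.key hi, par_dom_mem_iff (hm.move_left hi)]
      refine parDom_mem (S := X.S) (T := Y.S) hX.conf hY.conf ((par_dom_mem_iff hm).1 hd)
        (hX.move h).inj hY.inj h.mem hY.dom_mem ?_
      exact parDom_move (d := d) fun p j => parKey_move_left (fun _ _ => key_move_eq_some) h.key
        (fun f h => hi ⟨f, h⟩)
    exact this

theorem par_can_right (hX : X.Valid) (hY : Y.Valid) (hm : Match X Y)
    (hd : (X.par Y).dom ∈ (X.par Y).S.C) (h : Y.Can d f i) (hi : i ∉ X.ran) :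
    (X.par Y).Can d (parRight X f) i where
  key := by
    have hX : ∀ e, X.key e ≠ some i := fun f h => hi ⟨f, h⟩
    change parKey X.key Y.key (.right f) = _
    refine Option.ext fun j => parKey_right.trans ?_
    rw [h.key, oldKey_eq_some]
    constructor
    · exact fun h => h.1
    · rintro ⟨h₁, rfl⟩
      exact ⟨⟨h₁, rfl⟩, hX⟩
  fresh := by
    rintro ⟨e' | f' | ⟨e', f'⟩, hp⟩ h'
    · exact absurd ⟨e', (parKey_left.1 h').1⟩ hi
    · exact Subtype.ext (congrArg StarProd.right (h.fresh f' (parKey_right.1 h').1))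
    · exact absurd ⟨e', (parKey_both.1 h').1⟩ hi
  mem := by
    have := hX.finite
    have := hY.finite
    have : ((X.par Y).move d (parRight X f) i).dom ∈
        ((X.par Y).move d (parRight X f) i).S.C := by
      rw [parRight_move h.key hi, par_dom_mem_iff (hm.move_right hi)]
      refine parDom_mem (S := X.S) (T := Y.S) hX.conf hY.conf ((par_dom_mem_iff hm).1 hd)
        hX.inj (hY.move h).inj hX.dom_mem h.mem ?_
      exact parDom_move (d := d) fun p j => parKey_move_right (fun _ _ => key_move_eq_some) h.key
        (fun f h => hi ⟨f, h⟩)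
    exact this

theorem par_can_both (hX : X.Valid) (hY : Y.Valid) (hm : Match X Y)
    (hd : (X.par Y).dom ∈ (X.par Y).S.C) {l : Vis N} (hl : X.S.lab e = .vis l)
    (hl' : Y.S.lab f = .vis l.compl) (h : X.Can d e i) (h' : Y.Can d f i) :
    (X.par Y).Can d (parBoth e f hl hl') i where
  key := by
    change parKey X.key Y.key (.both e f) = _
    refine Option.ext fun j => parKey_both.trans ?_
    rw [h.key, h'.key, and_self_iff]
  fresh := by
    rintro ⟨e' | f' | ⟨e', f'⟩, hp⟩ hk
    · obtain ⟨hk₁, hk₂⟩ := parKey_left.1 hk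
      have h1 := h.fresh e' hk₁
      rw [h1, h.key] at hk₁
      exact absurd (h'.key.trans hk₁) (hk₂ f)
    · obtain ⟨hk₁, hk₂⟩ := parKey_right.1 hk
      have h1 := h'.fresh f' hk₁
      rw [h1, h'.key] at hk₁
      exact absurd (h.key.trans hk₁) (hk₂ e)
    · obtain ⟨hk₁, hk₂⟩ := parKey_both.1 hk
      exact Subtype.ext (congrArg₂ StarProd.both (h.fresh e' hk₁) (h'.fresh f' hk₂))
  mem := by
    have := hX.finite
    have := hY.finite
    have : ((X.par Y).move d (parBoth e f hl hl') i).dom ∈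
        ((X.par Y).move d (parBoth e f hl hl') i).S.C := by
      rw [parBoth_move hl hl' h.key h'.key h.fresh h'.fresh,
        par_dom_mem_iff (hm.move_both hl hl' h.fresh h'.fresh)]
      refine parDom_mem (S := X.S) (T := Y.S) hX.conf hY.conf ((par_dom_mem_iff hm).1 hd)
        (hX.move h).inj (hY.move h').inj h.mem h'.mem ?_
      exact parDom_move (d := d) fun p j => parKey_move_both (fun _ _ => key_move_eq_some)
        (fun _ _ => key_move_eq_some) h.key h'.key h.fresh h'.fresh
    exact this

/-- If a component of `p` were already marked, some marked event `q` would contain it. After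
performing `p`, both lie in a configuration of the product, where components are not shared, so `q =
p`; but `p` was unmarked. -/
theorem key_eq_none_of_can_fwd (hm : Match X Y) {p : (X.par Y).S.E}
    (h : (X.par Y).Can .fwd p i) :
    (∀ e, p.1.fst = some e → X.key e = none) ∧ (∀ f, p.1.snd = some f → Y.key f = none) ∧
      i ∉ X.ran ∧ i ∉ Y.ran := by
  have hloc : StarProd.LocInj (Subtype.val '' ((X.par Y).move .fwd p i).dom) := h.mem.2.1
  have hp : p.1 ∈ Subtype.val '' ((X.par Y).move .fwd p i).dom :=
    ⟨p, (dom_upd_some _ _ _).symm ▸ Or.inl rfl, rfl⟩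
  have hq : ∀ q j, parKey X.key Y.key q = some j →
      q ∈ Subtype.val '' ((X.par Y).move .fwd p i).dom := fun q j hq =>
    ⟨⟨q, hm.isSome hq⟩, (dom_upd_some _ _ _).symm ▸ Or.inr (mem_dom.2 ⟨j, hq⟩), rfl⟩
  have hpk : parKey X.key Y.key p.1 = none := h.key
  have hr : i ∉ (X.par Y).ran := by
    rintro ⟨q, hq⟩
    have := h.fresh q hq
    rw [this, h.key] at hq
    exact Option.some_ne_none _ hq.symm
  rw [par_ran hm, Set.mem_union, not_or] at hr
  refine ⟨fun e he => ?_, fun f hf => ?_, hr⟩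
  · by_contra hk
    obtain ⟨j, hj⟩ := Option.ne_none_iff_exists'.1 hk
    obtain ⟨q, hqe, hqj⟩ := exists_parKey_of_left (k' := Y.key) hj
    have := hloc q (hq q j hqj) p.1 hp (Or.inl ⟨hqe.trans he.symm, by simp [hqe]⟩)
    rw [this, hpk] at hqj
    exact Option.some_ne_none _ hqj.symm
  · by_contra hk
    obtain ⟨j, hj⟩ := Option.ne_none_iff_exists'.1 hk
    obtain ⟨q, hqe, hqj⟩ := exists_parKey_of_right (k := X.key) hj
    have := hloc q (hq q j hqj) p.1 hp (Or.inr ⟨hqe.trans hf.symm, by simp [hqe]⟩)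
    rw [this, hpk] at hqj
    exact Option.some_ne_none _ hqj.symm

/-- The transitions of a parallel composition come from its components. -/
theorem par_can_cases (hX : X.Valid) (hY : Y.Valid) (hm : Match X Y) {p : (X.par Y).S.E}
    (h : (X.par Y).Can d p i) :
    (∃ e, p = parLeft Y e ∧ X.Can d e i ∧ i ∉ Y.ran) ∨
    (∃ f, p = parRight X f ∧ Y.Can d f i ∧ i ∉ X.ran) ∨
    (∃ e f l, ∃ (hl : X.S.lab e = .vis l) (hl' : Y.S.lab f = .vis l.compl),
      p = parBoth e f hl hl' ∧ X.Can d e i ∧ Y.Can d f i) := by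
  have hmem : ((X.par Y).move d p i).dom ∈ ((X.par Y).move d p i).S.C := h.mem
  rcases p with ⟨e | f | ⟨e, f⟩, hp⟩
  -- Forward, the component is unmarked by local injectivity of the configuration reached; backward,
  -- the information is contained in the identifier of the single event.
  · have key : X.key e = d.oldKey i ∧ i ∉ Y.ran ∧ ∀ e', X.key e' = some i → e' = e := by
      cases d with
      | fwd =>
        obtain ⟨h1, -, h3, h4⟩ := key_eq_none_of_can_fwd hm h
        exact ⟨h1 e rfl, h4, fun e' h => absurd ⟨e', h⟩ h3⟩
      | bwd =>
        obtain ⟨h1, h2⟩ := parKey_left.1 h.key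
        exact ⟨h1, fun ⟨f, h⟩ => h2 f h, fun e' h => hX.inj _ _ _ h h1⟩
    refine Or.inl ⟨e, rfl, ⟨key.1, key.2.2, ?_⟩, key.2.1⟩
    change ((X.par Y).move d (parLeft Y e) i).dom ∈
      ((X.par Y).move d (parLeft Y e) i).S.C at hmem
    rw [parLeft_move key.1 key.2.1] at hmem
    exact dom_left_mem (hm.move_left key.2.1) hmem
  · have key : Y.key f = d.oldKey i ∧ i ∉ X.ran ∧ ∀ f', Y.key f' = some i → f' = f := by
      cases d with
      | fwd =>
        obtain ⟨-, h1, h3, h4⟩ := key_eq_none_of_can_fwd hm h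
        exact ⟨h1 f rfl, h3, fun e' h => absurd ⟨e', h⟩ h4⟩
      | bwd =>
        obtain ⟨h1, h2⟩ := parKey_right.1 h.key
        exact ⟨h1, fun ⟨f, h⟩ => h2 f h, fun e' h => hY.inj _ _ _ h h1⟩
    refine Or.inr (Or.inl ⟨f, rfl, ⟨key.1, key.2.2, ?_⟩, key.2.1⟩)
    change ((X.par Y).move d (parRight X f) i).dom ∈
      ((X.par Y).move d (parRight X f) i).S.C at hmem
    rw [parRight_move key.1 key.2.1] at hmem
    exact dom_right_mem (hm.move_right key.2.1) hmem
  · obtain ⟨l, hl, hl'⟩ := ConfStruct.parLabel_both_isSome.1 hp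
    have key : (X.key e = d.oldKey i ∧ ∀ e', X.key e' = some i → e' = e) ∧
        (Y.key f = d.oldKey i ∧ ∀ f', Y.key f' = some i → f' = f) := by
      cases d with
      | fwd =>
        obtain ⟨h1, h2, h3, h4⟩ := key_eq_none_of_can_fwd hm h
        exact ⟨⟨h1 e rfl, fun e' h => absurd ⟨e', h⟩ h3⟩, h2 f rfl,
          fun e' h => absurd ⟨e', h⟩ h4⟩
      | bwd =>
        obtain ⟨h1, h2⟩ := parKey_both.1 h.key
        exact ⟨⟨h1, fun e' h => hX.inj _ _ _ h h1⟩, h2, fun e' h => hY.inj _ _ _ h h2⟩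
    change ((X.par Y).move d (parBoth e f hl hl') i).dom ∈
      ((X.par Y).move d (parBoth e f hl hl') i).S.C at hmem
    rw [parBoth_move hl hl' key.1.1 key.2.1 key.1.2 key.2.2] at hmem
    have hm' := hm.move_both (d := d) hl hl' key.1.2 key.2.2
    exact Or.inr (Or.inr ⟨e, f, l, hl, hl', rfl, ⟨key.1.1, key.1.2, dom_left_mem hm' hmem⟩,
      ⟨key.2.1, key.2.2, dom_right_mem hm' hmem⟩⟩)

end par

end Marked
-- Memories as stacks above a base
namespace Mem

variable {N : Type u}

/-- Push a list of events, the first of which comes on top. -/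
def pushes (m : Mem N) : List (ℕ × Vis N × CCS N) → Mem N
  | [] => m
  | (i, l, Q) :: es => .ev i l Q (m.pushes es)

/-- The identifiers of a memory are distinct and the residuals are summands. -/
def WF : Mem N → Prop
  | empty => True
  | fork m => WF m
  | ev i _ Q m => i ∉ m.ids ∧ (Q = .nil ∨ ∃ k Q', Q = .pre k Q') ∧ WF m

/-- The top of the memory is not an event. -/
def IsBase : Mem N → Prop
  | ev _ _ _ _ => False
  | _ => True

theorem mem_ids_pushes {m : Mem N} {x : ℕ × Vis N × CCS N} : ∀ {es}, x ∈ es →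
    x.1 ∈ (m.pushes es).ids
  | y :: es, h => by
    rcases List.mem_cons.1 h with rfl | h
    · exact Or.inl rfl
    · exact Or.inr (mem_ids_pushes h)

theorem fn_subset_pushes (m : Mem N) : ∀ es, m.fn ⊆ (m.pushes es).fn
  | [] => subset_rfl
  | _ :: es => (fn_subset_pushes m es).trans Set.subset_union_right

theorem notMem_fn_pushes {m : Mem N} {a : N} : ∀ {es}, a ∉ (m.pushes es).fn →
    ∀ x ∈ es, x.2.1.base ≠ a ∧ a ∉ x.2.2.fn
  | y :: es, h, x, hx => by
    rcases List.mem_cons.1 hx with rfl | hx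
    · exact ⟨fun h' => h (Or.inl (Or.inl h'.symm)), fun h' => h (Or.inl (Or.inr h'))⟩
    · exact notMem_fn_pushes (es := es) (fun h' => h (Or.inr h')) x hx

end Mem

namespace Marked

variable {N : Type u}

/-! ### Sequences of past events -/

/-- Add a list of past prefixes, the first of which is innermost. -/
noncomputable def wrap (X : Marked N) : List (ℕ × Vis N × CCS N) → Marked N
  | [] => X
  | (i, l, Q) :: es => (X.past i l Q).wrap es

/-- The event of `X.wrap es` given by an event of `X`. -/
noncomputable def wrapOld : ∀ (es : List (ℕ × Vis N × CCS N)) {X : Marked N},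
    X.S.E → (X.wrap es).S.E
  | [], _, e => e
  | (i, l, Q) :: es, _, e => wrapOld es (pastOld i l Q e)

noncomputable def Iso.wrap : ∀ (es : List (ℕ × Vis N × CCS N)) {X Y : Marked N}, Iso id X Y →
    Iso id (X.wrap es) (Y.wrap es)
  | [], _, _, f => f
  | (i, l, Q) :: es, _, _, f => Iso.wrap es (f.past i l Q)

theorem wrap_lab : ∀ (es : List (ℕ × Vis N × CCS N)) {X : Marked N} (e : X.S.E),
    (X.wrap es).S.lab (wrapOld es e) = X.S.lab e
  | [], _, _ => rfl
  | (i, l, Q) :: es, _, e => (wrap_lab es (pastOld i l Q e)).trans rfl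

theorem wrap_move : ∀ (es : List (ℕ × Vis N × CCS N)) {X : Marked N} (d : Dir) (e : X.S.E)
    (j : ℕ), (X.wrap es).move d (wrapOld es e) j = (X.move d e j).wrap es
  | [], _, _, _, _ => rfl
  | (i, l, Q) :: es, X, d, e, j => by
    refine (wrap_move es d (pastOld i l Q e) j).trans ?_
    rw [past_move]
    rfl

theorem wrap_can : ∀ {es : List (ℕ × Vis N × CCS N)} {X : Marked N} {d : Dir} {e : X.S.E}
    {j : ℕ}, X.Can d e j → (∀ x ∈ es, j ≠ x.1) → (X.wrap es).Can d (wrapOld es e) j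
  | [], _, _, _, _, h, _ => h
  | _ :: es, _, _, _, _, h, hj =>
    wrap_can (es := es) (past_can h (hj _ List.mem_cons_self)) fun x hx =>
      hj x (List.mem_cons_of_mem _ hx)

theorem exists_of_wrap_can : ∀ {es : List (ℕ × Vis N × CCS N)} {X : Marked N} {d : Dir}
    {e : (X.wrap es).S.E} {j : ℕ}, (X.wrap es).Can d e j → (d = .fwd ∨ X.dom.Nonempty) →
    ∃ e', e = wrapOld es e' ∧ X.Can d e' j ∧ ∀ x ∈ es, j ≠ x.1
  | [], _, _, e, _, h, _ => ⟨e, rfl, h, fun _ h => absurd h List.not_mem_nil⟩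
  | (i, l, Q) :: es, X, d, e, j, h, hd => by
    -- As soon as one past prefix is present the structure has a marked event, so the prefixes
    -- further out cannot be undone. Only the innermost one needs the hypothesis `hd`.
    have hne : (X.past i l Q).dom.Nonempty := ⟨pastNew i l Q X, by rw [past_dom]; exact Or.inl rfl⟩
    obtain ⟨e', rfl, h', hj⟩ := exists_of_wrap_can (es := es) h (Or.inr hne)
    obtain ⟨e, rfl, h, hi⟩ := exists_of_past_can h' hd
    refine ⟨e, rfl, h, fun x hx => ?_⟩
    rcases List.mem_cons.1 hx with rfl | hx
    · exact hi
    · exact hj x hx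

theorem Iso.dom_eq_empty {s : N → N} {X Y : Marked N} (f : Iso s X Y) (h : Y.dom = ∅) :
    X.dom = ∅ := by
  rw [← f.preimage_dom, h, Set.preimage_empty]

theorem dom_eq_empty_iff {X : Marked N} : X.dom = ∅ ↔ X.ran = ∅ := by
  constructor
  · exact fun h => Set.eq_empty_of_forall_notMem fun i ⟨e, he⟩ =>
      Set.notMem_empty e (h ▸ mem_dom.2 ⟨i, he⟩)
  · refine fun h => Set.eq_empty_of_forall_notMem fun e he => ?_
    obtain ⟨i, hi⟩ := mem_dom.1 he
    exact Set.notMem_empty i (h ▸ ⟨e, hi⟩)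

theorem dom_eq_empty_of_par {X Y : Marked N} (hm : Match X Y) (h : (X.par Y).dom = ∅) :
    X.dom = ∅ ∧ Y.dom = ∅ := by
  rwa [dom_eq_empty_iff, par_ran hm, Set.union_empty_iff, ← dom_eq_empty_iff,
    ← dom_eq_empty_iff] at h

/-- Wrapping transfers the identifiers of the pushed events from the memory to the structure; the
total set of identifiers is unchanged. -/
theorem wrap_props {m : Mem N} : ∀ {es : List (ℕ × Vis N × CCS N)} {X : Marked N},
    X.Valid → (m.pushes es).WF → Disjoint (m.pushes es).ids X.ran →
    (X.wrap es).Valid ∧ Disjoint m.ids (X.wrap es).ran ∧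
      m.ids ∪ (X.wrap es).ran = (m.pushes es).ids ∪ X.ran
  | [], _, h, _, hd => ⟨h, hd, rfl⟩
  | (i, l, Q) :: es, X, h, hw, hd => by
    have hi : i ∉ X.ran := fun hi => Set.disjoint_left.1 hd (Or.inl rfl) hi
    obtain ⟨h1, h2, h3⟩ := wrap_props (m := m) (es := es) (X := X.past i l Q) (past_valid h hi)
      hw.2.2 (by
        rw [past_ran, Set.disjoint_insert_right]
        exact ⟨hw.1, hd.mono_left Set.subset_union_right⟩)
    refine ⟨h1, h2, h3.trans ?_⟩
    rw [past_ran, ← Set.singleton_union, ← Set.union_assoc]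
    congr 1
    exact Set.union_comm _ _

theorem wrap_dom_nonempty : ∀ {es : List (ℕ × Vis N × CCS N)} {X : Marked N},
    X.dom.Nonempty → (X.wrap es).dom.Nonempty
  | [], _, h => h
  | (i, l, Q) :: es, X, ⟨x, hx⟩ => by
    refine wrap_dom_nonempty (es := es) ⟨pastNew i l Q X, ?_⟩
    rw [past_dom]
    exact Or.inl rfl

theorem eq_nil_of_wrap_dom {es : List (ℕ × Vis N × CCS N)} {X : Marked N}
    (h : (X.wrap es).dom = ∅) : es = [] ∧ X.dom = ∅ := by
  rcases es with _ | ⟨⟨i, l, Q⟩, es⟩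
  · exact ⟨rfl, h⟩
  · refine absurd h (Set.Nonempty.ne_empty ?_)
    refine wrap_dom_nonempty (es := es) ⟨pastNew i l Q X, ?_⟩
    rw [past_dom]
    exact Or.inl rfl

theorem wrap_avoids {a : N} : ∀ {es : List (ℕ × Vis N × CCS N)} {X : Marked N}, X.Avoids a →
    (∀ x ∈ es, x.2.1.base ≠ a) → (X.wrap es).Avoids a
  | [], _, h, _ => h
  | (i, l, Q) :: es, X, h, he => by
    refine wrap_avoids (es := es) ?_ fun x hx => he x (List.mem_cons_of_mem _ hx)
    intro e hed
    rw [past_dom] at hed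
    rcases hed with rfl | ⟨d, hd, rfl⟩
    · exact he _ List.mem_cons_self
    · exact h d hd

/-- Iterates `pastRes`; this is the content of the scope law of structural congruence. -/
theorem wrap_res {a : N} : ∀ (es : List (ℕ × Vis N × CCS N)) (X : Marked N),
    (∀ x ∈ es, x.2.1.base ≠ a ∧ a ∉ x.2.2.fn) →
    Nonempty (Iso id ((X.wrap es).res a) ((X.res a).wrap es))
  | [], _, _ => ⟨Iso.refl _⟩
  | (i, l, Q) :: es, X, h => by
    obtain ⟨f⟩ := wrap_res es (X.past i l Q) fun x hx => h x (List.mem_cons_of_mem _ hx)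
    obtain ⟨h1, h2⟩ := h _ List.mem_cons_self
    exact ⟨f.trans (Iso.wrap es (pastRes i X h1 h2))⟩

end Marked

/-! ## The structure of a reversible process -/

open Marked in
/-- `R.Rep m X`: above the memory `m`, the process `R` is represented by the marked structure `X`. -/
def RProc.Rep {N : Type u} : RProc N → Mem N → Marked N → Prop
  -- The top of the memory is the most recent event, hence the innermost prefix around `P`:
  -- `Mem.pushes` and `wrap` read `es` in matching orders.
  | .thread m' P, m, X => ∃ es, m' = m.pushes es ∧ m'.WF ∧ Nonempty (Iso id ((lift P).wrap es) X)
  -- The list `es` is what was performed before the split. It is shared by both components and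
  -- therefore wrapped around their composition instead of occurring in `Y` and `Z`. Validity of the
  -- two pasts separately does not make them compatible, so matching labels and the joint
  -- configuration are required.
  | .par R S, m, X => ∃ es Y Z, R.Rep (m.pushes es).fork Y ∧ S.Rep (m.pushes es).fork Z ∧
      (m.pushes es).WF ∧ Match Y Z ∧ (Y.par Z).dom ∈ (Y.par Z).S.C ∧
      Nonempty (Iso id ((Y.par Z).wrap es) X)
  -- The condition on `m.fn` allows the restriction to be moved back into the thread when the past
  -- above `m` is empty.
  | .res R a, m, X => ∃ Y, R.Rep m Y ∧ a ∉ m.fn ∧ Y.Avoids a ∧ Nonempty (Iso id (Y.res a) X)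

namespace RProc

open Marked

variable {N : Type u}

/-- Identifiers of a represented process split into those of the common memory and those of the
structure. This converts the side conditions on `ids` in the transition rules into conditions on
`ran`. -/
theorem Rep.props {R : RProc N} : ∀ {m : Mem N} {X : Marked N}, R.Rep m X →
    X.Valid ∧ Disjoint m.ids X.ran ∧ R.ids = m.ids ∪ X.ran := by
  induction R with
  | thread m' P =>
    rintro m X ⟨es, rfl, hw, ⟨f⟩⟩
    obtain ⟨h1, h2, h3⟩ := wrap_props (m := m) (lift_valid P) hw
      (by rw [lift_ran]; exact Set.disjoint_empty _)
    rw [f.ran_eq] at h2 h3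
    rw [lift_ran, Set.union_empty] at h3
    exact ⟨f.valid h1, h2, h3.symm⟩
  | par R S ihR ihS =>
    rintro m X ⟨es, Y, Z, hR, hS, hw, hm, hd, ⟨f⟩⟩
    obtain ⟨hR1, hR2, hR3⟩ := ihR hR
    obtain ⟨hS1, hS2, hS3⟩ := ihS hS
    obtain ⟨h1, h2, h3⟩ := wrap_props (m := m) (par_valid hR1 hS1 hd) hw
      (by rw [par_ran hm]; exact Set.disjoint_union_right.2 ⟨hR2, hS2⟩)
    rw [f.ran_eq] at h2 h3
    refine ⟨f.valid h1, h2, ?_⟩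
    rw [h3, par_ran hm, ids, hR3, hS3, ← Set.union_union_distrib_left]
    rfl
  | res R a ih =>
    rintro m X ⟨Y, hR, -, ha, ⟨f⟩⟩
    obtain ⟨h1, h2, h3⟩ := ih hR
    rw [ids, ← f.ran_eq, res_ran ha]
    exact ⟨f.valid (res_valid h1 ha), h2, h3⟩

theorem Rep.ran_subset {R : RProc N} {m : Mem N} {X : Marked N} (h : R.Rep m X) :
    X.ran ⊆ R.ids := h.props.2.2 ▸ Set.subset_union_right

theorem Rep.ids_subset {R : RProc N} {m : Mem N} {X : Marked N} (h : R.Rep m X) :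
    m.ids ⊆ R.ids := h.props.2.2 ▸ Set.subset_union_left

theorem rep_start (P : CCS N) : (start P).Rep .empty (lift P) := ⟨[], rfl, trivial, ⟨Iso.refl _⟩⟩

theorem eq_nil_of_fork_eq_pushes {m m' : Mem N} {es} (h : m'.fork = m.fork.pushes es) :
    es = [] ∧ m' = m := by
  rcases es with _ | ⟨⟨i, l, Q⟩, es⟩
  · exact ⟨rfl, Mem.fork.inj h⟩
  · cases h

/-- Each law of congruence is an isomorphism of marked structures: `lift_par` for distribution,
`wrap_res` for scope and `nonempty_iso_of_cong` inside threads. The statement is an equivalence, so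
the symmetry rule is immediate, and it is uniform in `m` and `X` because components of a composition
are read above a forked memory. -/
theorem Cong.rep_iff {R S : RProc N} (h : Cong R S) : ∀ {m : Mem N} {X : Marked N},
    R.Rep m X ↔ S.Rep m X := by
  induction h with
  | refl R => exact Iff.rfl
  | symm _ ih => exact ih.symm
  | trans _ _ ih ih' => exact ih.trans ih'
  | par _ _ ih ih' =>
    intro m X
    exact exists_congr fun es => exists_congr fun Y => exists_congr fun Z =>
      and_congr ih (and_congr ih' Iff.rfl)
  | res a _ ih =>
    intro m X
    exact exists_congr fun Y => and_congr ih Iff.rfl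
  | thread m' h =>
    intro m X
    obtain ⟨f⟩ := nonempty_iso_of_cong h
    refine exists_congr fun es => and_congr Iff.rfl (and_congr Iff.rfl ⟨?_, ?_⟩)
    · rintro ⟨g⟩
      exact ⟨(f.symm.wrap es).trans g⟩
    · rintro ⟨g⟩
      exact ⟨(f.wrap es).trans g⟩
  | distrib m' P Q =>
    intro m X
    constructor
    · rintro ⟨es, rfl, hw, hf⟩
      rw [lift_par] at hf
      refine ⟨es, lift P, lift Q, ⟨[], rfl, hw, ⟨Iso.refl _⟩⟩, ⟨[], rfl, hw, ⟨Iso.refl _⟩⟩, hw,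
        fun _ _ _ h => absurd h.symm (Option.some_ne_none _), ?_, hf⟩
      rw [← lift_par]
      exact (lift_valid _).dom_mem
    -- Nothing can have been pushed above the fork, since both threads have the forked memory
    -- itself; hence `es₁` and `es₂` are empty and the components have no past of their own.
    · rintro ⟨es, Y, Z, ⟨es₁, h₁, hw, ⟨f₁⟩⟩, ⟨es₂, h₂, -, ⟨f₂⟩⟩, -, -, -, ⟨g⟩⟩
      obtain ⟨rfl, rfl⟩ := eq_nil_of_fork_eq_pushes h₁
      obtain ⟨rfl, -⟩ := eq_nil_of_fork_eq_pushes h₂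
      refine ⟨es, rfl, hw, ?_⟩
      rw [lift_par]
      exact ⟨((f₁.par Function.injective_id f₂).wrap es).trans g⟩
  | scope m' P a ha =>
    intro m X
    constructor
    · rintro ⟨es, rfl, hw, ⟨f⟩⟩
      have hes := Mem.notMem_fn_pushes ha
      obtain ⟨g⟩ := wrap_res es (lift P) hes
      refine ⟨(lift P).wrap es, ⟨es, rfl, hw, ⟨Iso.refl _⟩⟩,
        fun h => ha (Mem.fn_subset_pushes _ _ h), wrap_avoids ?_ fun x hx => (hes x hx).1,
        ⟨g.trans f⟩⟩
      intro e he
      rw [lift_dom] at he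
      exact absurd he (Set.notMem_empty _)
    · rintro ⟨Y, ⟨es, rfl, hw, ⟨f⟩⟩, -, -, ⟨g⟩⟩
      obtain ⟨g'⟩ := wrap_res es (lift P) (Mem.notMem_fn_pushes ha)
      exact ⟨es, rfl, hw, ⟨g'.symm.trans ((f.res Function.injective_id a).trans g)⟩⟩

/-- A process without past above `m` is congruent to a thread. -/
theorem Rep.exists_thread {R : RProc N} : ∀ {m : Mem N} {X : Marked N}, R.Rep m X → X.dom = ∅ →
    ∃ P, Cong R (thread m P) := by
  induction R with
  | thread m' P =>
    rintro m X ⟨es, rfl, hw, ⟨f⟩⟩ hX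
    obtain ⟨rfl, -⟩ := eq_nil_of_wrap_dom (f.dom_eq_empty hX)
    exact ⟨P, Cong.refl _⟩
  | par R S ihR ihS =>
    rintro m X ⟨es, Y, Z, hR, hS, hw, hm, hd, ⟨f⟩⟩ hX
    obtain ⟨rfl, h⟩ := eq_nil_of_wrap_dom (f.dom_eq_empty hX)
    obtain ⟨hY, hZ⟩ := dom_eq_empty_of_par hm h
    obtain ⟨P, hP⟩ := ihR hR hY
    obtain ⟨Q, hQ⟩ := ihS hS hZ
    exact ⟨.par P Q, (Cong.par hP hQ).trans (Cong.symm (Cong.distrib m P Q))⟩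
  | res R a ih =>
    rintro m X ⟨Y, hR, ha, hav, ⟨f⟩⟩ hX
    have h := f.dom_eq_empty hX
    obtain ⟨P, hP⟩ := ih hR (Set.eq_empty_of_forall_notMem fun e he =>
      (h ▸ (show (⟨e, hav e he⟩ : (Y.res a).S.E) ∈ (Y.res a).dom from he) :
        (⟨e, hav e he⟩ : (Y.res a).S.E) ∈ (∅ : Set (Y.res a).S.E)))
    exact ⟨.res P a, (Cong.res a hP).trans (Cong.symm (Cong.scope m P a ha))⟩

end RProc
-- Moves inside past prefixes, and moves of the prefix event
namespace Marked

variable {N : Type u}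

/-- A transition of `W` gives a transition of `W` with past events added. -/
theorem Iso.exists_of_can {es : List (ℕ × Vis N × CCS N)} {W X : Marked N}
    (f : Iso id (W.wrap es) X) {d : Dir} {e : W.S.E} {i : ℕ} (h : W.Can d e i)
    (hi : ∀ x ∈ es, i ≠ x.1) : ∃ e', X.S.lab e' = W.S.lab e ∧ X.Can d e' i ∧
      Nonempty (Iso id ((W.move d e i).wrap es) (X.move d e' i)) := by
  refine ⟨f.toEquiv (wrapOld es e), (f.lab_eq' _).trans (wrap_lab es e), f.can (wrap_can h hi), ?_⟩
  have g := f.move d (wrapOld es e) i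
  rw [wrap_move] at g
  exact ⟨g⟩

/-- Every transition of `W` with past events added comes from `W`, unless it undoes a past event. -/
theorem Iso.exists_of_can' {es : List (ℕ × Vis N × CCS N)} {W X : Marked N}
    (f : Iso id (W.wrap es) X) {d : Dir} {e : X.S.E} {i : ℕ} (h : X.Can d e i)
    (hd : d = .fwd ∨ W.dom.Nonempty) : ∃ e', X.S.lab e = W.S.lab e' ∧ W.Can d e' i ∧
      Nonempty (Iso id ((W.move d e' i).wrap es) (X.move d e i)) := by
  obtain ⟨e', he, h', -⟩ := exists_of_wrap_can (f.symm.can h) hd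
  have he' : e = f.toEquiv (wrapOld es e') := by
    rw [← he]; exact (f.toEquiv.apply_symm_apply e).symm
  subst he'
  refine ⟨e', (f.lab_eq' _).trans (wrap_lab es e'), h', ?_⟩
  have g := f.move d (wrapOld es e') i
  rw [wrap_move] at g
  exact ⟨g⟩

/-- The sum of a prefix with the empty structure. -/
def sumNil (o : Option ℕ) (l : Vis N) (X : Marked N) :
    Iso id (X.pre o l) ((X.pre o l).sum (lift .nil)) where
  toEquiv :=
    { toFun := Sum.inl
      invFun := Sum.elim id Empty.elim
      left_inv := fun _ => rfl
      right_inv := by rintro (e | e); exacts [rfl, e.elim] }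
  lab_eq _ := (Label.rename_id _).symm
  conf_iff y := by
    have hy : Sum.inr ⁻¹' y = (∅ : Set Empty) := Set.eq_empty_of_isEmpty (α := Empty) _
    refine ConfStruct.mem_coprod_C.trans ⟨?_, fun h => Or.inl ⟨h, hy⟩⟩
    rintro (⟨h, -⟩ | ⟨-, h⟩)
    · exact h
    · exact Or.inl h
  key_eq _ := rfl

/-- The first event of a prefix. -/
def preNew (o : Option ℕ) (l : Vis N) (X : Marked N) : (X.pre o l).S.E := (none : Option X.S.E)

theorem pre_upd (o o' : Option ℕ) (l : Vis N) (X : Marked N) :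
    (X.pre o l).upd (preNew o l X) o' = X.pre o' l := by
  refine congrArg (Marked.mk (X.pre o l).S) (funext ?_)
  rintro (_ | e)
  · exact upd_key_self (X.pre o l) _ _
  · exact upd_key_of_ne (X.pre o l) _ (Option.some_ne_none e)

theorem sum_upd_left {X Y : Marked N} (e : X.S.E) (o : Option ℕ) :
    (X.sum Y).upd (Sum.inl e) o = (X.upd e o).sum Y := by
  refine congrArg (Marked.mk (X.sum Y).S) (funext ?_)
  rintro (e' | e')
  · by_cases h : e' = e
    · subst h
      exact (upd_key_self (X.sum Y) _ _).trans (upd_key_self X _ _).symm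
    · exact (upd_key_of_ne (X.sum Y) _ (fun h' => h (Sum.inl.inj h'))).trans
        (upd_key_of_ne X _ h).symm
  · exact upd_key_of_ne (X.sum Y) _ (by rintro ⟨⟩)

/-- If performing `e` marks `X` as a valid structure, then `e` can be performed. -/
theorem can_fwd_of_iso {X Y : Marked N} {e : X.S.E} {i : ℕ} (hX : X.dom = ∅) (hY : Y.Valid)
    (f : Iso id Y (X.move .fwd e i)) : X.Can .fwd e i where
  key := by
    by_contra h
    exact Set.notMem_empty e (hX ▸ (show e ∈ X.dom from h))
  fresh e' h := absurd (mem_dom.2 ⟨i, h⟩) (hX ▸ Set.notMem_empty e')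
  mem := f.dom_mem_iff.2 hY.dom_mem

theorem past_lift_valid (i : ℕ) (l : Vis N) (Q P : CCS N) : ((lift P).past i l Q).Valid :=
  past_valid (lift_valid P) (by rw [lift_ran]; exact Set.notMem_empty _)

/-- The rule for λ.P records the residual 0, so the structure after the move is a sum with the empty
structure; `sumNil` removes that summand. -/
theorem iso_lift_pre_move (i : ℕ) (l : Vis N) (P : CCS N) :
    ∃ e : (lift (.pre l P)).S.E, (lift (.pre l P)).S.lab e = .vis l ∧
      (lift (.pre l P)).Can .fwd e i ∧
      Nonempty (Iso id ((lift P).past i l .nil) ((lift (.pre l P)).move .fwd e i)) := by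
  rw [lift_pre]
  have h : ((lift P).pre none l).move .fwd (preNew none l (lift P)) i =
    (lift P).pre (some i) l := pre_upd _ _ _ _
  have f : Iso id ((lift P).past i l .nil)
      (((lift P).pre none l).move .fwd (preNew none l (lift P)) i) := by
    rw [h]
    exact (sumNil _ _ _).symm
  refine ⟨preNew none l (lift P), rfl, can_fwd_of_iso ?_ (past_lift_valid i l .nil P) f, ⟨f⟩⟩
  rw [← lift_pre, lift_dom]

theorem lift_sum_move_left (i : ℕ) (l k : Vis N) (P Q : CCS N) :
    (lift (.sum l P k Q)).move .fwd (Sum.inl (none : Option P.enc.E)) i =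
      (lift P).past i l (.pre k Q) := by
  refine congrArg (Marked.mk (CCS.sum l P k Q).enc) (funext ?_)
  rintro ((_ | e) | e)
  · exact upd_key_self (lift (.sum l P k Q)) _ _
  · exact upd_key_of_ne (lift (.sum l P k Q)) _ (by rintro ⟨⟩)
  · exact upd_key_of_ne (lift (.sum l P k Q)) _ (by rintro ⟨⟩)

theorem lift_sum_move_right (i : ℕ) (l k : Vis N) (P Q : CCS N) :
    (lift (.sum l P k Q)).move .fwd (Sum.inr (none : Option Q.enc.E)) i =
      (lift (.pre l P)).sum ((lift Q).pre (some i) k) := by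
  refine congrArg (Marked.mk (CCS.sum l P k Q).enc) (funext ?_)
  rintro (e | (_ | e))
  · exact upd_key_of_ne (lift (.sum l P k Q)) _ (by rintro ⟨⟩)
  · exact upd_key_self (lift (.sum l P k Q)) _ _
  · exact upd_key_of_ne (lift (.sum l P k Q)) _ (by rintro ⟨⟩)

theorem can_lift_sum_left (i : ℕ) (l k : Vis N) (P Q : CCS N) :
    (lift (.sum l P k Q)).Can .fwd (Sum.inl (none : Option P.enc.E)) i :=
  can_fwd_of_iso (lift_dom _) (past_lift_valid i l (.pre k Q) P)
    (by rw [lift_sum_move_left]; exact Iso.refl _)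

theorem iso_move_pastNew_nil (i : ℕ) (l : Vis N) (P : CCS N) :
    Nonempty (Iso id (lift (.pre l P))
      (((lift P).past i l .nil).move .bwd (pastNew i l .nil (lift P)) i)) := by
  have h : ((lift P).past i l .nil).move .bwd (pastNew i l .nil (lift P)) i =
      ((lift P).pre none l).sum (lift .nil) := by
    refine (sum_upd_left _ _).trans ?_
    exact congrArg (sum · (lift .nil)) (pre_upd (some i) none l (lift P))
  rw [h, lift_pre]
  exact ⟨sumNil _ _ _⟩

theorem iso_move_pastNew_pre (i : ℕ) (l k : Vis N) (P Q : CCS N) :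
    Nonempty (Iso id (lift (.sum l P k Q))
      (((lift P).past i l (.pre k Q)).move .bwd (pastNew i l (.pre k Q) (lift P)) i)) := by
  have h : ((lift P).past i l (.pre k Q)).move .bwd (pastNew i l (.pre k Q) (lift P)) i =
      ((lift P).pre none l).sum (lift (.pre k Q)) := by
    refine (sum_upd_left _ _).trans ?_
    exact congrArg (sum · (lift (.pre k Q))) (pre_upd (some i) none l (lift P))
  rw [h, lift_sum, lift_pre]
  exact ⟨Iso.refl _⟩

/-- Here `P` has no past, so the prefix event is the last one performed and may be undone. -/
theorem can_pastNew {i : ℕ} {l : Vis N} {Q P P' : CCS N} (f : Iso id (lift P')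
    (((lift P).past i l Q).move .bwd (pastNew i l Q (lift P)) i)) :
    ((lift P).past i l Q).Can .bwd (pastNew i l Q (lift P)) i where
  key := rfl
  fresh _ h := (past_lift_valid i l Q P).inj _ _ _ h rfl
  mem := f.dom_mem_iff.2 (lift_valid P').dom_mem

end Marked

theorem Mem.isBase_fork {N : Type u} {m : Mem N} : m.fork.IsBase := trivial

/-! ### Transitions of a process are moves of its structure -/

namespace RProc

open Marked

variable {N : Type u}

/-- Either before or after the move `e` carries `i`, and in both situations the identifiers of the
structure are disjoint from those of `m`. -/
theorem Rep.notMem_ids {R R' : RProc N} {m : Mem N} {X : Marked N} {d : Dir} {e : X.S.E} {i : ℕ}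
    (h : R.Rep m X) (hc : X.Can d e i) (h' : R'.Rep m (X.move d e i)) : i ∉ m.ids := by
  cases d with
  | fwd => exact fun hi => Set.disjoint_left.1 h'.props.2.1 hi ⟨e, upd_key_self _ _ _⟩
  | bwd => exact fun hi => Set.disjoint_left.1 h.props.2.1 hi ⟨e, hc.key⟩

theorem rep_thread_of_iso {m : Mem N} {es} {i : ℕ} {l : Vis N} {P Q : CCS N} {X W : Marked N}
    (hi : i ∉ (m.pushes es).ids) (hw : (m.pushes es).WF)
    (hQ : Q = .nil ∨ ∃ k Q', Q = .pre k Q') (f : Iso id ((lift P).past i l Q) W)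
    (g : Iso id (W.wrap es) X) : (thread (.ev i l Q (m.pushes es)) P).Rep m X :=
  ⟨(i, l, Q) :: es, rfl, ⟨hi, hQ, hw⟩, ⟨(f.wrap es).trans g⟩⟩

/-- Every transition is given by a transition of the structure. -/
theorem Step.rep {d : Dir} {R R' : RProc N} {i : ℕ} {α : Label N} (h : Step d R i α R') :
    ∀ {m : Mem N} {X : Marked N}, m.IsBase → R.Rep m X →
      ∃ e, X.S.lab e = α ∧ X.Can d e i ∧ R'.Rep m (X.move d e i) := by
  induction h with
  | act_pre m' i l P hi =>
    rintro m X - ⟨es, rfl, hw, ⟨f⟩⟩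
    obtain ⟨e, hl, hc, ⟨g⟩⟩ := iso_lift_pre_move i l P
    obtain ⟨e', hl', hc', ⟨g'⟩⟩ := f.exists_of_can hc
      fun x hx h => hi (h ▸ Mem.mem_ids_pushes hx)
    exact ⟨e', hl'.trans hl, hc', rep_thread_of_iso hi hw (Or.inl rfl) g g'⟩
  | act_sum m' i l k P Q hi =>
    rintro m X - ⟨es, rfl, hw, ⟨f⟩⟩
    obtain ⟨e, hl, hc, ⟨g⟩⟩ := f.exists_of_can (can_lift_sum_left i l k P Q)
      fun x hx h => hi (h ▸ Mem.mem_ids_pushes hx)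
    rw [lift_sum_move_left] at g
    exact ⟨e, hl, hc, rep_thread_of_iso hi hw (Or.inr ⟨k, Q, rfl⟩) (Iso.refl _) g⟩
  | undo_pre m' i l P hi =>
    rintro m X hm ⟨es, h, hw, ⟨f⟩⟩
    -- With an empty list the event to be undone would belong to the common memory `m`, outside the
    -- structure. This is excluded because the top of `m` is not an event; the premises of the rules
    -- for compositions are used above a fork, which has this property.
    rcases es with _ | ⟨⟨j, l', Q'⟩, es⟩
    · subst h
      exact hm.elim
    · obtain ⟨rfl, rfl, rfl, rfl⟩ := Mem.ev.inj h
      obtain ⟨g⟩ := iso_move_pastNew_nil i l P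
      obtain ⟨e, hl, hc, ⟨g'⟩⟩ := Iso.exists_of_can (es := es) f (can_pastNew g)
        fun x hx h => hi (h ▸ Mem.mem_ids_pushes hx)
      exact ⟨e, hl, hc, es, rfl, hw.2.2, ⟨(g.wrap es).trans g'⟩⟩
  | undo_sum m' i l k P Q hi =>
    rintro m X hm ⟨es, h, hw, ⟨f⟩⟩
    rcases es with _ | ⟨⟨j, l', Q'⟩, es⟩
    · subst h
      exact hm.elim
    · obtain ⟨rfl, rfl, rfl, rfl⟩ := Mem.ev.inj h
      obtain ⟨g⟩ := iso_move_pastNew_pre i l k P Q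
      obtain ⟨e, hl, hc, ⟨g'⟩⟩ := Iso.exists_of_can (es := es) f (can_pastNew g)
        fun x hx h => hi (h ▸ Mem.mem_ids_pushes hx)
      exact ⟨e, hl, hc, es, rfl, hw.2.2, ⟨(g.wrap es).trans g'⟩⟩
  | syn d hR hS ihR ihS =>
    rintro m X - ⟨es, Y, Z, hY, hZ, hw, hm, hd, ⟨f⟩⟩
    obtain ⟨e₁, hl₁, hc₁, h₁⟩ := ihR Mem.isBase_fork hY
    obtain ⟨e₂, hl₂, hc₂, h₂⟩ := ihS Mem.isBase_fork hZ
    have hi := hY.notMem_ids hc₁ h₁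
    have hc := par_can_both hY.props.1 hZ.props.1 hm hd hl₁ hl₂ hc₁ hc₂
    obtain ⟨e, hl, hc', ⟨g⟩⟩ := f.exists_of_can hc fun x hx h => hi (h ▸ Mem.mem_ids_pushes hx)
    have hd' : ((Y.par Z).move _ _ _).dom ∈ ((Y.par Z).move _ _ _).S.C := hc.mem
    rw [parBoth_move hl₁ hl₂ hc₁.key hc₂.key hc₁.fresh hc₂.fresh] at g hd'
    -- The move of the composition is the composition of the moves, so the invariant is rebuilt from
    -- the two components with the same list `es`.
    exact ⟨e, hl.trans (lab_parBoth _ _ hl₁ hl₂), hc', es, _, _, h₁, h₂, hw,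
      hm.move_both hl₁ hl₂ hc₁.fresh hc₂.fresh, hd', ⟨g⟩⟩
  | par_left d S hR hi ih =>
    rintro m X - ⟨es, Y, Z, hY, hZ, hw, hm, hd, ⟨f⟩⟩
    obtain ⟨e₁, hl₁, hc₁, h₁⟩ := ih Mem.isBase_fork hY
    have hi' := hY.notMem_ids hc₁ h₁
    have hZi := fun h => hi (hZ.ran_subset h)
    have hc := par_can_left hY.props.1 hZ.props.1 hm hd hc₁ hZi
    obtain ⟨e, hl, hc', ⟨g⟩⟩ := f.exists_of_can hc fun x hx h => hi' (h ▸ Mem.mem_ids_pushes hx)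
    have hd' : ((Y.par Z).move _ _ _).dom ∈ ((Y.par Z).move _ _ _).S.C := hc.mem
    rw [parLeft_move hc₁.key hZi] at g hd'
    exact ⟨e, hl.trans hl₁, hc', es, _, _, h₁, hZ, hw, hm.move_left hZi, hd', ⟨g⟩⟩
  | par_right d R hS hi ih =>
    rintro m X - ⟨es, Y, Z, hY, hZ, hw, hm, hd, ⟨f⟩⟩
    obtain ⟨e₁, hl₁, hc₁, h₁⟩ := ih Mem.isBase_fork hZ
    have hi' := hZ.notMem_ids hc₁ h₁
    have hYi := fun h => hi (hY.ran_subset h)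
    have hc := par_can_right hY.props.1 hZ.props.1 hm hd hc₁ hYi
    obtain ⟨e, hl, hc', ⟨g⟩⟩ := f.exists_of_can hc fun x hx h => hi' (h ▸ Mem.mem_ids_pushes hx)
    have hd' : ((Y.par Z).move _ _ _).dom ∈ ((Y.par Z).move _ _ _).S.C := hc.mem
    rw [parRight_move hc₁.key hYi] at g hd'
    exact ⟨e, hl.trans hl₁, hc', es, _, _, hY, h₁, hw, hm.move_right hYi, hd', ⟨g⟩⟩
  | res d a hR ha ih =>
    rintro m X hm ⟨Y, hY, ham, hav, ⟨f⟩⟩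
    obtain ⟨e, hl, hc, h⟩ := ih hm hY
    rw [← hl] at ha
    have hc' : (Y.res a).Can d ⟨e, ha⟩ _ := (res_can_iff hav).2 hc
    have g := f.move d (⟨e, ha⟩ : (Y.res a).S.E) ‹ℕ›
    replace g := res_move (X := Y) d ⟨e, ha⟩ _ ▸ g
    exact ⟨f.toEquiv ⟨e, ha⟩, (f.lab_eq' ⟨e, ha⟩).trans hl, f.can hc', _, h, ham, hav.move d ha _, ⟨g⟩⟩
  | cong d h₁ _ h₂ ih =>
    intro m X hm hX
    obtain ⟨e, hl, hc, h⟩ := ih hm (h₁.rep_iff.1 hX)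
    exact ⟨e, hl, hc, h₂.rep_iff.1 h⟩

end RProc
-- Moves of the structure are transitions of the process
namespace CCS

variable {N : Type u}

/-- The number of constructors of a process. -/
def size : CCS N → ℕ
  | nil => 1
  | pre _ P => size P + 1
  | par P Q => size P + size Q + 1
  | sum _ P _ Q => size P + size Q + 1
  | res P _ => size P + 1

theorem size_rename (s : N → N) (P : CCS N) : (P.rename s).size = P.size := by
  induction P <;> simp_all [rename, size]

theorem finite_fn (P : CCS N) : P.fn.Finite := by
  induction P with
  | nil => exact Set.finite_empty
  | pre l P ih => exact (Set.finite_singleton _).union ih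
  | par P Q ihP ihQ => exact ihP.union ihQ
  | sum l P k Q ihP ihQ =>
    exact ((Set.finite_singleton _).union ihP).union ((Set.finite_singleton _).union ihQ)
  | res P a ih => exact ih.subset Set.sdiff_subset

end CCS

theorem Mem.finite_fn {N : Type u} (m : Mem N) : m.fn.Finite := by
  induction m with
  | empty => exact Set.finite_empty
  | fork m ih => exact ih
  | ev i l Q m ih => exact ((Set.finite_singleton _).union Q.finite_fn).union ih

theorem Mem.finite_ids {N : Type u} (m : Mem N) : m.ids.Finite := by
  induction m with
  | empty => exact Set.finite_empty
  | fork m ih => exact ih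
  | ev i l Q m ih => exact (Set.finite_singleton _).union ih

namespace Marked

variable {N : Type u}

/-- A prefix event is below every other event, so it is the only one that can occur alone. -/
theorem eq_preNew_of_mem {l : Vis N} {P : CCS N} {x : Set (Option P.enc.E)} {e : Option P.enc.E}
    (h : x ∈ (ConfStruct.pre (Label.vis l) P.enc).C) (hx : x = {e}) : e = none := by
  rcases ConfStruct.mem_pre_C.1 h with h | ⟨h, -⟩
  · exact absurd (hx.symm.trans h) (Set.singleton_ne_empty e)
  · rw [hx] at h
    exact h.symm

theorem dom_move_lift {P : CCS N} {e : P.enc.E} {i : ℕ} :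
    ((lift P).move .fwd e i).dom = {e} := by
  refine (dom_upd_some _ _ _).trans ((congrArg (insert e) (lift_dom P)).trans ?_)
  exact insert_empty_eq (β := Set P.enc.E) e

/-- The only initial transition of a prefix. -/
theorem iso_of_lift_pre_can {i : ℕ} {l : Vis N} {P : CCS N} {e : (lift (.pre l P)).S.E}
    (h : (lift (.pre l P)).Can .fwd e i) : (lift (.pre l P)).S.lab e = .vis l ∧
      Nonempty (Iso id ((lift P).past i l .nil) ((lift (.pre l P)).move .fwd e i)) := by
  have he : e = (none : Option P.enc.E) := eq_preNew_of_mem h.mem dom_move_lift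
  obtain ⟨e', hl, hc, hf⟩ := iso_lift_pre_move i l P
  have he' : e' = (none : Option P.enc.E) := eq_preNew_of_mem hc.mem dom_move_lift
  obtain rfl : e = e' := he.trans he'.symm
  exact ⟨hl, hf⟩

theorem iso_of_lift_sum_can {i : ℕ} {l k : Vis N} {P Q : CCS N} {e : (lift (.sum l P k Q)).S.E}
    (h : (lift (.sum l P k Q)).Can .fwd e i) :
    ((lift (.sum l P k Q)).S.lab e = .vis l ∧ Nonempty (Iso id ((lift P).past i l (.pre k Q))
      ((lift (.sum l P k Q)).move .fwd e i))) ∨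
    ((lift (.sum l P k Q)).S.lab e = .vis k ∧ Nonempty (Iso id ((lift Q).past i k (.pre l P))
      ((lift (.sum l P k Q)).move .fwd e i))) := by
  have hm : ({e} : Set (CCS.sum l P k Q).enc.E) ∈ (CCS.sum l P k Q).enc.C :=
    dom_move_lift (P := .sum l P k Q) ▸ h.mem
  have hm := ConfStruct.mem_coprod_C.1 hm
  rcases e with e | e
  · have he : e = (none : Option P.enc.E) := by
      refine eq_preNew_of_mem (l := l) (x := {e}) ?_ rfl
      rcases hm with ⟨h, -⟩ | ⟨-, h⟩
      · have he : Sum.inl (β := Option Q.enc.E) ⁻¹' {Sum.inl e} = {e} :=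
          Set.ext fun e' => Sum.inl_injective.eq_iff
        exact he ▸ h
      · exact ((Set.ext_iff.1 h e).1 rfl).elim
    subst he
    refine Or.inl ⟨rfl, ?_⟩
    rw [lift_sum_move_left]
    exact ⟨Iso.refl _⟩
  · have he : e = (none : Option Q.enc.E) := by
      refine eq_preNew_of_mem (l := k) (x := {e}) ?_ rfl
      rcases hm with ⟨-, h⟩ | ⟨h, -⟩
      · exact ((Set.ext_iff.1 h e).1 rfl).elim
      · have he : Sum.inr (α := Option P.enc.E) ⁻¹' {Sum.inr e} = {e} :=
          Set.ext fun e' => Sum.inr_injective.eq_iff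
        exact he ▸ h
    subst he
    refine Or.inr ⟨rfl, ?_⟩
    rw [lift_sum_move_right]
    exact ⟨Iso.sumComm _ _⟩

end Marked

namespace RProc

open Marked

variable {N : Type u}

/-- Threads count double so that the weight drops when a composition or a restriction is pulled out
of a thread: each pull trades a weight of two for a weight of one. -/
def weight : RProc N → ℕ
  | thread _ P => 2 * P.size
  | par R S => weight R + weight S + 1
  | res R _ => weight R + 1

theorem finite_ids (R : RProc N) : R.ids.Finite := by
  induction R with
  | thread m P => exact m.finite_ids
  | par R S ihR ihS => exact ihR.union ihS
  | res R a ih => exact ih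

/-- In a thread only the top event of the memory can be undone: the present process `P` is unmarked,
and every older event has a marked successor. -/
theorem Rep.exists_step_thread_bwd {m m' : Mem N} {P : CCS N} {X : Marked N} {e : X.S.E} {i : ℕ}
    (hX : (thread m' P).Rep m X) (h : X.Can .bwd e i) :
    ∃ R', Step .bwd (thread m' P) i (X.S.lab e) R' ∧ R'.Rep m (X.move .bwd e i) := by
  obtain ⟨es, rfl, hw, ⟨f⟩⟩ := hX
  rcases es with _ | ⟨⟨j, l, Q⟩, es⟩
  · exact absurd (f.symm.can h).key.symm (Option.some_ne_none i)
  · have hne : ((lift P).past j l Q).dom.Nonempty :=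
      ⟨pastNew j l Q (lift P), by rw [past_dom]; exact Or.inl rfl⟩
    obtain ⟨e', hl, hc, ⟨g⟩⟩ := Iso.exists_of_can' (es := es) f h (Or.inr hne)
    rcases past_key_eq_some.1 hc.key with ⟨rfl, rfl⟩ | ⟨e', -, h'⟩
    · rw [hl]
      obtain ⟨hj, hQ, hw⟩ := hw
      rcases hQ with rfl | ⟨k, Q, rfl⟩
      · obtain ⟨g'⟩ := iso_move_pastNew_nil j l P
        exact ⟨_, Step.undo_pre _ j l P hj, es, rfl, hw, ⟨(g'.wrap es).trans g⟩⟩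
      · obtain ⟨g'⟩ := iso_move_pastNew_pre j l k P Q
        exact ⟨_, Step.undo_sum _ j l k P Q hj, es, rfl, hw, ⟨(g'.wrap es).trans g⟩⟩
    · exact absurd h'.symm (Option.some_ne_none i)

/-- Every transition of the structure is given by a transition of the process. -/
theorem Rep.exists_step [Infinite N] (n : ℕ) : ∀ {R : RProc N}, R.weight ≤ n →
    ∀ {m : Mem N} {X : Marked N} {d : Dir} {e : X.S.E} {i : ℕ}, R.Rep m X → X.Can d e i →
    (d = .fwd → i ∉ R.ids) → ∃ R', Step d R i (X.S.lab e) R' ∧ R'.Rep m (X.move d e i) := by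
  induction n with
  | zero =>
    intro R hR
    rcases R with ⟨m, P⟩ | ⟨R, S⟩ | ⟨R, a⟩
    · cases P <;> simp [weight, CCS.size] at hR
    · simp [weight] at hR
    · simp [weight] at hR
  | succ n ih =>
    -- The induction hypothesis is applied to a congruent process of smaller weight; `Cong.rep_iff`
    -- keeps the same structure and `Step.cong` brings the transition back.
    have hcong : ∀ {R S : RProc N}, Cong R S → S.weight ≤ n →
        ∀ {m : Mem N} {X : Marked N} {d : Dir} {e : X.S.E} {i : ℕ}, R.Rep m X → X.Can d e i →
        (d = .fwd → i ∉ S.ids) → ∃ R', Step d R i (X.S.lab e) R' ∧ R'.Rep m (X.move d e i) := by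
      intro R S hRS hS m X d e i hX h hi
      obtain ⟨R', h₁, h₂⟩ := ih hS (hRS.rep_iff.1 hX) h hi
      exact ⟨R', Step.cong d hRS h₁ (Cong.refl _), h₂⟩
    intro R hR m X d e i hX h hi
    rcases R with ⟨m', P⟩ | ⟨R, S⟩ | ⟨R, a⟩
    · cases d with
      | bwd => exact hX.exists_step_thread_bwd h
      | fwd =>
        have hi' : i ∉ m'.ids := hi rfl
        cases P with
        | nil =>
          obtain ⟨es, rfl, hw, ⟨f⟩⟩ := hX
          obtain ⟨e', -⟩ := f.exists_of_can' h (Or.inl rfl)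
          exact e'.elim
        | pre l P =>
          obtain ⟨es, rfl, hw, ⟨f⟩⟩ := hX
          obtain ⟨e', hl, hc, ⟨g⟩⟩ := f.exists_of_can' h (Or.inl rfl)
          obtain ⟨hl', ⟨g'⟩⟩ := iso_of_lift_pre_can hc
          rw [hl, hl']
          exact ⟨_, Step.act_pre _ i l P hi', rep_thread_of_iso hi' hw (Or.inl rfl) g' g⟩
        | sum l P k Q =>
          obtain ⟨es, rfl, hw, ⟨f⟩⟩ := hX
          obtain ⟨e', hl, hc, ⟨g⟩⟩ := f.exists_of_can' h (Or.inl rfl)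
          rw [hl]
          rcases iso_of_lift_sum_can hc with ⟨hl', ⟨g'⟩⟩ | ⟨hl', ⟨g'⟩⟩
          · rw [hl']
            exact ⟨_, Step.act_sum _ i l k P Q hi',
              rep_thread_of_iso hi' hw (Or.inr ⟨k, Q, rfl⟩) g' g⟩
          · rw [hl']
            exact ⟨_, Step.cong _ (Cong.thread _ (CCS.Cong.sum_comm l k P Q))
              (Step.act_sum _ i k l Q P hi') (Cong.refl _),
              rep_thread_of_iso hi' hw (Or.inr ⟨l, P, rfl⟩) g' g⟩
        | par P Q =>
          refine hcong (Cong.distrib m' P Q) ?_ hX h ?_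
          · simp only [weight, CCS.size] at hR ⊢
            omega
          · rintro -
            exact fun h => hi' (h.elim id id)
        | res P a =>
          -- The restricted name may occur in the memory. It is replaced by one that is free neither
          -- in `P` nor in the memory, which exists because there are infinitely many names; then
          -- scope extrusion applies.
          obtain ⟨b, hb⟩ := (P.finite_fn.union m'.finite_fn).exists_notMem
          rw [Set.mem_union, not_or] at hb
          have hc : Cong (thread m' (.res P a)) (res (thread m' _) b) :=
            (Cong.thread m' (CCS.Cong.alpha P a b hb.1)).trans (Cong.scope m' _ b hb.2)
          refine hcong hc ?_ hX h fun _ => hi'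
          simp only [weight, CCS.size, CCS.size_rename] at hR ⊢
          omega
    · obtain ⟨es, Y, Z, hY, hZ, hw, hm, hd, ⟨f⟩⟩ := hX
      by_cases hne : d = .fwd ∨ (Y.par Z).dom.Nonempty
      · obtain ⟨p, hl, hc, ⟨g⟩⟩ := f.exists_of_can' h hne
        rw [hl]
        have hRS : R.weight ≤ n ∧ S.weight ≤ n := by
          simp only [weight] at hR
          omega
        -- Freshness of a new identifier is assumed; the identifier of an undone event belongs to
        -- one of the components, and these avoid the shared memory.
        have hi' : i ∉ (m.pushes es).ids := by
          cases d with
          | fwd => exact fun h => hi rfl (Or.inl (hY.ids_subset h))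
          | bwd =>
            intro h
            have : i ∈ (Y.par Z).ran := ⟨p, hc.key⟩
            rw [par_ran hm] at this
            rcases this with h' | h'
            · exact Set.disjoint_left.1 hY.props.2.1 h h'
            · exact Set.disjoint_left.1 hZ.props.2.1 h h'
        have hd' : ((Y.par Z).move d p i).dom ∈ ((Y.par Z).move d p i).S.C := hc.mem
        rcases par_can_cases hY.props.1 hZ.props.1 hm hc with ⟨e₁, rfl, hc₁, hZi⟩ |
          ⟨e₂, rfl, hc₂, hYi⟩ | ⟨e₁, e₂, l, hl₁, hl₂, rfl, hc₁, hc₂⟩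
        · obtain ⟨R', h₁, h₂⟩ := ih hRS.1 hY hc₁ fun hd h => hi hd (Or.inl h)
          rw [parLeft_move hc₁.key hZi] at g hd'
          refine ⟨par R' S, Step.par_left d S h₁ ?_, es, _, _, h₂, hZ, hw, hm.move_left hZi, hd',
            ⟨g⟩⟩
          rw [hZ.props.2.2]
          exact fun h => h.elim hi' hZi
        · obtain ⟨S', h₁, h₂⟩ := ih hRS.2 hZ hc₂ fun hd h => hi hd (Or.inr h)
          rw [parRight_move hc₂.key hYi] at g hd'
          refine ⟨par R S', Step.par_right d R h₁ ?_, es, _, _, hY, h₂, hw, hm.move_right hYi, hd',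
            ⟨g⟩⟩
          rw [hY.props.2.2]
          exact fun h => h.elim hi' hYi
        · obtain ⟨R', h₁, h₂⟩ := ih hRS.1 hY hc₁ fun hd h => hi hd (Or.inl h)
          obtain ⟨S', h₃, h₄⟩ := ih hRS.2 hZ hc₂ fun hd h => hi hd (Or.inr h)
          rw [parBoth_move hl₁ hl₂ hc₁.key hc₂.key hc₁.fresh hc₂.fresh] at g hd'
          rw [lab_parBoth]
          rw [hl₁] at h₁
          rw [hl₂] at h₃
          exact ⟨par R' S', Step.syn d h₁ h₃, es, _, _, h₂, h₄, hw,
            hm.move_both hl₁ hl₂ hc₁.fresh hc₂.fresh, hd', ⟨g⟩⟩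
      -- A backward move when neither component has a past of its own: what is undone is the last
      -- event before the split. The composition is first merged into a single thread.
      · rw [not_or, Set.not_nonempty_iff_eq_empty] at hne
        obtain ⟨hd₁, hd₂⟩ := dom_eq_empty_of_par hm hne.2
        obtain ⟨P, hP⟩ := hY.exists_thread hd₁
        obtain ⟨Q, hQ⟩ := hZ.exists_thread hd₂
        have hc : Cong (par R S) (thread (m.pushes es) (.par P Q)) :=
          (Cong.par hP hQ).trans (Cong.symm (Cong.distrib _ P Q))
        cases d with
        | fwd => exact absurd rfl hne.1
        | bwd =>
          have hX : (par R S).Rep m X := ⟨es, Y, Z, hY, hZ, hw, hm, hd, ⟨f⟩⟩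
          obtain ⟨R', h₁, h₂⟩ := (hc.rep_iff.1 hX).exists_step_thread_bwd h
          exact ⟨R', Step.cong _ hc h₁ (Cong.refl _), h₂⟩
    · obtain ⟨Y, hY, ham, hav, ⟨f⟩⟩ := hX
      have hc := f.symm.can h
      obtain ⟨e', he'⟩ : ∃ e', e = f.toEquiv e' := ⟨_, (f.toEquiv.apply_symm_apply e).symm⟩
      subst he'
      have hc : (Y.res a).Can d e' i := by
        have := f.symm.can h
        rwa [show f.symm.toEquiv (f.toEquiv e') = e' from f.toEquiv.symm_apply_apply e'] at this
      obtain ⟨R', h₁, h₂⟩ := ih (by simpa [weight] using hR) hY ((res_can_iff hav).1 hc) hi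
      have g := f.move d e' i
      rw [res_move] at g
      refine ⟨res R' a, Step.res d a ?_ ?_, _, h₂, ham, hav.move d e'.2 i, ⟨g⟩⟩
      · rw [f.lab_eq']
        exact h₁
      · rw [f.lab_eq']
        exact e'.2

end RProc
/-! ## The encoding of memories -/

namespace Mem

variable {N : Type u}

/-- The identifiers of the lower segments of a memory. -/
def segs : Mem N → Set (Set ℕ)
  | empty => {∅}
  | fork m => segs m
  | ev i l Q m => insert (ids (ev i l Q m)) (segs m)

/-- The event identified by `i` has the label `α`. -/
def HasLab : Mem N → ℕ → Label N → Prop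
  | empty, _, _ => False
  | fork m, i, α => HasLab m i α
  | ev j l _ m, i, α => (i = j ∧ α = .vis l) ∨ HasLab m i α

theorem ids_mem_segs (m : Mem N) : m.ids ∈ m.segs := by
  induction m with
  | empty => exact rfl
  | fork m ih => exact ih
  | ev i l Q m ih => exact Or.inl rfl

theorem subset_ids_of_mem_segs {m : Mem N} {s : Set ℕ} (h : s ∈ m.segs) : s ⊆ m.ids := by
  induction m with
  | empty => exact subset_of_eq h
  | fork m ih => exact ih h
  | ev i l Q m ih =>
    rcases h with rfl | h
    · exact subset_rfl
    · exact (ih h).trans Set.subset_union_right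

theorem segs_chain {m : Mem N} {s t : Set ℕ} (hs : s ∈ m.segs) (ht : t ∈ m.segs) :
    s ⊆ t ∨ t ⊆ s := by
  induction m with
  | empty => exact Or.inl (subset_of_eq (hs.trans ht.symm))
  | fork m ih => exact ih hs ht
  | ev i l Q m ih =>
    rcases hs with rfl | hs
    · exact Or.inr (subset_ids_of_mem_segs ht)
    · rcases ht with rfl | ht
      · exact Or.inl ((subset_ids_of_mem_segs hs).trans Set.subset_union_right)
      · exact ih hs ht

/-- Identifiers on a stack are distinct, so the segment that ends just below the later of the two
events contains only the other one. -/
theorem exists_segs_separating {m : Mem N} (hm : m.WF) {i j : ℕ} (hi : i ∈ m.ids) (hj : j ∈ m.ids)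
    (hij : i ≠ j) : ∃ s ∈ m.segs, i ∈ s ↔ j ∉ s := by
  induction m with
  | empty => exact hi.elim
  | fork m ih => exact ih hm hi hj
  | ev k l Q m ih =>
    rcases hi with rfl | hi <;> rcases hj with rfl | hj
    · exact absurd rfl hij
    · exact ⟨m.ids, Or.inr m.ids_mem_segs, iff_of_false hm.1 (not_not_intro hj)⟩
    · exact ⟨m.ids, Or.inr m.ids_mem_segs, iff_of_true hi hm.1⟩
    · obtain ⟨s, hs, h⟩ := ih hm.2.2 hi hj
      exact ⟨s, Or.inr hs, h⟩

theorem HasLab.mem_ids {m : Mem N} {i : ℕ} {α : Label N} (h : m.HasLab i α) : i ∈ m.ids := by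
  induction m with
  | empty => exact h.elim
  | fork m ih => exact ih h
  | ev k l Q m ih => exact h.imp And.left ih

/-- Memories record the visible half of a synchronisation. Two copies of a shared event thus carry
the same visible label, which the pairing of labels distinguishes from a complementary one. -/
theorem HasLab.exists_vis {m : Mem N} {i : ℕ} {α : Label N} (h : m.HasLab i α) :
    ∃ l : Vis N, α = .vis l := by
  induction m with
  | empty => exact h.elim
  | fork m ih => exact ih h
  | ev k l Q m ih => exact h.elim (fun h => ⟨l, h.2⟩) ih

theorem HasLab.unique {m : Mem N} (hm : m.WF) {i : ℕ} {α β : Label N} (h : m.HasLab i α)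
    (h' : m.HasLab i β) : α = β := by
  induction m with
  | empty => exact h.elim
  | fork m ih => exact ih hm h h'
  | ev k l Q m ih =>
    rcases h with ⟨rfl, rfl⟩ | h <;> rcases h' with ⟨h₁, rfl⟩ | h'
    · rfl
    · exact absurd h'.mem_ids hm.1
    · exact absurd h.mem_ids (h₁ ▸ hm.1)
    · exact ih hm.2.2 h h'

end Mem

/-! ### Memory encodings as a stack followed by a marked structure -/

namespace Marked

variable {N : Type u}

/-- The events with an identifier in `s`. -/
def evs (X : Marked N) (s : Set ℕ) : Set X.S.E := {e | ∃ i ∈ s, X.key e = some i}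

/-- The identifiers of `s` form a lower segment of `m`, or `m` and a configuration of `X`. -/
def Good (m : Mem N) (X : Marked N) (s : Set ℕ) : Prop :=
  s ∈ m.segs ∨ (m.ids ⊆ s ∧ X.evs s ∈ X.S.C)

/-- The events of `D` are those of the memory `m` followed by the identified events of `X`. -/
structure Below (m : Mem N) (X : Marked N) (D : IdConfStruct (Label N) ℕ) : Prop where
  inj : Function.Injective D.ident
  range : Set.range D.ident = m.ids ∪ X.ran
  lab : ∀ e d, X.key e = some (D.ident d) → X.S.lab e = D.lab d
  hasLab : ∀ d, D.ident d ∈ m.ids → m.HasLab (D.ident d) (D.lab d)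
  conf : ∀ x, x ∈ D.C ↔ Good m X (D.ident '' x)

theorem Valid.empty_mem {X : Marked N} (h : X.Valid) : ∅ ∈ X.S.C := by
  have := h.finite
  exact h.conf.empty_mem h.dom_mem

theorem evs_eq_empty {X : Marked N} {s : Set ℕ} (h : Disjoint s X.ran) : X.evs s = ∅ :=
  Set.eq_empty_of_forall_notMem fun e ⟨_, hi, he⟩ => Set.disjoint_left.1 h hi ⟨e, he⟩

theorem Good.evs_mem {m : Mem N} {X : Marked N} {s : Set ℕ} (h : Good m X s) (hX : X.Valid)
    (hd : Disjoint m.ids X.ran) : X.evs s ∈ X.S.C := by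
  rcases h with h | h
  · rw [evs_eq_empty (hd.mono_left (Mem.subset_ids_of_mem_segs h))]
    exact hX.empty_mem
  · exact h.2

theorem evs_inter {X : Marked N} {s t : Set ℕ} (h : X.ran ⊆ t) : X.evs (s ∩ t) = X.evs s :=
  Set.ext fun e => ⟨fun ⟨i, hi, he⟩ => ⟨i, hi.1, he⟩, fun ⟨i, hi, he⟩ => ⟨i, ⟨hi, h ⟨e, he⟩⟩, he⟩⟩

/-- The configurations of a memory form a chain, one for each lower segment of the stack;
distinctness of identifiers makes events and identifiers interchangeable. -/
theorem enc_props {m : Mem N} (hm : m.WF) : Function.Injective m.enc.ident ∧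
    Set.range m.enc.ident = m.ids ∧ (∀ d, m.HasLab (m.enc.ident d) (m.enc.lab d)) ∧
    ∀ x, x ∈ m.enc.C ↔ m.enc.ident '' x ∈ m.segs := by
  induction m with
  | empty =>
    refine ⟨fun e => e.elim, Set.eq_empty_of_forall_notMem (fun _ ⟨e, _⟩ => Empty.elim e), fun e => e.elim, fun x => ?_⟩
    have hx : x = ∅ := Set.eq_empty_of_isEmpty (α := Empty) x
    subst hx
    exact iff_of_true rfl (Set.image_empty _)
  | fork m ih => exact ih hm
  | ev i l Q m ih =>
    obtain ⟨h1, h2, h3, h4⟩ := ih hm.2.2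
    have hi : ∀ e, m.enc.ident e ≠ i := fun e he => hm.1 (h2 ▸ ⟨e, he⟩)
    have hinj : Function.Injective (Mem.ev i l Q m).enc.ident := by
      rintro (_ | e) (_ | e') h
      · rfl
      · exact absurd h.symm (hi e')
      · exact absurd h (hi e)
      · exact congrArg some (h1 h)
    have hrange : Set.range (Mem.ev i l Q m).enc.ident = (Mem.ev i l Q m).ids := by
      ext j
      constructor
      · rintro ⟨_ | e, rfl⟩
        · exact Or.inl rfl
        · exact Or.inr (h2 ▸ ⟨e, rfl⟩)
      · rintro (rfl | h)
        · exact ⟨(none : Option m.enc.E), rfl⟩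
        · rw [← h2] at h
          obtain ⟨e, rfl⟩ := h
          exact ⟨(some e : Option m.enc.E), rfl⟩
    -- The whole event set is a configuration, hence the only maximal one, and the new event is
    -- placed on top of everything.
    have hmax : ∀ y, m.enc.toConfStruct.IsMaximal y ↔ y = Set.univ := by
      have huniv : Set.univ ∈ m.enc.C := by
        rw [h4, Set.image_univ, h2]
        exact m.ids_mem_segs
      intro y
      constructor
      · exact fun h => (h.2 _ huniv).resolve_right (not_not_intro (Set.subset_univ y))
      · rintro rfl
        exact ⟨huniv, fun y _ => or_not_of_imp fun h => (Set.univ_subset_iff.1 h).symm⟩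
    have himage : ∀ y : Set m.enc.E,
        (Mem.ev i l Q m).enc.ident '' (some '' y : Set (Option m.enc.E)) = m.enc.ident '' y :=
      fun y => Set.image_image _ _ _
    have htop : (insert none (some '' Set.univ) : Set (Option m.enc.E)) = Set.univ := by
      ext (_ | e) <;> simp
    refine ⟨hinj, hrange, ?_, fun x => ⟨?_, ?_⟩⟩
    · rintro (_ | e)
      · exact Or.inl ⟨rfl, rfl⟩
      · exact Or.inr (h3 e)
    · rintro (⟨y, hy, rfl⟩ | ⟨y, hy, rfl⟩)
      · exact Or.inr ((himage y).symm ▸ (h4 y).1 hy)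
      · rw [(hmax y).1 hy]
        refine Or.inl ?_
        exact (congrArg _ htop).trans (Set.image_univ.trans hrange)
    · rintro (h | h)
      · refine Or.inr ⟨Set.univ, (hmax _).2 rfl, ?_⟩
        rw [htop]
        refine hinj.image_injective (h.trans ?_)
        exact (Set.image_univ.trans hrange).symm
      · have hx : x = some '' (some ⁻¹' x : Set m.enc.E) := by
          refine Set.Subset.antisymm ?_ (Set.image_preimage_subset some x)
          rintro (_ | e) he
          · exact absurd (Mem.subset_ids_of_mem_segs h ⟨_, he, rfl⟩) hm.1
          · exact ⟨e, he, rfl⟩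
        refine Or.inl ⟨_, (h4 _).2 ?_, hx⟩
        rw [hx] at h
        exact himage _ ▸ h

theorem below_lift {m : Mem N} (hm : m.WF) (P : CCS N) : Below m (lift P) m.enc := by
  obtain ⟨h1, h2, h3, h4⟩ := enc_props hm
  refine ⟨h1, by rw [lift_ran, Set.union_empty, h2],
    fun _ _ h => absurd h.symm (Option.some_ne_none _), fun d _ => h3 d, fun x => ?_⟩
  rw [h4]
  refine ⟨Or.inl, fun h => h.elim id fun h => ?_⟩
  rw [Set.Subset.antisymm ((Set.image_subset_range _ _).trans h2.subset) h.1]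
  exact m.ids_mem_segs

theorem Below.iso {m : Mem N} {X Y : Marked N} {D : IdConfStruct (Label N) ℕ} (h : Below m X D)
    (f : Iso id X Y) : Below m Y D where
  inj := h.inj
  range := f.ran_eq ▸ h.range
  lab e d he := by
    obtain ⟨e, rfl⟩ := f.toEquiv.surjective e
    rw [f.key_eq] at he
    rw [f.lab_eq', h.lab e d he]
  hasLab := h.hasLab
  conf x := by
    rw [h.conf]
    refine or_congr Iff.rfl (and_congr Iff.rfl ?_)
    rw [f.conf_iff]
    have : f.toEquiv ⁻¹' (Y.evs (D.ident '' x)) = X.evs (D.ident '' x) := by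
      ext e
      simp [evs, f.key_eq]
    rw [this]

/-- Restriction leaves the memory encoding unchanged; on the structure side it removes no marked
event, so both agree. -/
theorem Below.res {m : Mem N} {X : Marked N} {D : IdConfStruct (Label N) ℕ} (h : Below m X D)
    {a : N} (ha : X.Avoids a) : Below m (X.res a) D where
  inj := h.inj
  range := (res_ran ha).symm ▸ h.range
  lab e d he := h.lab e.1 d he
  hasLab := h.hasLab
  conf x := by
    rw [h.conf]
    refine or_congr Iff.rfl (and_congr Iff.rfl ?_)
    have : Subtype.val '' ((X.res a).evs (D.ident '' x)) = X.evs (D.ident '' x) := by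
      ext e
      constructor
      · rintro ⟨e, he, rfl⟩
        exact he
      · rintro ⟨i, hi, he⟩
        exact ⟨⟨e, ha e (mem_dom.2 ⟨i, he⟩)⟩, ⟨i, hi, he⟩, rfl⟩
    exact iff_of_eq (congrArg (· ∈ X.S.C) this.symm)

theorem past_evs_of_mem {i : ℕ} {l : Vis N} {Q : CCS N} {X : Marked N} {s : Set ℕ} (hi : i ∈ s) :
    (X.past i l Q).evs s ∈ (X.past i l Q).S.C ↔ X.evs s ∈ X.S.C := by
  rw [past_mem_iff (x := (X.past i l Q).evs s)
    (show pastNew i l Q X ∈ (X.past i l Q).evs s from ⟨i, hi, rfl⟩)]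
  refine and_iff_right ?_
  exact Set.eq_empty_of_forall_notMem fun e ⟨_, _, h⟩ => Option.some_ne_none _ h.symm

/-- Without the prefix event no event behind it can occur in a configuration. -/
theorem past_evs_of_notMem {i : ℕ} {l : Vis N} {Q : CCS N} {X : Marked N} {s : Set ℕ} (hi : i ∉ s)
    (h : (X.past i l Q).evs s ∈ (X.past i l Q).S.C) : X.evs s = ∅ := by
  have hn : pastNew i l Q X ∉ (X.past i l Q).evs s := by
    rintro ⟨j, hj, h⟩
    rw [← Option.some.inj h] at hj
    exact hi hj
  have : Sum.inl ⁻¹' (X.past i l Q).evs s = (∅ : Set (Option X.S.E)) := by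
    rcases ConfStruct.mem_coprod_C.1 h with ⟨h, -⟩ | ⟨-, h⟩
    · rcases ConfStruct.mem_pre_C.1 h with h | ⟨h, -⟩
      · exact h
      · exact absurd h hn
    · exact h
  exact Set.eq_empty_of_forall_notMem fun e he =>
    ((Set.ext_iff.1 this (some e : Option X.S.E)).1 he).elim

/-- The top event of the stack becomes the prefix event of the structure. The only new point is the
boundary between the two descriptions in `Good`: the full stack with `i` is the segment on one side
and the prefix event alone on the other. -/
theorem Below.past {m : Mem N} {X : Marked N} {D : IdConfStruct (Label N) ℕ} {i : ℕ} {l : Vis N}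
    {Q : CCS N} (h : Below (.ev i l Q m) X D) (hX : X.Valid) (hm : (Mem.ev i l Q m).WF)
    (hd : Disjoint (Mem.ev i l Q m).ids X.ran) : Below m (X.past i l Q) D where
  inj := h.inj
  range := by
    rw [h.range, past_ran, Mem.ids, ← Set.singleton_union, ← Set.union_assoc]
    congr 1
    exact Set.union_comm _ _
  lab e d he := by
    rcases past_key_eq_some.1 he with ⟨rfl, hi⟩ | ⟨e, rfl, he⟩
    · have := h.hasLab d (hi ▸ Or.inl rfl)
      rcases this with ⟨-, h⟩ | h
      · exact h.symm
      · exact absurd h.mem_ids (hi ▸ hm.1)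
    · exact h.lab e d he
  hasLab d hd := (h.hasLab d (Or.inr hd)).resolve_left fun h' => hm.1 (h'.1 ▸ hd)
  conf x := by
    rw [h.conf]
    have hs : D.ident '' x ⊆ (Mem.ev i l Q m).ids ∪ X.ran :=
      (Set.image_subset_range _ _).trans h.range.subset
    generalize D.ident '' x = s at hs
    by_cases hi : i ∈ s
    · constructor
      · rintro ((h | h) | ⟨h, h'⟩)
        · refine Or.inr ⟨h ▸ Set.subset_union_right, (past_evs_of_mem hi).2 ?_⟩
          rw [h, evs_eq_empty hd]
          exact hX.empty_mem
        · exact Or.inl h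
        · exact Or.inr ⟨Set.subset_union_right.trans h, (past_evs_of_mem hi).2 h'⟩
      · rintro (h | ⟨h, h'⟩)
        · exact Or.inl (Or.inr h)
        · exact Or.inr ⟨Set.union_subset (Set.singleton_subset_iff.2 hi) h,
            (past_evs_of_mem hi).1 h'⟩
    · constructor
      · rintro ((h | h) | ⟨h, h'⟩)
        · exact absurd (h ▸ Or.inl rfl) hi
        · exact Or.inl h
        · exact absurd (h (Or.inl rfl)) hi
      · rintro (h | ⟨h, h'⟩)
        · exact Or.inl (Or.inr h)
        -- Without `i` nothing of `X` is present, so `s` is exactly the segment `m.ids`.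
        · have he := past_evs_of_notMem hi h'
          have : s = m.ids := by
            refine Set.Subset.antisymm (fun j hj => ?_) h
            rcases hs hj with (rfl | h) | ⟨e, h⟩
            · exact absurd hj hi
            · exact h
            · exact (Set.notMem_empty e (he ▸ ⟨j, hj, h⟩)).elim
          exact Or.inl (Or.inr (this ▸ m.ids_mem_segs))

theorem Below.wrap {m : Mem N} {D : IdConfStruct (Label N) ℕ} :
    ∀ {es : List (ℕ × Vis N × CCS N)} {X : Marked N}, Below (m.pushes es) X D → X.Valid →
    (m.pushes es).WF → Disjoint (m.pushes es).ids X.ran → Below m (X.wrap es) D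
  | [], _, h, _, _, _ => h
  | (i, l, Q) :: es, X, h, hX, hm, hd => by
    have hi : i ∉ X.ran := fun hi => Set.disjoint_left.1 hd (Or.inl rfl) hi
    refine Below.wrap (es := es) (h.past hX hm hd) (past_valid hX hi) hm.2.2 ?_
    rw [past_ran, Set.disjoint_insert_right]
    exact ⟨hm.1, hd.mono_left Set.subset_union_right⟩

end Marked
-- Memory encodings of parallel compositions
namespace IdConfStruct

variable {N : Type u}

theorem jointLabel_self (l : Vis N) : jointLabel (.vis l) (.vis l) = some (.vis l) := by
  simp [jointLabel, l.compl_ne]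

theorem jointLabel_compl (l : Vis N) : jointLabel (.vis l) (.vis l.compl) = some .tau := by
  simp [jointLabel]

variable {D D' : IdConfStruct (Label N) ℕ}

theorem parLabel_left {e : D.E} (h : ∀ e', D.ident e ≠ D'.ident e') :
    parLabel D D' (.left e) = some (D.lab e) := if_neg (not_exists.2 h)

theorem parLabel_right {e : D'.E} (h : ∀ e', D.ident e' ≠ D'.ident e) :
    parLabel D D' (.right e) = some (D'.lab e) := if_neg (not_exists.2 h)

theorem parLabel_both {e : D.E} {e' : D'.E} (h : D.ident e = D'.ident e') :
    parLabel D D' (.both e e') = jointLabel (D.lab e) (D'.lab e') := if_pos h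

/-- The events of a parallel composition of identified structures are those that carry the
identifiers of a parallel composition. -/
theorem parKey_of_isSome {p : StarProd D.E D'.E} (h : (parLabel D D' p).isSome) :
    Marked.parKey (some ∘ D.ident) (some ∘ D'.ident) p =
      some ((D.prod D').ident p).merge := by
  rcases p with e | e | ⟨e, e'⟩
  · refine Marked.parKey_left.2 ⟨rfl, fun f hf => ?_⟩
    rw [parLabel, if_pos ⟨f, (Option.some.inj hf).symm⟩] at h
    exact absurd h (by simp)
  · refine Marked.parKey_right.2 ⟨rfl, fun f hf => ?_⟩
    rw [parLabel, if_pos ⟨f, Option.some.inj hf⟩] at h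
    exact absurd h (by simp)
  · refine Marked.parKey_both.2 ⟨rfl, ?_⟩
    by_contra hf
    rw [parLabel, if_neg fun h => hf (congrArg some h.symm)] at h
    exact absurd h (by simp)

end IdConfStruct

namespace Marked

variable {N : Type u}

section parEvs

variable {A B : Type} {k : A → Option ℕ} {k' : B → Option ℕ} {s : Set ℕ}

/-- The events of a parallel composition with an identifier in `s`. -/
def parEvs (k : A → Option ℕ) (k' : B → Option ℕ) (s : Set ℕ) : Set (StarProd A B) :=
  {e | ∃ i ∈ s, parKey k k' e = some i}

theorem parEvs_subset : parEvs k k' s ⊆ parDom k k' := fun _ ⟨i, _, h⟩ => mem_parDom.2 ⟨i, h⟩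

theorem fstImage_parEvs : StarProd.fstImage (parEvs k k' s) = {a | ∃ i ∈ s, k a = some i} := by
  ext a
  constructor
  · rintro ⟨e, ⟨i, hi, he⟩, h⟩
    exact ⟨i, hi, key_fst_of_parKey he h⟩
  · rintro ⟨i, hi, ha⟩
    obtain ⟨e, he, h⟩ := exists_parKey_of_left (k' := k') ha
    exact ⟨e, ⟨i, hi, h⟩, he⟩

theorem sndImage_parEvs : StarProd.sndImage (parEvs k k' s) = {b | ∃ i ∈ s, k' b = some i} := by
  ext a
  constructor
  · rintro ⟨e, ⟨i, hi, he⟩, h⟩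
    exact ⟨i, hi, key_snd_of_parKey he h⟩
  · rintro ⟨i, hi, ha⟩
    obtain ⟨e, he, h⟩ := exists_parKey_of_right (k := k) ha
    exact ⟨e, ⟨i, hi, h⟩, he⟩

end parEvs

/-- Finiteness of the events makes `ConfStruct.mem_prod_C` available for products of memory
encodings. -/
theorem Below.finite {m : Mem N} {X : Marked N} {D : IdConfStruct (Label N) ℕ} (h : Below m X D)
    (hX : X.Valid) : Finite D.E := by
  have := hX.finite
  have hr : X.ran.Finite := by
    refine ((Set.finite_range X.key).preimage (Option.some_injective ℕ).injOn).subset ?_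
    rintro i ⟨e, he⟩
    exact ⟨e, he⟩
  have := (m.finite_ids.union hr).to_subtype
  exact Finite.of_injective (fun d => (⟨D.ident d, h.range ▸ ⟨d, rfl⟩⟩ : ↥(m.ids ∪ X.ran)))
    fun d d' hd => h.inj (congrArg Subtype.val hd)

theorem Below.preimage_mem_iff {m : Mem N} {X : Marked N} {D : IdConfStruct (Label N) ℕ}
    (h : Below m X D) (s : Set ℕ) :
    D.ident ⁻¹' s ∈ D.C ↔ Good m X (s ∩ (m.ids ∪ X.ran)) := by
  rw [h.conf, Set.image_preimage_eq_inter_range, h.range]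

section

variable {m : Mem N} {Y Z : Marked N} {D₁ D₂ : IdConfStruct (Label N) ℕ}

theorem good_par_iff (hm : Match Y Z) {s : Set ℕ} : Good m (Y.par Z) s ↔
    s ∈ m.segs ∨ (m.ids ⊆ s ∧ parEvs Y.key Z.key s ∈ (Y.S.prod Z.S).C) := by
  have : Subtype.val '' ((Y.par Z).evs s) = parEvs Y.key Z.key s := by
    ext e
    constructor
    · rintro ⟨e, he, rfl⟩
      exact he
    · rintro ⟨i, hi, he⟩
      exact ⟨⟨e, hm.isSome he⟩, ⟨i, hi, he⟩, rfl⟩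
  exact or_congr Iff.rfl (and_congr Iff.rfl (iff_of_eq (congrArg (· ∈ (Y.S.prod Z.S).C) this)))

theorem Good.left (hm : Match Y Z) {s : Set ℕ} (h : Good m (Y.par Z) s) :
    Good m Y (s ∩ (m.ids ∪ Y.ran)) := by
  rcases (good_par_iff hm).1 h with h | ⟨h, h'⟩
  · rw [Set.inter_eq_left.2 ((Mem.subset_ids_of_mem_segs h).trans Set.subset_union_left)]
    exact Or.inl h
  · refine Or.inr ⟨Set.subset_inter h Set.subset_union_left, ?_⟩
    rw [evs_inter Set.subset_union_right]
    have := h'.1.1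
    rwa [fstImage_parEvs] at this

theorem Good.right (hm : Match Y Z) {s : Set ℕ} (h : Good m (Y.par Z) s) :
    Good m Z (s ∩ (m.ids ∪ Z.ran)) := by
  rcases (good_par_iff hm).1 h with h | ⟨h, h'⟩
  · rw [Set.inter_eq_left.2 ((Mem.subset_ids_of_mem_segs h).trans Set.subset_union_left)]
    exact Or.inl h
  · refine Or.inr ⟨Set.subset_inter h Set.subset_union_left, ?_⟩
    rw [evs_inter Set.subset_union_right]
    have := h'.1.2
    rwa [sndImage_parEvs] at this

/-- Two identifiers in the memory are separated by one of its segments, an identifier in it from one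
outside by the whole memory, and two outside by a separating subconfiguration of the product, to
which the memory is added. -/
theorem Good.exists_separating (hY : Y.Valid) (hZ : Z.Valid) (hm : Match Y Z) (hw : m.WF)
    (h1 : Disjoint m.ids Y.ran) (h2 : Disjoint m.ids Z.ran) {s : Set ℕ}
    (hs : s ⊆ m.ids ∪ (Y.ran ∪ Z.ran)) (h : Good m (Y.par Z) s) {i j : ℕ} (hi : i ∈ s)
    (hj : j ∈ s) (hij : i ≠ j) : ∃ t ⊆ s, Good m (Y.par Z) t ∧ (i ∈ t ↔ j ∉ t) := by
  have := hY.finite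
  have := hZ.finite
  rcases (good_par_iff hm).1 h with h | ⟨h, h'⟩
  · have hsm := Mem.subset_ids_of_mem_segs h
    obtain ⟨t, ht, h'⟩ := Mem.exists_segs_separating hw (hsm hi) (hsm hj) hij
    rcases Mem.segs_chain ht h with h'' | h''
    · exact ⟨t, h'', Or.inl ht, h'⟩
    · exact absurd (h'' hj) (h'.1 (h'' hi))
  by_cases him : i ∈ m.ids <;> by_cases hjm : j ∈ m.ids
  · obtain ⟨t, ht, h''⟩ := Mem.exists_segs_separating hw him hjm hij
    exact ⟨t, (Mem.subset_ids_of_mem_segs ht).trans h, Or.inl ht, h''⟩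
  · exact ⟨m.ids, h, Or.inl m.ids_mem_segs, iff_of_true him hjm⟩
  · exact ⟨m.ids, h, Or.inl m.ids_mem_segs, iff_of_false him (not_not_intro hjm)⟩
  · rw [← par_ran hm] at hs
    obtain ⟨⟨p, _⟩, hp : parKey Y.key Z.key p = some i⟩ := (hs hi).resolve_left him
    obtain ⟨⟨q, _⟩, hq : parKey Y.key Z.key q = some j⟩ := (hs hj).resolve_left hjm
    have hpq : p ≠ q := fun hpq => hij (Option.some.inj (hp.symm.trans (hpq ▸ hq)))
    obtain ⟨z, hz, hz1, hz2, hz'⟩ :=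
      (ConfStruct.mem_prod_C.1 h').2.2.2 p ⟨i, hi, hp⟩ q ⟨j, hj, hq⟩ hpq
    have hmem : ∀ r n, parKey Y.key Z.key r = some n →
        (n ∈ m.ids ∪ {n | ∃ e ∈ z, parKey Y.key Z.key e = some n} ↔ r ∈ z) := by
      intro r n hr
      constructor
      · rintro (hn | ⟨e, he, hn⟩)
        · have : n ∈ (Y.par Z).ran := ⟨⟨r, hm.isSome hr⟩, hr⟩
          rw [par_ran hm] at this
          exact (this.elim (Set.disjoint_left.1 h1 hn) (Set.disjoint_left.1 h2 hn)).elim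
        · exact parKey_inj hY.inj hZ.inj hn hr ▸ he
      · exact fun h => Or.inr ⟨r, h, hr⟩
    refine ⟨m.ids ∪ {n | ∃ e ∈ z, parKey Y.key Z.key e = some n}, ?_, ?_, ?_⟩
    · refine Set.union_subset h ?_
      rintro n ⟨e, he, hn⟩
      obtain ⟨n', hn', hn''⟩ := hz he
      exact Option.some.inj (hn.symm.trans hn'') ▸ hn'
    · refine (good_par_iff hm).2 (Or.inr ⟨Set.subset_union_left, ?_⟩)
      have : parEvs Y.key Z.key (m.ids ∪ {n | ∃ e ∈ z, parKey Y.key Z.key e = some n}) = z := by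
        ext r
        constructor
        · rintro ⟨n, hn, hr⟩
          exact (hmem r n hr).1 hn
        · intro hr
          obtain ⟨n, -, hn⟩ := hz hr
          exact ⟨n, (hmem r n hn).2 hr, hn⟩
      rw [this]
      exact ConfStruct.prod_mem_of_subset hY.conf hZ.conf h' hz hz1 hz2
    · rw [hmem p i hp, hmem q j hq]
      exact hz'

/-- All events are compared through their identifiers: both compositions are instances of `parKey`,
once for the identifiers of `D₁` and `D₂`, defined on every event, and once for the partial ones of
`Y` and `Z`. Above `m` the two agree; the identifiers of `m` occur on both sides and give one pair
each. -/
theorem Below.par (b₁ : Below m Y D₁) (b₂ : Below m Z D₂) (hY : Y.Valid) (hZ : Z.Valid)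
    (hm : Match Y Z) (hd : (Y.par Z).dom ∈ (Y.par Z).S.C) (hw : m.WF)
    (h1 : Disjoint m.ids Y.ran) (h2 : Disjoint m.ids Z.ran) :
    Below m (Y.par Z) (D₁.par D₂) := by
  have := hY.finite
  have := hZ.finite
  have := b₁.finite hY
  have := b₂.finite hZ
  have hmem : ∀ i ∈ m.ids, (∃ a, D₁.ident a = i) ∧ ∃ b, D₂.ident b = i := fun i hi =>
    ⟨(b₁.range.symm ▸ Or.inl hi : i ∈ Set.range D₁.ident),
      (b₂.range.symm ▸ Or.inl hi : i ∈ Set.range D₂.ident)⟩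
  have hranY : ∀ i ∈ Y.ran, ∃ a, D₁.ident a = i := fun i hi =>
    (b₁.range.symm ▸ Or.inr hi : i ∈ Set.range D₁.ident)
  have hranZ : ∀ i ∈ Z.ran, ∃ b, D₂.ident b = i := fun i hi =>
    (b₂.range.symm ▸ Or.inr hi : i ∈ Set.range D₂.ident)
  -- Two copies of a memory event have the label recorded in `m`, so they form a fork and keep that
  -- label.
  have hpast : ∀ a b, D₁.ident a = D₂.ident b → D₁.ident a ∈ m.ids →
      ∃ l, m.HasLab (D₁.ident a) (.vis l) ∧
        IdConfStruct.parLabel D₁ D₂ (.both a b) = some (.vis l) := by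
    intro a b hab ha
    have ha' := b₁.hasLab a ha
    have hb' := b₂.hasLab b (hab ▸ ha)
    rw [← hab] at hb'
    obtain ⟨l, hl⟩ := ha'.exists_vis
    refine ⟨l, hl ▸ ha', ?_⟩
    rw [IdConfStruct.parLabel_both hab, ← ha'.unique hw hb', hl, IdConfStruct.jointLabel_self]
  -- A common identifier that is marked in `Y` and `Z` belongs to a synchronisation, by `Match`.
  have hnew : ∀ a b e f, D₁.ident a = D₂.ident b → Y.key e = some (D₁.ident a) →
      Z.key f = some (D₁.ident a) → (∃ l : Vis N, Y.S.lab e = .vis l ∧ Z.S.lab f = .vis l.compl) ∧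
      IdConfStruct.parLabel D₁ D₂ (.both a b) = some .tau := by
    intro a b e f hab he hf
    obtain ⟨l, hl, hl'⟩ := hm e f _ he hf
    refine ⟨⟨l, hl, hl'⟩, ?_⟩
    rw [IdConfStruct.parLabel_both hab, ← b₁.lab e a he, ← b₂.lab f b (hab ▸ hf), hl, hl',
      IdConfStruct.jointLabel_compl]
  -- Every pair with equal identifiers survives: the identifier lies in `m` on both sides or above
  -- `m` on both sides, since it cannot be in `m` and marked at once.
  have hsome : ∀ p i, parKey (some ∘ D₁.ident) (some ∘ D₂.ident) p = some i →
      (IdConfStruct.parLabel D₁ D₂ p).isSome := by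
    rintro (a | b | ⟨a, b⟩) i hp
    · obtain ⟨rfl, h⟩ := (parKey_left.1 hp).imp_left Option.some.inj
      rw [IdConfStruct.parLabel_left fun b hb => h b (congrArg some hb.symm)]
      rfl
    · obtain ⟨rfl, h⟩ := (parKey_right.1 hp).imp_left Option.some.inj
      rw [IdConfStruct.parLabel_right fun b hb => h b (congrArg some hb)]
      rfl
    · obtain ⟨rfl, h⟩ := (parKey_both.1 hp).imp Option.some.inj Option.some.inj
      rcases (b₁.range ▸ ⟨a, rfl⟩ : D₁.ident a ∈ m.ids ∪ Y.ran) with ha | ⟨e, he⟩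
      · obtain ⟨l, -, hl⟩ := hpast a b h.symm ha
        rw [hl]
        rfl
      · rcases (b₂.range ▸ ⟨b, rfl⟩ : D₂.ident b ∈ m.ids ∪ Z.ran) with hb | ⟨f, hf⟩
        · exact (Set.disjoint_left.1 h1 (h ▸ hb) ⟨e, he⟩).elim
        · rw [(hnew a b e f h.symm he (h ▸ hf)).2]
          rfl
  have hkey : ∀ p : (D₁.par D₂).E,
      parKey (some ∘ D₁.ident) (some ∘ D₂.ident) p.1 = some ((D₁.par D₂).ident p) :=
    fun p => IdConfStruct.parKey_of_isSome p.2
  have inj₁ : ∀ a a' i, (some ∘ D₁.ident) a = some i → (some ∘ D₁.ident) a' = some i → a = a' :=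
    fun a a' i h h' => b₁.inj (Option.some.inj (h.trans h'.symm))
  have inj₂ : ∀ a a' i, (some ∘ D₂.ident) a = some i → (some ∘ D₂.ident) a' = some i → a = a' :=
    fun a a' i h h' => b₂.inj (Option.some.inj (h.trans h'.symm))
  have hrange : Set.range (D₁.par D₂).ident = m.ids ∪ (Y.ran ∪ Z.ran) := by
    rw [Set.union_union_distrib_left, ← b₁.range, ← b₂.range]
    ext i
    constructor
    · rintro ⟨p, rfl⟩
      have hp := hkey p
      obtain ⟨a | b | ⟨a, b⟩, _⟩ := p
      · exact Or.inl ⟨a, rfl⟩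
      · exact Or.inr ⟨b, rfl⟩
      · exact Or.inl ⟨a, rfl⟩
    · rintro (⟨a, rfl⟩ | ⟨b, rfl⟩)
      · obtain ⟨p, -, hp⟩ := exists_parKey_of_left (k := some ∘ D₁.ident)
          (k' := some ∘ D₂.ident) (a := a) rfl
        exact ⟨⟨p, hsome p _ hp⟩, Option.some.inj ((hkey ⟨p, hsome p _ hp⟩).symm.trans hp)⟩
      · obtain ⟨p, -, hp⟩ := exists_parKey_of_right (k := some ∘ D₁.ident)
          (k' := some ∘ D₂.ident) (b := b) rfl
        exact ⟨⟨p, hsome p _ hp⟩, Option.some.inj ((hkey ⟨p, hsome p _ hp⟩).symm.trans hp)⟩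
  refine ⟨?_, ?_, ?_, ?_, ?_⟩
  · intro p q hpq
    refine Subtype.ext (parKey_inj inj₁ inj₂ (hkey p) ?_)
    rw [hpq]
    exact hkey q
  · rw [par_ran hm, hrange]
  · intro q p hq
    replace hq : parKey Y.key Z.key q.1 = some ((D₁.par D₂).ident p) := hq
    have hp := hkey p
    generalize hi : (D₁.par D₂).ident p = i at hq hp
    obtain ⟨e | f | ⟨e, f⟩, hq'⟩ := q <;> obtain ⟨a | b | ⟨a, b⟩, hp'⟩ := p
    · obtain ⟨rfl, h⟩ := (parKey_left.1 hp).imp_left Option.some.inj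
      refine (b₁.lab e a (parKey_left.1 hq).1).trans (Option.get_of_eq_some _ ?_).symm
      exact IdConfStruct.parLabel_left fun b hb => h b (congrArg some hb.symm)
    · obtain ⟨a, ha⟩ := hranY i ⟨e, (parKey_left.1 hq).1⟩
      exact absurd (congrArg some ha) ((parKey_right.1 hp).2 a)
    · obtain ⟨ha, hb⟩ := (parKey_both.1 hp).imp Option.some.inj Option.some.inj
      obtain ⟨he, hf⟩ := parKey_left.1 hq
      rcases (b₂.range ▸ ⟨b, rfl⟩ : D₂.ident b ∈ m.ids ∪ Z.ran) with h | ⟨f, hf'⟩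
      · exact (Set.disjoint_left.1 h1 (hb ▸ h) ⟨e, he⟩).elim
      · exact absurd (hb ▸ hf') (hf f)
    · obtain ⟨b, hb⟩ := hranZ i ⟨f, (parKey_right.1 hq).1⟩
      exact absurd (congrArg some hb) ((parKey_left.1 hp).2 b)
    · obtain ⟨rfl, h⟩ := (parKey_right.1 hp).imp_left Option.some.inj
      refine (b₂.lab f b (parKey_right.1 hq).1).trans (Option.get_of_eq_some _ ?_).symm
      exact IdConfStruct.parLabel_right fun a ha => h a (congrArg some ha)
    · obtain ⟨ha, hb⟩ := (parKey_both.1 hp).imp Option.some.inj Option.some.inj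
      obtain ⟨hf, he⟩ := parKey_right.1 hq
      rcases (b₁.range ▸ ⟨a, rfl⟩ : D₁.ident a ∈ m.ids ∪ Y.ran) with h | ⟨e, he'⟩
      · exact (Set.disjoint_left.1 h2 (ha ▸ h) ⟨f, hf⟩).elim
      · exact absurd (ha ▸ he') (he e)
    · obtain ⟨b, hb⟩ := hranZ i ⟨f, (parKey_both.1 hq).2⟩
      exact absurd (congrArg some hb) ((parKey_left.1 hp).2 b)
    · obtain ⟨a, ha⟩ := hranY i ⟨e, (parKey_both.1 hq).1⟩
      exact absurd (congrArg some ha) ((parKey_right.1 hp).2 a)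
    · obtain ⟨ha, hb⟩ := (parKey_both.1 hp).imp Option.some.inj Option.some.inj
      obtain ⟨he, hf⟩ := parKey_both.1 hq
      obtain ⟨⟨l, hl, hl'⟩, h⟩ := hnew a b e f (ha.trans hb.symm) (ha ▸ he) (ha ▸ hf)
      exact (lab_parBoth e f hl hl').trans (Option.get_of_eq_some _ h).symm
  · intro p hi
    have hp := hkey p
    generalize hi' : (D₁.par D₂).ident p = i at hi hp
    obtain ⟨⟨a', ha'⟩, ⟨b', hb'⟩⟩ := hmem i hi
    obtain ⟨a | b | ⟨a, b⟩, hp'⟩ := p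
    · exact absurd (congrArg some hb') ((parKey_left.1 hp).2 b')
    · exact absurd (congrArg some ha') ((parKey_right.1 hp).2 a')
    · obtain ⟨ha, hb⟩ := (parKey_both.1 hp).imp Option.some.inj Option.some.inj
      obtain ⟨l, hl, h⟩ := hpast a b (ha.trans hb.symm) (ha ▸ hi)
      rw [show (D₁.par D₂).lab ⟨.both a b, hp'⟩ = .vis l from Option.get_of_eq_some _ h]
      exact ha ▸ hl
  · intro x
    have hs : (D₁.par D₂).ident '' x ⊆ m.ids ∪ (Y.ran ∪ Z.ran) :=
      (Set.image_subset_range _ _).trans hrange.subset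
    -- A set of surviving events is determined by its identifiers, so the rest of the argument is
    -- about the set `s` of identifiers only.
    have himage : Subtype.val '' x =
        parEvs (some ∘ D₁.ident) (some ∘ D₂.ident) ((D₁.par D₂).ident '' x) := by
      ext p
      constructor
      · rintro ⟨p, hp, rfl⟩
        exact ⟨_, ⟨p, hp, rfl⟩, hkey p⟩
      · rintro ⟨_, ⟨q, hq, rfl⟩, h⟩
        exact ⟨q, hq, parKey_inj inj₁ inj₂ (hkey q) h⟩
    refine Iff.trans (b := parEvs (some ∘ D₁.ident) (some ∘ D₂.ident)
      ((D₁.par D₂).ident '' x) ∈ (D₁.toConfStruct.prod D₂.toConfStruct).C)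
      (iff_of_eq (congrArg (· ∈ (D₁.toConfStruct.prod D₂.toConfStruct).C) himage)) ?_
    generalize (D₁.par D₂).ident '' x = s at hs
    have hfst : ∀ t, StarProd.fstImage (parEvs (some ∘ D₁.ident) (some ∘ D₂.ident) t) ∈ D₁.C ↔
        Good m Y (t ∩ (m.ids ∪ Y.ran)) := fun t => by
      rw [fstImage_parEvs, ← b₁.preimage_mem_iff]
      simp [Set.preimage]
    have hsnd : ∀ t, StarProd.sndImage (parEvs (some ∘ D₁.ident) (some ∘ D₂.ident) t) ∈ D₂.C ↔
        Good m Z (t ∩ (m.ids ∪ Z.ran)) := fun t => by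
      rw [sndImage_parEvs, ← b₂.preimage_mem_iff]
      simp [Set.preimage]
    rw [ConfStruct.mem_prod_C]
    constructor
    · rintro ⟨hs1, hs2, -⟩
      replace hs1 := (hfst s).1 hs1
      replace hs2 := (hsnd s).1 hs2
      rw [good_par_iff hm]
      -- If `s` contains the whole memory, its projections are configurations of `Y` and `Z`, and
      -- lying inside the marked configuration makes the pair a configuration of their product.
      -- Otherwise both projections are segments of `m`, and nothing above `m` is present.
      by_cases hms : m.ids ⊆ s
      · have hs1 := hs1.evs_mem hY h1
        have hs2 := hs2.evs_mem hZ h2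
        rw [evs_inter Set.subset_union_right] at hs1 hs2
        refine Or.inr ⟨hms, ConfStruct.prod_mem_of_subset hY.conf hZ.conf
          ((par_dom_mem_iff hm).1 hd) parEvs_subset ?_ ?_⟩
        · rwa [fstImage_parEvs]
        · rwa [sndImage_parEvs]
      · replace hs1 := hs1.resolve_right fun h => hms (h.1.trans Set.inter_subset_left)
        replace hs2 := hs2.resolve_right fun h => hms (h.1.trans Set.inter_subset_left)
        have hsm : s ⊆ m.ids := by
          intro i hi
          rcases hs hi with h | h | h
          · exact h
          · exact Mem.subset_ids_of_mem_segs hs1 ⟨hi, Or.inr h⟩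
          · exact Mem.subset_ids_of_mem_segs hs2 ⟨hi, Or.inr h⟩
        rw [Set.inter_eq_left.2 (hsm.trans Set.subset_union_left)] at hs1
        exact Or.inl hs1
    · intro hg
      refine ⟨(hfst s).2 (hg.left hm), (hsnd s).2 (hg.right hm),
        fun e he e' he' => parDom_locInj inj₁ inj₂ e (parEvs_subset he) e' (parEvs_subset he'), ?_⟩
      rintro p ⟨i, hi, hp⟩ q ⟨j, hj, hq⟩ hpq
      have hij : i ≠ j := fun hij => hpq (parKey_inj inj₁ inj₂ hp (hij ▸ hq))
      obtain ⟨t, hts, ht, hij⟩ := hg.exists_separating hY hZ hm hw h1 h2 hs hi hj hij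
      have hmem : ∀ r n, parKey (some ∘ D₁.ident) (some ∘ D₂.ident) r = some n →
          (r ∈ parEvs (some ∘ D₁.ident) (some ∘ D₂.ident) t ↔ n ∈ t) := fun r n hr =>
        ⟨fun ⟨n', hn', h⟩ => Option.some.inj (hr.symm.trans h) ▸ hn', fun hn => ⟨n, hn, hr⟩⟩
      refine ⟨parEvs (some ∘ D₁.ident) (some ∘ D₂.ident) t, fun r ⟨n, hn, hr⟩ => ⟨n, hts hn, hr⟩,
        (hfst t).2 (ht.left hm), (hsnd t).2 (ht.right hm), ?_⟩
      rw [hmem p i hp, hmem q j hq]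
      exact hij

end

end Marked
-- The memory encoding of a represented process
namespace RProc

open Marked

variable {N : Type u}

theorem Rep.below {R : RProc N} : ∀ {m : Mem N} {X : Marked N}, R.Rep m X → Below m X R.enc := by
  induction R with
  | thread m' P =>
    rintro m X ⟨es, rfl, hw, ⟨f⟩⟩
    exact ((below_lift hw P).wrap (lift_valid P) hw
      (by rw [lift_ran]; exact Set.disjoint_empty _)).iso f
  | par R S ihR ihS =>
    rintro m X ⟨es, Y, Z, hR, hS, hw, hm, hd, ⟨f⟩⟩
    obtain ⟨hR1, hR2, -⟩ := hR.props
    obtain ⟨hS1, hS2, -⟩ := hS.props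
    have b := (ihR hR).par (ihS hS) hR1 hS1 hm hd hw hR2 hS2
    have b' : Below (m.pushes es) (Y.par Z) (R.par S).enc :=
      ⟨b.inj, b.range, b.lab, b.hasLab, b.conf⟩
    exact (b'.wrap (par_valid hR1 hS1 hd) hw
      (by rw [par_ran hm]; exact Set.disjoint_union_right.2 ⟨hR2, hS2⟩)).iso f
  | res R a ih =>
    rintro m X ⟨Y, hR, -, ha, ⟨f⟩⟩
    exact ((ih hR).res ha).iso f

end RProc

/-! ## Configurations and causality -/

namespace ConfStruct

variable {L : Type u} {S T : ConfStruct L}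

/-- The configurations below a given one are its subsets that are closed under causality. -/
theorem IsConfStruct.mem_iff_of_subset (hS : S.IsConfStruct) [Finite S.E] {x y : Set S.E}
    (hx : x ∈ S.C) (hy : y ⊆ x) : y ∈ S.C ↔ ∀ e ∈ y, ∀ d ∈ x, S.Le x d e → d ∈ y := by
  refine ⟨fun h e he d _ hd => hd y h hy he, fun h => ?_⟩
  have key : ∀ e ∈ y, ∃ z ∈ S.C, e ∈ z ∧ z ⊆ y := by
    intro e he
    -- A minimal configuration containing `e` is the least one inside `x`, because such
    -- configurations are closed under intersection; so all its elements are causes of `e` and lie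
    -- in `y`.
    obtain ⟨z, ⟨hz, hzx, hez⟩, hmin⟩ := (Set.toFinite {z | z ∈ S.C ∧ z ⊆ x ∧ e ∈ z}).exists_minimal
      ⟨x, hx, subset_rfl, hy he⟩
    refine ⟨z, hz, hez, fun d hd => h e he d (hzx hd) fun w hw hwx hew => ?_⟩
    exact (hmin ⟨hS.inter_mem hz hw hx hzx hwx, Set.inter_subset_left.trans hzx, hez, hew⟩
      Set.inter_subset_left hd).2
  have hU : ⋃₀ {z | z ∈ S.C ∧ z ⊆ y} = y := by
    refine Set.Subset.antisymm (Set.sUnion_subset fun z hz => hz.2) fun e he => ?_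
    obtain ⟨z, hz, hez, hzy⟩ := key e he
    exact ⟨z, ⟨hz, hzy⟩, hez⟩
  rw [← hU]
  exact hS.finite_complete _ (fun z hz => hz.1) ⟨x, hx, Set.toFinite x, fun z hz => hz.2.trans hy⟩

/-- The count of each label is the part of the bijection that is still comparable when two
successive bijections are unrelated. -/
theorem IsLabelOrderBij.ncard_eq {x₁ : Set S.E} {x₂ : Set T.E} {f : S.E → Option T.E}
    (h : IsLabelOrderBij S T x₁ x₂ f) (α : L) :
    {e ∈ x₁ | S.lab e = α}.ncard = {d ∈ x₂ | T.lab d = α}.ncard := by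
  choose g hg using fun e (he : e ∈ {e ∈ x₁ | S.lab e = α}) => (h.dom e).2 he.1
  refine Set.ncard_congr g (fun e he => ?_) (fun e e' he he' hee => ?_) fun d hd => ?_
  · exact ⟨(h.range _).1 ⟨e, hg e he⟩, (h.label _ _ (hg e he)).symm.trans he.2⟩
  · exact h.inj e e' _ (hg e he) (hee ▸ hg e' he')
  · obtain ⟨e, he⟩ := (h.range d).2 hd.1
    have hm : e ∈ {e ∈ x₁ | S.lab e = α} := ⟨(h.dom e).1 ⟨d, he⟩, (h.label _ _ he).trans hd.2⟩
    exact ⟨e, hm, Option.some.inj ((hg e hm).symm.trans he)⟩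

/-- Events that are added to corresponding configurations have the same label. -/
theorem IsLabelOrderBij.lab_eq [Finite S.E] [Finite T.E] {x₁ y₁ : Set S.E} {x₂ y₂ : Set T.E}
    {f g : S.E → Option T.E} (hf : IsLabelOrderBij S T x₁ x₂ f)
    (hg : IsLabelOrderBij S T y₁ y₂ g) {e₁ : S.E} {e₂ : T.E} (h₁ : S.Step x₁ e₁ y₁)
    (h₂ : T.Step x₂ e₂ y₂) : S.lab e₁ = T.lab e₂ := by
  by_contra hne
  obtain ⟨-, -, he₁, rfl⟩ := h₁
  obtain ⟨-, -, -, rfl⟩ := h₂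
  -- If the labels differed, the number of events labelled like `e₁` would increase on the first
  -- side and stay the same on the second.
  have h := hg.ncard_eq (S.lab e₁)
  have h1 : {e ∈ insert e₁ x₁ | S.lab e = S.lab e₁} =
      insert e₁ {e ∈ x₁ | S.lab e = S.lab e₁} := by
    ext e
    constructor
    · rintro ⟨rfl | he, hl⟩
      · exact Or.inl rfl
      · exact Or.inr ⟨he, hl⟩
    · rintro (rfl | ⟨he, hl⟩)
      · exact ⟨Or.inl rfl, rfl⟩
      · exact ⟨Or.inr he, hl⟩
  have h2 : {d ∈ insert e₂ x₂ | T.lab d = S.lab e₁} = {d ∈ x₂ | T.lab d = S.lab e₁} := by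
    ext d
    constructor
    · rintro ⟨rfl | hd, hl⟩
      · exact absurd hl.symm hne
      · exact ⟨hd, hl⟩
    · exact fun ⟨hd, hl⟩ => ⟨Or.inr hd, hl⟩
  rw [h1, h2, Set.ncard_insert_of_notMem (fun h => he₁ h.1) (Set.toFinite _),
    hf.ncard_eq] at h
  exact Nat.succ_ne_self _ h

/-- The transition from `x` to `y` in the direction `d`. -/
def DirStep (S : ConfStruct L) : Dir → Set S.E → S.E → Set S.E → Prop
  | .fwd, x, e, y => S.Step x e y
  | .bwd, x, e, y => S.Step y e x

end ConfStruct

/-! ## Identifiers of past events -/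

section Track

open Marked RProc

variable {N : Type u}

/-- The process `R`, derived from `P`, has performed the events of `x`, with identifiers `h`. -/
structure Track (P : CCS N) (R : RProc N) (x : Set P.enc.E) (h : P.enc.E → Option ℕ) : Prop where
  rep : R.Rep .empty ⟨P.enc, h⟩
  dom_eq : {e | h e ≠ none} = x

/-- The direction of extension of identifiers. -/
def Dir.Ext {A : Type} : Dir → (A → Option ℕ) → (A → Option ℕ) → Prop
  | .fwd, h, k => ∀ e i, h e = some i → k e = some i
  -- Definitionally the forward case with the two functions exchanged; this lets `isRestriction_iff`
  -- serve backward transitions too.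
  | .bwd, h, k => ∀ e i, k e = some i → h e = some i

theorem track_start (P : CCS N) : Track P (start P) ∅ fun _ => none :=
  ⟨rep_start P, Set.eq_empty_of_forall_notMem fun _ h => h rfl⟩

theorem ext_move {X : Marked N} {d : Dir} {e : X.S.E} {i : ℕ} (h : X.Can d e i) :
    d.Ext X.key (X.move d e i).key := by
  cases d with
  | fwd =>
    intro e' j hj
    refine key_move_eq_some.2 (Or.inr ⟨?_, hj⟩)
    rintro rfl
    exact Option.some_ne_none _ (hj.symm.trans h.key)
  | bwd =>
    intro e' j hj
    rcases key_move_eq_some.1 hj with ⟨-, h, -⟩ | ⟨-, h⟩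
    · exact absurd h (by simp)
    · exact h

namespace Track

variable {P : CCS N} {R R' : RProc N} {x y : Set P.enc.E} {h : P.enc.E → Option ℕ}

theorem mem_iff (t : Track P R x h) {e : P.enc.E} : e ∈ x ↔ ∃ i, h e = some i := by
  rw [← t.dom_eq]
  exact Option.ne_none_iff_exists'

theorem valid (t : Track P R x h) : (Marked.mk P.enc h).Valid := t.rep.props.1

theorem mem (t : Track P R x h) : x ∈ P.enc.C := t.dom_eq ▸ t.valid.dom_mem

theorem step (t : Track P R x h) {d : Dir} {i : ℕ} {α : Label N} (hs : Step d R i α R') :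
    ∃ e y k, P.enc.DirStep d x e y ∧ P.enc.lab e = α ∧ Track P R' y k ∧ d.Ext h k := by
  obtain ⟨e, hl, hc, hr⟩ := hs.rep (m := .empty) trivial t.rep
  refine ⟨e, (Marked.move d ⟨P.enc, h⟩ e i).dom, (Marked.move d ⟨P.enc, h⟩ e i).key, ?_, hl,
    ⟨hr, rfl⟩, ext_move hc⟩
  have hm : (Marked.move d ⟨P.enc, h⟩ e i).dom ∈ P.enc.C := hc.mem
  cases d with
  | fwd =>
    refine ⟨t.mem, hm, fun he => ?_, ?_⟩
    · obtain ⟨j, hj⟩ := t.mem_iff.1 he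
      exact Option.some_ne_none _ (hj.symm.trans hc.key)
    · rw [← t.dom_eq]
      exact dom_upd_some _ _ _
  | bwd =>
    have he : (Marked.move .bwd ⟨P.enc, h⟩ e i).dom = (Marked.mk P.enc h).dom \ {e} :=
      dom_upd_none _ _
    refine ⟨hm, t.mem, fun h' => ?_, ?_⟩
    · rw [he] at h'
      exact h'.2 rfl
    · rw [he, ← t.dom_eq]
      exact (Set.insert_sdiff_self_of_mem (mem_dom.2 ⟨i, hc.key⟩)).symm

theorem exists_step [Infinite N] (t : Track P R x h) {d : Dir} {e : P.enc.E}
    (hs : P.enc.DirStep d x e y) :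
    ∃ i R' k, Step d R i (P.enc.lab e) R' ∧ Track P R' y k ∧ d.Ext h k := by
  have key : ∃ i, (Marked.mk P.enc h).Can d e i ∧ (d = .fwd → i ∉ R.ids) ∧
      (Marked.move d ⟨P.enc, h⟩ e i).dom = y := by
    cases d with
    | fwd =>
      obtain ⟨-, hy, he, rfl⟩ := hs
      -- A forward step of configurations has no identifier of its own, and any unused one will do;
      -- a backward step has to use the identifier that the event carries.
      obtain ⟨i, hi⟩ := R.finite_ids.exists_notMem
      have hd : (Marked.move .fwd ⟨P.enc, h⟩ e i).dom = insert e x := by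
        rw [← t.dom_eq]
        exact dom_upd_some _ _ _
      refine ⟨i, ⟨?_, fun e' he' => absurd (t.rep.ran_subset ⟨e', he'⟩) hi, hd ▸ hy⟩,
        fun _ => hi, hd⟩
      by_contra hn
      exact he (t.mem_iff.2 (Option.ne_none_iff_exists'.1 hn))
    | bwd =>
      obtain ⟨hy, -, he, hx⟩ := hs
      obtain ⟨i, hi⟩ := t.mem_iff.1 (hx ▸ Or.inl rfl : e ∈ x)
      have hd : (Marked.move .bwd ⟨P.enc, h⟩ e i).dom = y := by
        have : (Marked.move .bwd ⟨P.enc, h⟩ e i).dom = x \ {e} := by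
          rw [← t.dom_eq]
          exact dom_upd_none _ _
        rw [this, hx]
        exact Set.insert_sdiff_self_of_notMem he
      exact ⟨i, ⟨hi, fun e' he' => t.valid.inj _ _ _ he' hi, hd ▸ hy⟩, fun hd => by simp at hd, hd⟩
  obtain ⟨i, hc, hi, rfl⟩ := key
  obtain ⟨R', hs, hr⟩ := t.rep.exists_step R.weight le_rfl hc hi
  exact ⟨i, R', (Marked.move d ⟨P.enc, h⟩ e i).key, hs, ⟨hr, rfl⟩, ext_move hc⟩

/-- The events of `⌊R⌋` as events of `⟦P⟧`. -/
theorem exists_event (t : Track P R x h) : ∃ φ : R.enc.E → P.enc.E,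
    Function.Injective φ ∧ (∀ d e, h e = some (R.enc.ident d) ↔ e = φ d) ∧ Set.range φ = x ∧
    (∀ d, P.enc.lab (φ d) = R.enc.lab d) ∧ ∀ y, y ∈ R.enc.C ↔ φ '' y ∈ P.enc.C := by
  have b := t.rep.below
  have hv := t.valid
  have hr : Set.range R.enc.ident = (Marked.mk P.enc h).ran := by
    rw [b.range]
    exact Set.empty_union _
  choose φ hφ using fun d => (hr ▸ ⟨d, rfl⟩ : R.enc.ident d ∈ (Marked.mk P.enc h).ran)
  refine ⟨φ, fun d d' hd => ?_, fun d e => ⟨fun he => hv.inj _ _ _ he (hφ d), ?_⟩, ?_,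
    fun d => b.lab _ _ (hφ d), fun y => ?_⟩
  · exact b.inj (Option.some.inj ((hφ d).symm.trans (hd ▸ hφ d')))
  · rintro rfl
    exact hφ d
  · ext e
    rw [t.mem_iff]
    constructor
    · rintro ⟨d, rfl⟩
      exact ⟨_, hφ d⟩
    · rintro ⟨i, hi⟩
      obtain ⟨d, rfl⟩ := (hr.symm ▸ ⟨e, hi⟩ : i ∈ Set.range R.enc.ident)
      exact ⟨d, hv.inj _ _ _ (hφ d) hi⟩
  · have himage : (Marked.mk P.enc h).evs (R.enc.ident '' y) = φ '' y := by
      ext e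
      constructor
      · rintro ⟨_, ⟨d, hd, rfl⟩, he⟩
        exact ⟨d, hd, hv.inj _ _ _ (hφ d) he⟩
      · rintro ⟨d, hd, rfl⟩
        exact ⟨_, ⟨d, hd, rfl⟩, hφ d⟩
    rw [b.conf, ← himage]
    refine ⟨fun hg => hg.evs_mem hv (Set.empty_disjoint _), fun hg => ?_⟩
    exact Or.inr ⟨Set.empty_subset _, hg⟩

end Track

/-! ## Isomorphisms of memories and bijections of events -/

/-- The isomorphism `f` of memories and the function `g` relate events with the same
identifiers. -/
def Compat {E₁ E₂ : Type} (h₁ : E₁ → Option ℕ) (h₂ : E₂ → Option ℕ) {R₁ R₂ : RProc N}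
    (f : MemIso R₁ R₂) (g : E₁ → Option E₂) : Prop :=
  ∀ e₁ e₂, g e₁ = some e₂ ↔
    ∃ d, h₁ e₁ = some (R₁.enc.ident d) ∧ h₂ e₂ = some (R₂.enc.ident (f.toEquiv d))

section

variable {P₁ P₂ : CCS N} {R₁ R₂ : RProc N} {x₁ : Set P₁.enc.E} {x₂ : Set P₂.enc.E}
  {h₁ : P₁.enc.E → Option ℕ} {h₂ : P₂.enc.E → Option ℕ}

/-- Causality in a configuration refers only to the configurations inside it, so it can be computed
in the memory encoding. -/
theorem le_image_iff {S : ConfStruct (Label N)} {D : ConfStruct (Label N)} {φ : D.E → S.E}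
    (hφ : Function.Injective φ) (hC : ∀ y, y ∈ D.C ↔ φ '' y ∈ S.C) (d d' : D.E) :
    S.Le (Set.range φ) (φ d) (φ d') ↔ ∀ y ∈ D.C, d' ∈ y → d ∈ y := by
  constructor
  · intro h y hy hd
    exact (hφ.mem_set_image).1 (h _ ((hC y).1 hy) (Set.image_subset_range _ _) ⟨d', hd, rfl⟩)
  · intro h y hy hyx hd
    rw [← Set.image_preimage_eq_of_subset hyx, ← hC] at hy
    exact h _ hy hd

theorem exists_compat (t₁ : Track P₁ R₁ x₁ h₁) (t₂ : Track P₂ R₂ x₂ h₂) (f : MemIso R₁ R₂) :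
    ∃ g, Compat h₁ h₂ f g := by
  classical
  obtain ⟨φ₁, hi₁, hk₁, -⟩ := t₁.exists_event
  obtain ⟨φ₂, hi₂, hk₂, -⟩ := t₂.exists_event
  refine ⟨fun e => if he : ∃ d, e = φ₁ d then some (φ₂ (f.toEquiv he.choose)) else none,
    fun e₁ e₂ => ?_⟩
  simp only [hk₁, hk₂]
  split_ifs with he
  · rw [Option.some.injEq]
    constructor
    · rintro rfl
      exact ⟨_, he.choose_spec, rfl⟩
    · rintro ⟨d, rfl, rfl⟩
      rw [← hi₁ he.choose_spec]
  · exact iff_of_false id fun ⟨d, hd, _⟩ => he ⟨d, hd⟩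

/-- The bijection is `f` conjugated by the embeddings of the two memories. An isomorphism preserves
configurations, hence the order defined from them. -/
theorem Compat.isLabelOrderBij (t₁ : Track P₁ R₁ x₁ h₁) (t₂ : Track P₂ R₂ x₂ h₂)
    {f : MemIso R₁ R₂} {g : P₁.enc.E → Option P₂.enc.E} (hc : Compat h₁ h₂ f g) :
    ConfStruct.IsLabelOrderBij P₁.enc P₂.enc x₁ x₂ g := by
  obtain ⟨φ₁, hi₁, hk₁, rfl, hl₁, hC₁⟩ := t₁.exists_event
  obtain ⟨φ₂, hi₂, hk₂, rfl, hl₂, hC₂⟩ := t₂.exists_event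
  have hg : ∀ e₁ e₂, g e₁ = some e₂ ↔ ∃ d, e₁ = φ₁ d ∧ e₂ = φ₂ (f.toEquiv d) := fun e₁ e₂ => by
    rw [hc]
    simp only [hk₁, hk₂]
  refine ⟨fun e => ?_, fun e => ?_, fun e e' d he he' => ?_, fun e d he => ?_,
    fun e e' d d' he he' => ?_⟩
  · constructor
    · rintro ⟨d, hd⟩
      obtain ⟨d, rfl, -⟩ := (hg _ _).1 hd
      exact ⟨d, rfl⟩
    · rintro ⟨d, rfl⟩
      exact ⟨_, (hg _ _).2 ⟨d, rfl, rfl⟩⟩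
  · constructor
    · rintro ⟨d, hd⟩
      obtain ⟨d, -, rfl⟩ := (hg _ _).1 hd
      exact ⟨_, rfl⟩
    · rintro ⟨d, rfl⟩
      exact ⟨_, (hg _ _).2 ⟨f.toEquiv.symm d, rfl, by rw [f.toEquiv.apply_symm_apply]⟩⟩
  · obtain ⟨c, rfl, rfl⟩ := (hg _ _).1 he
    obtain ⟨c', rfl, h⟩ := (hg _ _).1 he'
    rw [f.toEquiv.injective (hi₂ h)]
  · obtain ⟨c, rfl, rfl⟩ := (hg _ _).1 he
    rw [hl₁, hl₂, f.lab_eq]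
  · obtain ⟨c, rfl, rfl⟩ := (hg _ _).1 he
    obtain ⟨c', rfl, rfl⟩ := (hg _ _).1 he'
    rw [le_image_iff hi₁ hC₁, le_image_iff hi₂ hC₂]
    constructor
    · intro h y hy hc'
      have : y = f.toEquiv '' (f.toEquiv ⁻¹' y) := (f.toEquiv.image_preimage y).symm
      rw [this, ← f.conf_iff] at hy
      exact h _ hy hc'
    · intro h y hy hc'
      exact (f.toEquiv.injective.mem_set_image).1 (h _ ((f.conf_iff y).1 hy) ⟨c', hc', rfl⟩)

/-- Conversely the order determines the configurations: those inside `x₁` are its causally closed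
subsets, so an order isomorphism maps configurations to configurations. -/
theorem exists_memIso (t₁ : Track P₁ R₁ x₁ h₁) (t₂ : Track P₂ R₂ x₂ h₂)
    {g : P₁.enc.E → Option P₂.enc.E} (hg : ConfStruct.IsLabelOrderBij P₁.enc P₂.enc x₁ x₂ g) :
    ∃ f : MemIso R₁ R₂, Compat h₁ h₂ f g := by
  obtain ⟨φ₁, hi₁, hk₁, hr₁, hl₁, hC₁⟩ := t₁.exists_event
  obtain ⟨φ₂, hi₂, hk₂, hr₂, hl₂, hC₂⟩ := t₂.exists_event
  obtain ⟨_, hS₁⟩ := P₁.enc_isConfStruct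
  obtain ⟨_, hS₂⟩ := P₂.enc_isConfStruct
  have hex : ∀ d, ∃ d', g (φ₁ d) = some (φ₂ d') := fun d => by
    obtain ⟨e, he⟩ := (hg.dom (φ₁ d)).2 (hr₁ ▸ ⟨d, rfl⟩)
    obtain ⟨d', rfl⟩ := (hr₂ ▸ (hg.range e).1 ⟨_, he⟩ : e ∈ Set.range φ₂)
    exact ⟨d', he⟩
  choose f hf using hex
  have hfb : Function.Bijective f := by
    refine ⟨fun d d' hd => hi₁ (hg.inj _ _ _ (hf d) (hd ▸ hf d')), fun d => ?_⟩
    obtain ⟨e, he⟩ := (hg.range (φ₂ d)).2 (hr₂ ▸ ⟨d, rfl⟩)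
    obtain ⟨d', rfl⟩ := (hr₁ ▸ (hg.dom e).1 ⟨_, he⟩ : e ∈ Set.range φ₁)
    exact ⟨d', hi₂ (Option.some.inj ((hf d').symm.trans he))⟩
  -- Configurations of the memory described by causality alone, in a form used for both processes.
  have hmem : ∀ {P : CCS N} {R : RProc N} {x : Set P.enc.E} {φ : R.enc.E → P.enc.E},
      x ∈ P.enc.C → Set.range φ = x → Function.Injective φ →
      (∀ y, y ∈ R.enc.C ↔ φ '' y ∈ P.enc.C) → ∀ y, y ∈ R.enc.C ↔
        ∀ d ∈ y, ∀ d', P.enc.Le x (φ d') (φ d) → d' ∈ y := by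
    intro P R x φ hx hr hi hC y
    obtain ⟨_, hS⟩ := P.enc_isConfStruct
    subst hr
    rw [hC, hS.mem_iff_of_subset hx (Set.image_subset_range _ _), Set.forall_mem_image]
    refine forall₂_congr fun d _ => Set.forall_mem_range.trans (forall_congr' fun d' => ?_)
    rw [hi.mem_set_image]
  refine ⟨⟨Equiv.ofBijective f hfb, fun d => ?_, fun y => ?_⟩, fun e₁ e₂ => ?_⟩
  · exact (hl₂ _).symm.trans ((hg.label _ _ (hf d)).symm.trans (hl₁ d))
  · rw [hmem t₁.mem hr₁ hi₁ hC₁, hmem t₂.mem hr₂ hi₂ hC₂]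
    change _ ↔ ∀ d ∈ f '' y, ∀ d', P₂.enc.Le x₂ (φ₂ d') (φ₂ d) → d' ∈ f '' y
    rw [Set.forall_mem_image]
    refine forall₂_congr fun d _ => ?_
    rw [hfb.2.forall]
    refine forall_congr' fun d' => ?_
    rw [hfb.1.mem_set_image, hg.order _ _ _ _ (hf d') (hf d)]
  · simp only [hk₁, hk₂]
    constructor
    · intro he
      obtain ⟨d, rfl⟩ := (hr₁ ▸ (hg.dom e₁).1 ⟨_, he⟩ : e₁ ∈ Set.range φ₁)
      exact ⟨d, rfl, Option.some.inj (he.symm.trans (hf d))⟩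
    · rintro ⟨d, rfl, rfl⟩
      exact hf d

/-- Identifiers persist along the step, so being the same event of ⟦P⟧ and having the same
identifier are equivalent on the common part. -/
theorem isRestriction_iff {S₁ S₂ : RProc N} {k₁ : P₁.enc.E → Option ℕ} {k₂ : P₂.enc.E → Option ℕ}
    (t₁ : Track P₁ R₁ x₁ h₁) (t₂ : Track P₂ R₂ x₂ h₂) (e₁ : Dir.fwd.Ext h₁ k₁) (e₂ : Dir.fwd.Ext h₂ k₂)
    {f : MemIso R₁ R₂} {f' : MemIso S₁ S₂} {g g' : P₁.enc.E → Option P₂.enc.E}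
    (hc : Compat h₁ h₂ f g) (hc' : Compat k₁ k₂ f' g') :
    IsRestriction f f' ↔ ConfStruct.restr g' x₁ = g := by
  constructor
  · intro hr
    have key : ∀ e d, g e = some d → g' e = some d := by
      intro e d he
      obtain ⟨c, hc1, hc2⟩ := (hc e d).1 he
      obtain ⟨c', hc3, hc4⟩ := hr c
      exact (hc' e d).2 ⟨c', hc3 ▸ e₁ _ _ hc1, hc4 ▸ e₂ _ _ hc2⟩
    refine funext fun e => ?_
    by_cases he : e ∈ x₁
    · obtain ⟨d, hd⟩ := ((hc.isLabelOrderBij t₁ t₂).dom e).2 he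
      rw [ConfStruct.restr, if_pos he, hd, key _ _ hd]
    · rw [ConfStruct.restr, if_neg he]
      by_contra hn
      obtain ⟨d, hd⟩ := Option.ne_none_iff_exists'.1 (Ne.symm hn)
      exact he (((hc.isLabelOrderBij t₁ t₂).dom e).1 ⟨d, hd⟩)
  · rintro rfl d
    obtain ⟨φ₁, -, hk₁, hr₁, -⟩ := t₁.exists_event
    obtain ⟨φ₂, -, hk₂, -⟩ := t₂.exists_event
    have h1 := (hk₁ d _).2 rfl
    have h2 := (hk₂ (f.toEquiv d) _).2 rfl
    have h3 := (hc _ _).2 ⟨d, h1, h2⟩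
    rw [ConfStruct.restr, if_pos (hr₁ ▸ ⟨d, rfl⟩)] at h3
    obtain ⟨d', hd1, hd2⟩ := (hc' _ _).1 h3
    exact ⟨d', Option.some.inj (hd1.symm.trans (e₁ _ _ h1)),
      Option.some.inj (hd2.symm.trans (e₂ _ _ h2))⟩

end

end Track
/-! ## The correspondence of bisimulations -/

section Bisim

open RProc

variable {N : Type u} {keep her : Prop} {P₁ P₂ : CCS N}

theorem compat_start (P₁ P₂ : CCS N) : Compat (fun _ : P₁.enc.E => none)
    (fun _ : P₂.enc.E => none) (emptyIso P₁ P₂) fun _ => none :=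
  fun _ _ => iff_of_false (Option.some_ne_none _).symm fun ⟨_, h, _⟩ => Option.some_ne_none _ h.symm

/-- The relation on configurations induced by a relation on processes. -/
def confRel (P₁ P₂ : CCS N) (B : (R₁ R₂ : RProc N) → MemIso R₁ R₂ → Prop) (x₁ : Set P₁.enc.E)
    (x₂ : Set P₂.enc.E) (g : P₁.enc.E → Option P₂.enc.E) : Prop :=
  ∃ R₁ R₂ f h₁ h₂, B R₁ R₂ f ∧ Track P₁ R₁ x₁ h₁ ∧ Track P₂ R₂ x₂ h₂ ∧ Compat h₁ h₂ f g

/-- The relation on processes induced by a relation on configurations. -/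
def procRel (P₁ P₂ : CCS N)
    (R : Set P₁.enc.E → Set P₂.enc.E → (P₁.enc.E → Option P₂.enc.E) → Prop) (R₁ R₂ : RProc N)
    (f : MemIso R₁ R₂) : Prop :=
  (Reachable P₁ R₁ ∧ Reachable P₂ R₂) ∧ ∃ x₁ x₂ g h₁ h₂, R x₁ x₂ g ∧ Track P₁ R₁ x₁ h₁ ∧
    Track P₂ R₂ x₂ h₂ ∧ Compat h₁ h₂ f g

/-- A step of configurations is realised by a transition of the tracking process, matched there, and
the matching transition is read back as a step. The tracking data are part of the relation, so
reachability of the processes plays no role here. -/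
theorem CCS.IsBisim.confRel [Infinite N] {B : (R₁ R₂ : RProc N) → MemIso R₁ R₂ → Prop}
    (hB : CCS.IsBisim keep her P₁ P₂ B) :
    ConfStruct.IsBisim keep her P₁.enc P₂.enc (confRel P₁ P₂ B) where
  conf := fun _ _ _ ⟨_, _, _, _, _, _, t₁, t₂, _⟩ => ⟨t₁.mem, t₂.mem⟩
  init := ⟨_, _, _, _, _, hB.init, track_start P₁, track_start P₂, compat_start P₁ P₂⟩
  bij := fun _ _ _ ⟨_, _, _, _, _, _, t₁, t₂, hc⟩ => hc.isLabelOrderBij t₁ t₂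
  fwd₁ := by
    rintro x₁ x₂ g ⟨R₁, R₂, f, h₁, h₂, hb, t₁, t₂, hc⟩ e₁ y₁ hs
    obtain ⟨i, S₁, k₁, hs₁, s₁, he₁⟩ := t₁.exists_step (d := .fwd) hs
    obtain ⟨j, S₂, f', hs₂, hk, hb'⟩ := hB.fwd₁ _ _ _ hb _ _ _ hs₁
    obtain ⟨e₂, y₂, k₂, hs', -, s₂, he₂⟩ := t₂.step hs₂
    obtain ⟨g', hc'⟩ := exists_compat s₁ s₂ f'
    exact ⟨e₂, y₂, g', hs', fun h => (isRestriction_iff t₁ t₂ he₁ he₂ hc hc').1 (hk h),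
      S₁, S₂, f', k₁, k₂, hb', s₁, s₂, hc'⟩
  fwd₂ := by
    rintro x₁ x₂ g ⟨R₁, R₂, f, h₁, h₂, hb, t₁, t₂, hc⟩ e₂ y₂ hs
    obtain ⟨i, S₂, k₂, hs₂, s₂, he₂⟩ := t₂.exists_step (d := .fwd) hs
    obtain ⟨j, S₁, f', hs₁, hk, hb'⟩ := hB.fwd₂ _ _ _ hb _ _ _ hs₂
    obtain ⟨e₁, y₁, k₁, hs', -, s₁, he₁⟩ := t₁.step hs₁
    obtain ⟨g', hc'⟩ := exists_compat s₁ s₂ f'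
    exact ⟨e₁, y₁, g', hs', fun h => (isRestriction_iff t₁ t₂ he₁ he₂ hc hc').1 (hk h),
      S₁, S₂, f', k₁, k₂, hb', s₁, s₂, hc'⟩
  bwd₁ := by
    rintro hher x₁ x₂ g ⟨R₁, R₂, f, h₁, h₂, hb, t₁, t₂, hc⟩ e₁ y₁ hs
    obtain ⟨i, S₁, k₁, hs₁, s₁, he₁⟩ := t₁.exists_step (d := .bwd) hs
    obtain ⟨j, S₂, f', hs₂, hk, hb'⟩ := hB.bwd₁ hher _ _ _ hb _ _ _ hs₁
    obtain ⟨e₂, y₂, k₂, hs', -, s₂, he₂⟩ := t₂.step hs₂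
    obtain ⟨g', hc'⟩ := exists_compat s₁ s₂ f'
    exact ⟨e₂, y₂, g', hs', fun h => ((isRestriction_iff s₁ s₂ he₁ he₂ hc' hc).1 (hk h)).symm,
      S₁, S₂, f', k₁, k₂, hb', s₁, s₂, hc'⟩
  bwd₂ := by
    rintro hher x₁ x₂ g ⟨R₁, R₂, f, h₁, h₂, hb, t₁, t₂, hc⟩ e₂ y₂ hs
    obtain ⟨i, S₂, k₂, hs₂, s₂, he₂⟩ := t₂.exists_step (d := .bwd) hs
    obtain ⟨j, S₁, f', hs₁, hk, hb'⟩ := hB.bwd₂ hher _ _ _ hb _ _ _ hs₂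
    obtain ⟨e₁, y₁, k₁, hs', -, s₁, he₁⟩ := t₁.step hs₁
    obtain ⟨g', hc'⟩ := exists_compat s₁ s₂ f'
    exact ⟨e₁, y₁, g', hs', fun h => ((isRestriction_iff s₁ s₂ he₁ he₂ hc' hc).1 (hk h)).symm,
      S₁, S₂, f', k₁, k₂, hb', s₁, s₂, hc'⟩

theorem reachable_step {P : CCS N} {R S : RProc N} {d : Dir} {i : ℕ} {α : Label N}
    (hr : Reachable P R) (h : Step d R i α S) : Reachable P S := hr.tail ⟨d, i, α, h⟩

/-- The same transport in the opposite direction. Reachability is carried along, and the isomorphism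
of the new memories is built from the bijection by `exists_memIso`. -/
theorem ConfStruct.IsBisim.procRel [Infinite N]
    {R : Set P₁.enc.E → Set P₂.enc.E → (P₁.enc.E → Option P₂.enc.E) → Prop}
    (hR : ConfStruct.IsBisim keep her P₁.enc P₂.enc R) :
    CCS.IsBisim keep her P₁ P₂ (procRel P₁ P₂ R) := by
  have := P₁.enc_isConfStruct.1
  have := P₂.enc_isConfStruct.1
  refine ⟨fun _ _ _ h => h.1, ⟨⟨.refl, .refl⟩, _, _, _, _, _, hR.init, track_start P₁,
    track_start P₂, compat_start P₁ P₂⟩, ?_, ?_, ?_, ?_⟩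
  · rintro R₁ R₂ f ⟨⟨r₁, r₂⟩, x₁, x₂, g, h₁, h₂, hr, t₁, t₂, hc⟩ i α S₁ hs₁
    obtain ⟨e₁, y₁, k₁, hs, rfl, s₁, he₁⟩ := t₁.step hs₁
    obtain ⟨e₂, y₂, g', hs', hk, hr'⟩ := hR.fwd₁ _ _ _ hr _ _ hs
    obtain ⟨j, S₂, k₂, hs₂, s₂, he₂⟩ := t₂.exists_step (d := .fwd) hs'
    -- The matching event is not required to have the same label; the bijections before and after
    -- the step force it.
    rw [← (hR.bij _ _ _ hr).lab_eq (hR.bij _ _ _ hr') hs hs'] at hs₂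
    obtain ⟨f', hc'⟩ := exists_memIso s₁ s₂ (hR.bij _ _ _ hr')
    exact ⟨j, S₂, f', hs₂, fun h => (isRestriction_iff t₁ t₂ he₁ he₂ hc hc').2 (hk h),
      ⟨reachable_step r₁ hs₁, reachable_step r₂ hs₂⟩, y₁, y₂, g', k₁, k₂, hr', s₁, s₂, hc'⟩
  · rintro R₁ R₂ f ⟨⟨r₁, r₂⟩, x₁, x₂, g, h₁, h₂, hr, t₁, t₂, hc⟩ i α S₂ hs₂
    obtain ⟨e₂, y₂, k₂, hs, rfl, s₂, he₂⟩ := t₂.step hs₂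
    obtain ⟨e₁, y₁, g', hs', hk, hr'⟩ := hR.fwd₂ _ _ _ hr _ _ hs
    obtain ⟨j, S₁, k₁, hs₁, s₁, he₁⟩ := t₁.exists_step (d := .fwd) hs'
    rw [(hR.bij _ _ _ hr).lab_eq (hR.bij _ _ _ hr') hs' hs] at hs₁
    obtain ⟨f', hc'⟩ := exists_memIso s₁ s₂ (hR.bij _ _ _ hr')
    exact ⟨j, S₁, f', hs₁, fun h => (isRestriction_iff t₁ t₂ he₁ he₂ hc hc').2 (hk h),
      ⟨reachable_step r₁ hs₁, reachable_step r₂ hs₂⟩, y₁, y₂, g', k₁, k₂, hr', s₁, s₂, hc'⟩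
  · rintro hher R₁ R₂ f ⟨⟨r₁, r₂⟩, x₁, x₂, g, h₁, h₂, hr, t₁, t₂, hc⟩ i α S₁ hs₁
    obtain ⟨e₁, y₁, k₁, hs, rfl, s₁, he₁⟩ := t₁.step hs₁
    obtain ⟨e₂, y₂, g', hs', hk, hr'⟩ := hR.bwd₁ hher _ _ _ hr _ _ hs
    obtain ⟨j, S₂, k₂, hs₂, s₂, he₂⟩ := t₂.exists_step (d := .bwd) hs'
    rw [← (hR.bij _ _ _ hr').lab_eq (hR.bij _ _ _ hr) hs hs'] at hs₂
    obtain ⟨f', hc'⟩ := exists_memIso s₁ s₂ (hR.bij _ _ _ hr')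
    exact ⟨j, S₂, f', hs₂, fun h => (isRestriction_iff s₁ s₂ he₁ he₂ hc' hc).2 (hk h).symm,
      ⟨reachable_step r₁ hs₁, reachable_step r₂ hs₂⟩, y₁, y₂, g', k₁, k₂, hr', s₁, s₂, hc'⟩
  · rintro hher R₁ R₂ f ⟨⟨r₁, r₂⟩, x₁, x₂, g, h₁, h₂, hr, t₁, t₂, hc⟩ i α S₂ hs₂
    obtain ⟨e₂, y₂, k₂, hs, rfl, s₂, he₂⟩ := t₂.step hs₂
    obtain ⟨e₁, y₁, g', hs', hk, hr'⟩ := hR.bwd₂ hher _ _ _ hr _ _ hs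
    obtain ⟨j, S₁, k₁, hs₁, s₁, he₁⟩ := t₁.exists_step (d := .bwd) hs'
    rw [(hR.bij _ _ _ hr').lab_eq (hR.bij _ _ _ hr) hs' hs] at hs₁
    obtain ⟨f', hc'⟩ := exists_memIso s₁ s₂ (hR.bij _ _ _ hr')
    exact ⟨j, S₁, f', hs₁, fun h => (isRestriction_iff s₁ s₂ he₁ he₂ hc' hc).2 (hk h).symm,
      ⟨reachable_step r₁ hs₁, reachable_step r₂ hs₂⟩, y₁, y₂, g', k₁, k₂, hr', s₁, s₂, hc'⟩

theorem exists_isBisim_iff [Infinite N] (keep her : Prop) (P₁ P₂ : CCS N) :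
    (∃ B, CCS.IsBisim keep her P₁ P₂ B) ↔
      ∃ R, ConfStruct.IsBisim keep her P₁.enc P₂.enc R :=
  ⟨fun ⟨_, h⟩ => ⟨_, h.confRel⟩, fun ⟨_, h⟩ => ⟨_, h.procRel⟩⟩

end Bisim

end RevCCS

theorem mainTheorem1 {N : Type u} [Infinite N] (P₁ P₂ : RevCCS.CCS N) :
    (RevCCS.CCS.HHPB P₁ P₂ ↔ RevCCS.ConfStruct.HHPB P₁.enc P₂.enc) ∧
    (RevCCS.CCS.WfHHPB P₁ P₂ ↔ RevCCS.ConfStruct.WfHHPB P₁.enc P₂.enc) ∧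
    (RevCCS.CCS.HPB P₁ P₂ ↔ RevCCS.ConfStruct.HPB P₁.enc P₂.enc) ∧
    (RevCCS.CCS.WfHPB P₁ P₂ ↔ RevCCS.ConfStruct.WfHPB P₁.enc P₂.enc) :=
  ⟨RevCCS.exists_isBisim_iff True True P₁ P₂, RevCCS.exists_isBisim_iff False True P₁ P₂,
    RevCCS.exists_isBisim_iff True False P₁ P₂, RevCCS.exists_isBisim_iff False False P₁ P₂⟩
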